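/- **Setting.** Formulas are built from variables $p_i$, $\bot$, $\top$, $\land$, $\lor$, $\to$, $\Box$. A logic $L$ is given by an arbitrary selection (in particular one containing C) of the axioms M, C, N, T, P, D and of the rules $\mathrm{RD}_n^+$, $n\ge 1$, added to the basic non-normal modal logic E. A *block* $\langle\Sigma\rangle$ is given by a finite multiset $\Sigma$ of formulas; a *sequent* $\Gamma\Rightarrow\Delta$ has a finite multiset $\Gamma$ of formulas and blocks and a finite multiset $\Delta$ of formulas; a *hypersequent* is a finite multiset $S_1\mid\dots\mid S_k$ of sequents, its components. The calculus $\mathcal H_L^-$ (the hypersequent calculus for $L$ with all principal formulas and blocks deleted from the premisses) has, in a hypersequent context $G$, the axioms $p,\Gamma\Rightarrow\Delta,p$; $\ \bot,\Gamma\Rightarrow\Delta$; $\ \Gamma\Rightarrow\Delta,\top$; the usual two-sided propositional rules without copies of the principal formula; and the following rules, written "conclusion / premisses": * $\mathsf L\Box$: $\Gamma,\Box A\Rightarrow\Delta\ /\ \Gamma,\langle A\rangle\Rightarrow\Delta$; * without M, $\mathsf R\Box$: $\Gamma,\langle\Sigma\rangle\Rightarrow\Box B,\Delta\ /\ \Gamma\Rightarrow\Delta\mid\Sigma\Rightarrow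 B$ and $\Gamma\Rightarrow\Delta\mid B\Rightarrow A$ for all $A\in\Sigma$; with M, the same rule with the first premiss only; * with N: $\Gamma\Rightarrow\Delta\ /\ \Gamma,\langle\top\rangle\Rightarrow\Delta$; * with C: $\Gamma,\langle\Sigma\rangle,\langle\Pi\rangle\Rightarrow\Delta\ /\ \Gamma,\langle\Sigma,\Pi\rangle\Rightarrow\Delta$; * with T: $\Gamma,\langle\Sigma\rangle\Rightarrow\Delta\ /\ \Gamma,\Sigma\Rightarrow\Delta$; * with P, or with D and M: $\Gamma,\langle\Sigma\rangle\Rightarrow\Delta\ /\ \Gamma\Rightarrow\Delta\mid\Sigma\Rightarrow$; * with D and without M, $\mathsf D_1$: $\Gamma,\langle\Sigma\rangle\Rightarrow\Delta\ /\ \Gamma\Rightarrow\Delta\mid\Sigma\Rightarrow$ and $\Gamma\Rightarrow\Delta\mid{}\Rightarrow A$ for all $A\in\Sigma$; and $\mathsf D_2$: $\Gamma,\langle\Sigma\rangle,\langle\Pi\rangle\Rightarrow\Delta\ /\ \Gamma\Rightarrow\Delta\mid\Sigma,\Pi\Rightarrow$ and $\Gamma\Rightarrow\Delta\mid{}\Rightarrow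 A,B$ for all $A\in\Sigma$, $B\in\Pi$; with D and M, $\mathsf D_2$ with the first premiss only; * with $\mathrm{RD}_n^+$, for every $1\le m\le n$: $\Gamma,\langle\Sigma_1\rangle,\dots,\langle\Sigma_m\rangle\Rightarrow\Delta\ /\ \Gamma\Rightarrow\Delta\mid\Sigma_1,\dots,\Sigma_m\Rightarrow$. *Backwards proof search* for $G$: if N belongs to $L$, the rule N is first applied once to every component of $G$. Then, repeatedly, an application of a rule other than N with the present hypersequent as its conclusion is guessed existentially, one of its premisses is chosen universally, and, if N belongs to $L$, N is applied once to each component that the rule has newly created. The search succeeds if there is a choice of guesses for which every branch ends in an axiom. A *run* is any sequence of such choices; its length is the number of guessed rule applications. The size $|G|$ is the number of symbols of $G$ (each occurrence of a variable counts one). **Theorem.** Let $L$ be any such logic. 1. $G$ is derivable in $\mathcal H_L^-$ if and only if backwards proof search for $G$ succeeds. Moreover there are polynomials $p,q$ such that for every $G$ this is also equivalent to the success of the search in which every run is cut off after $p(|G|)$ rule applications, and all hypersequents reached by runs from $G$ of length at most $p(|G|)$ have size at most $q(|G|)$. 2. Unless $L$ contains N together with at least one of P, D, $\mathrm{RD}_n^+$,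 no cut-off is needed: there is a polynomial $p$ such that every run of the search from $G$ has length at most $p(|G|)$ and only reaches hypersequents of size at most $p(|G|)$. 3. Derivability in $\mathcal H_L^-$, as a set of strings over a finite alphabet (formulas in prefix notation, indices of variables in binary), is decided in alternating polynomial time: some alternating Turing machine, all of whose computation paths on inputs of length $n$ have length polynomial in $n$, accepts exactly the strings that denote derivable hypersequents. 4. Hence derivability in $\mathcal H_L^-$ is in $\mathsf{PSPACE}$ (a deterministic machine with polynomial space decides it). -/

import Mathlib

namespace NNML

/-! ### Formulas and logics -/

/-- Formulas of the propositional modal language over the variables `p₀, p₁, p₂, …`. -/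
inductive Formula : Type
  | atom (i : ℕ)
  | bot
  | top
  | and (A B : Formula)
  | or (A B : Formula)
  | imp (A B : Formula)
  | box (A : Formula)

/-- A non-normal modal logic: an arbitrary selection of the axioms M, C, N, T, P, D and of the
rules `RD_n⁺` (`n ≥ 1`), on top of the basic logic E. -/
structure Logic where
  M : Bool
  C : Bool
  N : Bool
  T : Bool
  P : Bool
  D : Bool
  RD : Set ℕ+

/-! ### Hypersequents -/

/-- A sequent `Γ, ⟨Σ₁⟩, …, ⟨Σₘ⟩ ⇒ Δ`. The antecedent, a multiset of formulas and blocks, is given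
by the multiset `form` of its formulas and the multiset `blocks` of its blocks; a block is a
multiset of formulas. -/
structure Sequent where
  form : Multiset Formula
  blocks : Multiset (Multiset Formula)
  succ : Multiset Formula

/-- A hypersequent is a finite multiset of sequents, its components. -/
abbrev Hypersequent := Multiset Sequent

/-- The number of symbols of a formula, each occurrence of a variable counting as one. -/
def Formula.size : Formula → ℕ
  | atom _ => 1
  | bot => 1
  | top => 1
  | and A B => A.size + B.size + 1
  | or A B => A.size + B.size + 1
  | imp A B => A.size + B.size + 1
  | box A => A.size + 1

def formulasSize (X : Multiset Formula) : ℕ := (X.map Formula.size).sum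

def Sequent.size (S : Sequent) : ℕ :=
  formulasSize S.form + (S.blocks.map fun X => formulasSize X + 1).sum + formulasSize S.succ + 1

def hypersequentSize (G : Hypersequent) : ℕ := (G.map Sequent.size).sum

/-! ### The calculus -/

/-- What one premiss of a rule puts in the place of the component that is active in the
conclusion: the remainder of that component, and the newly created components. -/
structure Premiss where
  rest : Sequent
  created : Multiset Sequent

/-- The premiss `G ∣ rest ∣ created` in the context `G`. -/
def Premiss.fill (P : Premiss) (G : Hypersequent) : Hypersequent :=
  P.rest ::ₘ (P.created + G)

/-- `Rule L S Ps`: apart from the rule N (treated separately), the calculus for `L` without copying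
of principal formulas and blocks has a rule with active component `S` in the conclusion and with
the premisses `Ps`. Here `⟨Γ, Θ, Δ⟩` is the sequent `Γ, Θ ⇒ Δ` with formulas `Γ` and blocks `Θ`. -/
inductive Rule (L : Logic) : Sequent → Multiset Premiss → Prop
  | init (p : ℕ) (Γ Θ Δ) :
      Rule L ⟨.atom p ::ₘ Γ, Θ, .atom p ::ₘ Δ⟩ 0
  | botL (Γ Θ Δ) :
      Rule L ⟨.bot ::ₘ Γ, Θ, Δ⟩ 0
  | topR (Γ Θ Δ) :
      Rule L ⟨Γ, Θ, .top ::ₘ Δ⟩ 0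
  | impL (A B Γ Θ Δ) :
      Rule L ⟨.imp A B ::ₘ Γ, Θ, Δ⟩ {⟨⟨Γ, Θ, A ::ₘ Δ⟩, 0⟩, ⟨⟨B ::ₘ Γ, Θ, Δ⟩, 0⟩}
  | impR (A B Γ Θ Δ) :
      Rule L ⟨Γ, Θ, .imp A B ::ₘ Δ⟩ {⟨⟨A ::ₘ Γ, Θ, B ::ₘ Δ⟩, 0⟩}
  | andL (A B Γ Θ Δ) :
      Rule L ⟨.and A B ::ₘ Γ, Θ, Δ⟩ {⟨⟨A ::ₘ B ::ₘ Γ, Θ, Δ⟩, 0⟩}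
  | andR (A B Γ Θ Δ) :
      Rule L ⟨Γ, Θ, .and A B ::ₘ Δ⟩ {⟨⟨Γ, Θ, A ::ₘ Δ⟩, 0⟩, ⟨⟨Γ, Θ, B ::ₘ Δ⟩, 0⟩}
  | orL (A B Γ Θ Δ) :
      Rule L ⟨.or A B ::ₘ Γ, Θ, Δ⟩ {⟨⟨A ::ₘ Γ, Θ, Δ⟩, 0⟩, ⟨⟨B ::ₘ Γ, Θ, Δ⟩, 0⟩}
  | orR (A B Γ Θ Δ) :
      Rule L ⟨Γ, Θ, .or A B ::ₘ Δ⟩ {⟨⟨Γ, Θ, A ::ₘ B ::ₘ Δ⟩, 0⟩}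
  | boxL (A Γ Θ Δ) :
      Rule L ⟨.box A ::ₘ Γ, Θ, Δ⟩ {⟨⟨Γ, {A} ::ₘ Θ, Δ⟩, 0⟩}
  | boxR (h : L.M = false) (X B Γ Θ Δ) :
      Rule L ⟨Γ, X ::ₘ Θ, .box B ::ₘ Δ⟩
        (⟨⟨Γ, Θ, Δ⟩, {⟨X, 0, {B}⟩}⟩ ::ₘ X.map fun A => ⟨⟨Γ, Θ, Δ⟩, {⟨{B}, 0, {A}⟩}⟩)
  | boxRm (h : L.M = true) (X B Γ Θ Δ) :
      Rule L ⟨Γ, X ::ₘ Θ, .box B ::ₘ Δ⟩ {⟨⟨Γ, Θ, Δ⟩, {⟨X, 0, {B}⟩}⟩}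
  | c (h : L.C = true) (X Y Γ Θ Δ) :
      Rule L ⟨Γ, X ::ₘ Y ::ₘ Θ, Δ⟩ {⟨⟨Γ, (X + Y) ::ₘ Θ, Δ⟩, 0⟩}
  | t (h : L.T = true) (X Γ Θ Δ) :
      Rule L ⟨Γ, X ::ₘ Θ, Δ⟩ {⟨⟨X + Γ, Θ, Δ⟩, 0⟩}
  /-- The rule P, which also belongs to the monotonic calculi with axiom D. -/
  | p (h : L.P = true ∨ (L.D = true ∧ L.M = true)) (X Γ Θ Δ) :
      Rule L ⟨Γ, X ::ₘ Θ, Δ⟩ {⟨⟨Γ, Θ, Δ⟩, {⟨X, 0, 0⟩}⟩}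
  | d₁ (h : L.D = true) (hM : L.M = false) (X Γ Θ Δ) :
      Rule L ⟨Γ, X ::ₘ Θ, Δ⟩
        (⟨⟨Γ, Θ, Δ⟩, {⟨X, 0, 0⟩}⟩ ::ₘ X.map fun A => ⟨⟨Γ, Θ, Δ⟩, {⟨0, 0, {A}⟩}⟩)
  | d₂ (h : L.D = true) (hM : L.M = false) (X Y Γ Θ Δ) :
      Rule L ⟨Γ, X ::ₘ Y ::ₘ Θ, Δ⟩
        (⟨⟨Γ, Θ, Δ⟩, {⟨X + Y, 0, 0⟩}⟩ ::ₘ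
          (X ×ˢ Y).map fun AB => ⟨⟨Γ, Θ, Δ⟩, {⟨0, 0, {AB.1, AB.2}⟩}⟩)
  /-- The monotonic version of the rule for axiom D. -/
  | dM (h : L.D = true) (hM : L.M = true) (X Y Γ Θ Δ) :
      Rule L ⟨Γ, X ::ₘ Y ::ₘ Θ, Δ⟩ {⟨⟨Γ, Θ, Δ⟩, {⟨X + Y, 0, 0⟩}⟩}
  /-- The rules `D_m⁺` with `1 ≤ m ≤ n`, all of which belong to the calculi with `RD_n⁺`; `Ξ` is
  the multiset of the `m` principal blocks. -/
  | dPlus (n : ℕ+) (h : n ∈ L.RD) (Ξ : Multiset (Multiset Formula))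
      (h₁ : 1 ≤ Ξ.card) (hn : Ξ.card ≤ n) (Γ Θ Δ) :
      Rule L ⟨Γ, Ξ + Θ, Δ⟩ {⟨⟨Γ, Θ, Δ⟩, {⟨Ξ.join, 0, 0⟩}⟩}

/-- The sequent `S` with the block `⟨⊤⟩` added to its antecedent: the rule N read backwards. -/
def Sequent.addTop (S : Sequent) : Sequent := ⟨S.form, {Formula.top} ::ₘ S.blocks, S.succ⟩

/-- Derivability in the calculus for `L` without copying of principal formulas and blocks. -/
inductive Derivable (L : Logic) : Hypersequent → Prop
  | rule {S : Sequent} {Ps : Multiset Premiss} (G : Hypersequent) (h : Rule L S Ps)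
      (hP : ∀ P ∈ Ps, Derivable L (P.fill G)) : Derivable L (S ::ₘ G)
  | n (h : L.N = true) (G : Hypersequent) (S : Sequent) (hP : Derivable L (S.addTop ::ₘ G)) :
      Derivable L (S ::ₘ G)

/-! ### Backwards proof search -/

/-- If the calculus for `L` has the rule N, apply it once (backwards) to `S`. -/
def applyN (L : Logic) (S : Sequent) : Sequent := if L.N then S.addTop else S

/-- The hypersequent with which the search for `G` starts: N has been applied to every
component. -/
def searchStart (L : Logic) (G : Hypersequent) : Hypersequent := G.map (applyN L)

/-- The hypersequent with which the search proceeds to a premiss: N has been applied to the newly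
created components. -/
def Premiss.searchFill (L : Logic) (P : Premiss) (G : Hypersequent) : Hypersequent :=
  P.rest ::ₘ (P.created.map (applyN L) + G)

/-- `SearchSucceeds L n H`: the alternating search succeeds from `H` when every branch is cut off
after `n` guessed rule applications. A rule application with conclusion `H` is guessed
(existential choice), and the search has to succeed from all of its premisses (universal
choice). -/
inductive SearchSucceeds (L : Logic) : ℕ → Hypersequent → Prop
  | step {n : ℕ} {S : Sequent} {Ps : Multiset Premiss} (G : Hypersequent) (h : Rule L S Ps)
      (hP : ∀ P ∈ Ps, SearchSucceeds L n (P.searchFill L G)) : SearchSucceeds L (n + 1) (S ::ₘ G)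

/-- `SearchRun L n H H'`: some sequence of `n` existential and universal choices of the search
leads from `H` to `H'`. -/
inductive SearchRun (L : Logic) : ℕ → Hypersequent → Hypersequent → Prop
  | nil (H : Hypersequent) : SearchRun L 0 H H
  | step {n : ℕ} {S : Sequent} {Ps : Multiset Premiss} {P : Premiss} {H : Hypersequent}
      (G : Hypersequent) (h : Rule L S Ps) (hP : P ∈ Ps)
      (hr : SearchRun L n (P.searchFill L G) H) : SearchRun L (n + 1) (S ::ₘ G) H

/-! ### Hypersequents as strings -/

/-- The alphabet: the logical symbols, a symbol that announces a variable and the two binary digits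
of its index, the two block brackets, the sequent arrow, and the end of a component. -/
inductive Letter : Type
  | var | zero | one | bot | top | and | or | imp | box | blockOpen | blockClose | arrow | bar

/-- Formulas in prefix notation; the index of a variable is written in binary. -/
def Formula.encode : Formula → List Letter
  | atom i => .var :: i.bits.map fun b => if b then .one else .zero
  | bot => [.bot]
  | top => [.top]
  | and A B => .and :: (A.encode ++ B.encode)
  | or A B => .or :: (A.encode ++ B.encode)
  | imp A B => .imp :: (A.encode ++ B.encode)
  | box A => .box :: A.encode

/-- A sequent written down in some order. -/
structure SequentList where
  form : List Formula
  blocks : List (List Formula)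
  succ : List Formula

def SequentList.toSequent (S : SequentList) : Sequent :=
  ⟨S.form, (S.blocks.map fun X => (X : Multiset Formula) : List (Multiset Formula)), S.succ⟩

def SequentList.encode (S : SequentList) : List Letter :=
  S.form.flatMap Formula.encode ++
    S.blocks.flatMap (fun X => .blockOpen :: (X.flatMap Formula.encode ++ [.blockClose])) ++
    .arrow :: (S.succ.flatMap Formula.encode ++ [.bar])

/-- The derivability problem: the set of all strings that write down, in any order of the
components and of the elements of their multisets, a derivable hypersequent. -/
def derivabilityProblem (L : Logic) : Set (List Letter) :=
  {w | ∃ G : List SequentList, w = G.flatMap SequentList.encode ∧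
    Derivable L (G.map SequentList.toSequent : List Sequent)}

/-! ### Complexity classes -/

/-- An alternating machine: a (multi-stack) Turing machine with finite stack alphabets, a second
transition function, a set of universal control states (the others are existential), and a set of
accepting internal states. -/
structure AltMachine where
  base : Turing.FinTM2
  finite_alphabet : ∀ k, Finite (base.Γ k)
  second : base.Λ → Turing.TM2.Stmt base.Γ base.Λ base.σ
  isUniversal : Set base.Λ
  accepting : Set base.σ

/-- One computation step, with the first or the second transition function. There is no next
configuration exactly when the machine has halted. -/
def AltMachine.next (M : AltMachine) (b : Bool) (c : M.base.Cfg) : Option M.base.Cfg :=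
  Turing.TM2.step (if b then M.second else M.base.m) c

/-- Acceptance: a halted configuration is accepting if its internal state is, an existential one if
some successor is, and a universal one if both successors are. -/
inductive AltMachine.Accepts (M : AltMachine) : M.base.Cfg → Prop
  | halt (c : M.base.Cfg) (h : c.l = none) (ha : c.var ∈ M.accepting) : M.Accepts c
  | existential (c c' : M.base.Cfg) (q : M.base.Λ) (h : c.l = some q) (hq : q ∉ M.isUniversal)
      (b : Bool) (hc : c' ∈ M.next b c) (ha : M.Accepts c') : M.Accepts c
  | universal (c : M.base.Cfg) (q : M.base.Λ) (h : c.l = some q) (hq : q ∈ M.isUniversal)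
      (ha : ∀ b, ∀ c' ∈ M.next b c, M.Accepts c') : M.Accepts c

/-- Alternating polynomial time: an alternating machine accepts exactly the words of `S`, and on
every input word all of its computation paths have polynomial length. -/
def InAlternatingPTime {α : Type} (S : Set (List α)) : Prop :=
  ∃ (M : AltMachine) (e : α ↪ M.base.Γ M.base.k₀) (p : Polynomial ℕ), ∀ w : List α,
    (w ∈ S ↔ M.Accepts (Turing.initList M.base (w.map e))) ∧
    ∀ (n : ℕ) (c : ℕ → M.base.Cfg), c 0 = Turing.initList M.base (w.map e) →
      (∀ i < n, ∃ b, c (i + 1) ∈ M.next b (c i)) → n ≤ p.eval w.length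

/-- The space used by a configuration: the number of symbols on all stacks. -/
def space (M : Turing.FinTM2) (c : M.Cfg) : ℕ :=
  letI := M.kFin
  ∑ k : M.K, (c.stk k).length

/-- PSPACE: a deterministic machine halts on every input word, in an internal state that says
whether the word is in `S`, and never uses more than polynomial space. -/
def InPSPACE {α : Type} (S : Set (List α)) : Prop :=
  ∃ (M : Turing.FinTM2) (e : α ↪ M.Γ M.k₀) (accepting : Set M.σ) (p : Polynomial ℕ),
    (∀ k, Finite (M.Γ k)) ∧ ∀ w : List α,
      (∀ c, StateTransition.Reaches M.step (Turing.initList M (w.map e)) c →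
        space M c ≤ p.eval w.length) ∧
      ∃ c, StateTransition.Reaches M.step (Turing.initList M (w.map e)) c ∧ c.l = none ∧
        (c.var ∈ accepting ↔ w ∈ S)

end NNML

namespace NNML

/-! ### Weights of formulas and sequents, and the length of search runs -/

/-! The premisses do not contain the principal formulas and blocks, and no rule carries anything
from one component to another existing one. So components do not interact: a hypersequent is
derivable if and only if one of its components is provable on its own (`derivable_iff_exists_prov`).
Provability of single sequents, `Prov`, uses a normalised calculus: a modal rule acts on a whole
group of blocks at once (this absorbs C), may use no block where N would supply ⟨⊤⟩, and keeps only
the component that it creates.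

From `Derivable` to `Prov`: by induction on the derivation, some component can be replaced by every
sequent from which it arises, up to weakening, by merging blocks, by adding and removing ⊤, and by
adding blocks of ⊤ (`Rule.provSim`, `Derivable.exists_provSim`). This invariant swallows the steps C
and N. From `Prov` to the search: a normalised rule unfolds into applications of C followed by one
rule of the calculus, in any context. One ⟨⊤⟩ per component suffices, because a modal step needs at
most one and then moves on to a fresh component (`NRule.searchGood`). A weight in which a box counts
2 and a block 1 pays for the steps, whence the cut-off 2|G|. The search is sound because its uses of
N are rules of the calculus.

For the length of arbitrary runs, a weight is chosen that every rule application lowers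
(`Rule.wt_premiss`, `SearchRun.length_add_wt_le`). The ⟨⊤⟩ that N adds to a new component is paid
for by the box that R□ removes. P, D and RD remove no box; together with N they can be applied to
each fresh ⟨⊤⟩ forever, hence the exception.

For the complexity, not the hypersequent search but `Prov` is played as a game: the existential
player chooses a component of the input and then guesses rule applications, the universal player
chooses premisses. A weight that is linear in the input bounds both the tape and the number of
rounds (`NRule.tapeWt_lt`, `Wins.game`). The moves are regular expressions over stack operations.
Their input-output relations are computed compositionally, a syntactic criterion bounds their time
(`Time.driven`), and they have finitely many continuations (`conts_finite`), which gives a finite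
control. The resulting game, described by `Eval`, is turned both into an alternating machine and
into a deterministic one that searches depth-first and undoes moves with the help of a history
stack, so that its space is proportional to the length of a path. -/

/-- The weight of a formula in which every box counts `b`. -/
def Formula.wt (b : ℕ) : Formula → ℕ
  | atom _ => 1
  | bot => 1
  | top => 1
  | and A B => A.wt b + B.wt b + 1
  | or A B => A.wt b + B.wt b + 1
  | imp A B => A.wt b + B.wt b + 1
  | box A => A.wt b + b

def formulasWt (b : ℕ) (X : Multiset Formula) : ℕ := (X.map (Formula.wt b)).sum

/-- The weight of a sequent in which every box counts `b`, every block `k`, and which itself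
counts `s`. -/
def Sequent.wt (b k s : ℕ) (S : Sequent) : ℕ :=
  formulasWt b S.form + (S.blocks.map fun X => formulasWt b X + k).sum + formulasWt b S.succ + s

def hypersequentWt (b k s : ℕ) (G : Hypersequent) : ℕ := (G.map (Sequent.wt b k s)).sum

@[simp] theorem formulasWt_zero (b : ℕ) : formulasWt b 0 = 0 := rfl

@[simp] theorem formulasWt_cons (b : ℕ) (A : Formula) (X : Multiset Formula) :
    formulasWt b (A ::ₘ X) = A.wt b + formulasWt b X := by simp [formulasWt]

@[simp] theorem formulasWt_singleton (b : ℕ) (A : Formula) : formulasWt b {A} = A.wt b := by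
  simp [formulasWt]

@[simp] theorem formulasWt_add (b : ℕ) (X Y : Multiset Formula) :
    formulasWt b (X + Y) = formulasWt b X + formulasWt b Y := by simp [formulasWt]

theorem formulasWt_join (b : ℕ) (U : Multiset (Multiset Formula)) :
    formulasWt b U.join = (U.map (formulasWt b)).sum := by
  induction U using Multiset.induction with
  | empty => simp
  | cons X U ih => simp [ih]

theorem sum_map_formulasWt_add (b k : ℕ) (U : Multiset (Multiset Formula)) :
    (U.map fun X => formulasWt b X + k).sum = formulasWt b U.join + U.card * k := by
  induction U using Multiset.induction with
  | empty => simp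
  | cons X U ih => simp [ih]; ring

theorem Formula.wt_le_of_mem {b : ℕ} {A : Formula} {X : Multiset Formula} (h : A ∈ X) :
    A.wt b ≤ formulasWt b X :=
  Multiset.le_sum_of_mem (Multiset.mem_map_of_mem _ h)

theorem Formula.wt_pos {b : ℕ} (A : Formula) (hb : 1 ≤ b) : 1 ≤ A.wt b := by
  cases A <;> simp [Formula.wt]; omega

theorem Formula.size_eq_wt (A : Formula) : A.size = A.wt 1 := by
  induction A <;> simp [Formula.size, Formula.wt, *]

theorem formulasSize_eq_wt (X : Multiset Formula) : formulasSize X = formulasWt 1 X := by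
  simp only [formulasSize, formulasWt]
  congr 1
  exact Multiset.map_congr rfl fun A _ => A.size_eq_wt

theorem Sequent.size_eq_wt (S : Sequent) : S.size = S.wt 1 1 1 := by
  simp [Sequent.size, Sequent.wt, formulasSize_eq_wt]

theorem hypersequentSize_eq_wt (G : Hypersequent) : hypersequentSize G = hypersequentWt 1 1 1 G := by
  simp only [hypersequentSize, hypersequentWt]
  congr 1
  exact Multiset.map_congr rfl fun A _ => A.size_eq_wt

theorem Formula.wt_le_mul_size {b : ℕ} (hb : 1 ≤ b) (A : Formula) : A.wt b ≤ b * A.size := by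
  induction A <;> simp only [Formula.size, Formula.wt] <;> nlinarith

theorem formulasWt_le_mul_size {b : ℕ} (hb : 1 ≤ b) (X : Multiset Formula) :
    formulasWt b X ≤ b * formulasSize X := by
  induction X using Multiset.induction with
  | empty => simp
  | cons A X ih =>
    have := A.wt_le_mul_size hb
    simp only [formulasSize, Multiset.map_cons, Multiset.sum_cons, formulasWt_cons] at *
    nlinarith

theorem Sequent.wt_le_mul_size {b k s : ℕ} (hb : 1 ≤ b) (hk : k ≤ b) (hs : s ≤ b) (S : Sequent) :
    S.wt b k s ≤ b * S.size := by
  obtain ⟨Γ, Θ, Δ⟩ := S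
  have h1 := formulasWt_le_mul_size hb Γ
  have h2 := formulasWt_le_mul_size hb Δ
  have h3 : (Θ.map fun X => formulasWt b X + k).sum ≤
      b * (Θ.map fun X => formulasSize X + 1).sum := by
    rw [← Multiset.sum_map_mul_left]
    apply Multiset.sum_map_le_sum_map
    intro X _
    have := formulasWt_le_mul_size hb X
    nlinarith
  simp only [Sequent.wt, Sequent.size]
  nlinarith

theorem hypersequentWt_le_mul_size {b k s : ℕ} (hb : 1 ≤ b) (hk : k ≤ b) (hs : s ≤ b)
    (G : Hypersequent) : hypersequentWt b k s G ≤ b * hypersequentSize G := by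
  simp only [hypersequentWt, hypersequentSize]
  rw [← Multiset.sum_map_mul_left]
  exact Multiset.sum_map_le_sum_map _ _ fun S _ => S.wt_le_mul_size hb hk hs

theorem card_le_hypersequentSize (G : Hypersequent) : G.card ≤ hypersequentSize G := by
  induction G using Multiset.induction with
  | empty => simp
  | cons S G ih =>
    simp only [hypersequentSize, Multiset.map_cons, Multiset.sum_cons, Multiset.card_cons,
      Sequent.size] at *
    omega

@[simp] theorem hypersequentWt_cons (b k s : ℕ) (S : Sequent) (G : Hypersequent) :
    hypersequentWt b k s (S ::ₘ G) = S.wt b k s + hypersequentWt b k s G := by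
  simp [hypersequentWt]

@[simp] theorem hypersequentWt_zero (b k s : ℕ) : hypersequentWt b k s 0 = 0 := rfl

@[simp] theorem hypersequentWt_singleton (b k s : ℕ) (S : Sequent) :
    hypersequentWt b k s {S} = S.wt b k s := by
  simp [hypersequentWt]

@[simp] theorem hypersequentWt_add (b k s : ℕ) (G H : Hypersequent) :
    hypersequentWt b k s (G + H) = hypersequentWt b k s G + hypersequentWt b k s H := by
  simp [hypersequentWt]

theorem wt_applyN_le (L : Logic) (b k s : ℕ) (S : Sequent) :
    (applyN L S).wt b k s ≤ S.wt b k s + (k + 1) := by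
  unfold applyN
  split
  · simp [Sequent.addTop, Sequent.wt, Formula.wt]; omega
  · omega

theorem wt_applyN_of_not (L : Logic) (b k s : ℕ) (S : Sequent) (h : L.N ≠ true) :
    (applyN L S).wt b k s = S.wt b k s := by
  simp [applyN, h]

theorem wt_searchStart_le (L : Logic) (b k s : ℕ) (G : Hypersequent) :
    hypersequentWt b k s (searchStart L G) ≤ hypersequentWt b k s G + (k + 1) * G.card := by
  induction G using Multiset.induction with
  | empty => simp [searchStart]
  | cons S G ih =>
    have := wt_applyN_le L b k s S
    simp only [searchStart, Multiset.map_cons, hypersequentWt_cons, Multiset.card_cons] at *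
    nlinarith

/-- The change of the weight in a backwards rule application. -/
theorem Rule.wt_premiss {L : Logic} {S : Sequent} {Ps : Multiset Premiss} (h : Rule L S Ps)
    {P : Premiss} (hP : P ∈ Ps) {b k s d : ℕ} (hb : k + d ≤ b) (hk : d ≤ k) (hd : d ≤ 1) :
    (P.created = 0 ∧ P.rest.wt b k s + d ≤ S.wt b k s) ∨
    ∃ T, P.created = {T} ∧ (P.rest.wt b k s + T.wt b k s + b + k ≤ S.wt b k s + s ∨
      ((L.P = true ∨ L.D = true ∨ L.RD ≠ ∅) ∧
        P.rest.wt b k s + T.wt b k s + k ≤ S.wt b k s + s)) := by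
  cases h
  case init | botL | topR => simp at hP
  case impL | impR | andL | andR | orL | orR =>
    simp only [Multiset.insert_eq_cons, Multiset.mem_cons, Multiset.mem_singleton] at hP
    left
    rcases hP with rfl | rfl <;>
    · simp only [Sequent.wt, formulasWt_cons, Formula.wt, true_and]; omega
  case boxL =>
    simp only [Multiset.mem_singleton] at hP
    subst hP
    left
    simp [Sequent.wt, Formula.wt]; omega
  case boxR X B Γ Θ Δ hM =>
    right
    simp only [Multiset.mem_cons, Multiset.mem_map] at hP
    rcases hP with rfl | ⟨A, hA, rfl⟩
    · exact ⟨_, rfl, Or.inl (by simp [Sequent.wt, Formula.wt]; omega)⟩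
    -- A side premiss keeps a single formula of the block, which weighs no more than all of them.
    · have := Formula.wt_le_of_mem (b := b) hA
      exact ⟨_, rfl, Or.inl (by simp [Sequent.wt, Formula.wt]; omega)⟩
  case boxRm =>
    simp only [Multiset.mem_singleton] at hP
    subst hP
    right
    exact ⟨_, rfl, Or.inl (by simp [Sequent.wt, Formula.wt]; omega)⟩
  case c =>
    simp only [Multiset.mem_singleton] at hP
    subst hP
    left
    simp [Sequent.wt]; omega
  case t =>
    simp only [Multiset.mem_singleton] at hP
    subst hP
    left
    simp [Sequent.wt]; omega
  case p X Γ Θ Δ h =>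
    simp only [Multiset.mem_singleton] at hP
    subst hP
    right
    exact ⟨_, rfl, Or.inr ⟨by tauto, by simp [Sequent.wt]; omega⟩⟩
  case d₁ X Γ Θ Δ hM h =>
    right
    simp only [Multiset.mem_cons, Multiset.mem_map] at hP
    rcases hP with rfl | ⟨A, hA, rfl⟩
    · exact ⟨_, rfl, Or.inr ⟨by tauto, by simp [Sequent.wt]; omega⟩⟩
    · have := Formula.wt_le_of_mem (b := b) hA
      exact ⟨_, rfl, Or.inr ⟨by tauto, by simp [Sequent.wt]; omega⟩⟩
  case d₂ X Y Γ Θ Δ hM h =>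
    right
    simp only [Multiset.mem_cons, Multiset.mem_map] at hP
    rcases hP with rfl | ⟨⟨A, B⟩, hA, rfl⟩
    · exact ⟨_, rfl, Or.inr ⟨by tauto, by simp [Sequent.wt]; omega⟩⟩
    · rw [Multiset.mem_product] at hA
      have := Formula.wt_le_of_mem (b := b) hA.1
      have := Formula.wt_le_of_mem (b := b) hA.2
      dsimp only at *
      exact ⟨_, rfl, Or.inr ⟨by tauto, by simp [Sequent.wt]; omega⟩⟩
  case dM =>
    simp only [Multiset.mem_singleton] at hP
    subst hP
    right
    exact ⟨_, rfl, Or.inr ⟨by tauto, by simp [Sequent.wt]; omega⟩⟩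
  case dPlus =>
    rename_i n hmem Ξ h₁ hn Γ Θ Δ
    simp only [Multiset.mem_singleton] at hP
    subst hP
    right
    refine ⟨_, rfl, Or.inr ⟨Or.inr (Or.inr (Set.nonempty_iff_ne_empty.1 ⟨n, hmem⟩)), ?_⟩⟩
    -- At least one block is principal, so at least `k` is gained from its brackets.
    have : k ≤ Ξ.card * k := Nat.le_mul_of_pos_left _ h₁
    simp only [Sequent.wt, sum_map_formulasWt_add, Multiset.map_add, Multiset.sum_add,
      Multiset.map_zero, Multiset.sum_zero, formulasWt_zero]
    omega

/-- No rule by itself enlarges a hypersequent: a new component costs 1, but a block that cost 1 is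
gone. Only the ⟨⊤⟩ that N adds, of size 2, counts, and each application creates at most one
component. -/
theorem SearchRun.size_le {L : Logic} {n : ℕ} {H H' : Hypersequent} (h : SearchRun L n H H') :
    hypersequentSize H' ≤ hypersequentSize H + 2 * n := by
  induction h with
  | nil H => omega
  | @step n S Ps P H G h hP hr ih =>
    have := h.wt_premiss hP (b := 1) (k := 1) (s := 1) (d := 0) (by omega) (by omega) (by omega)
    simp only [hypersequentSize_eq_wt, Premiss.searchFill, hypersequentWt_cons,
      hypersequentWt_add] at *
    rcases this with ⟨h0, h1⟩ | ⟨T, h0, h1⟩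
    · simp only [h0, Multiset.map_zero, hypersequentWt_zero] at ih; omega
    · have := wt_applyN_le L 1 1 1 T
      simp only [h0, Multiset.map_singleton, hypersequentWt_singleton] at ih; omega

/-- A rule that creates nothing loses at least 1. A block, of weight 2, pays for a new component of
weight 1 and leaves 1 over. With N the new ⟨⊤⟩ costs 3 more, and only a box in the succedent, of
weight 4, can pay for it. So N is compatible with R□ but not with the rules that refute blocks. -/
theorem SearchRun.length_add_wt_le {L : Logic}
    (hL : L.N = true → L.P = false ∧ L.D = false ∧ L.RD = ∅)
    {n : ℕ} {H H' : Hypersequent} (h : SearchRun L n H H') :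
    n + hypersequentWt 4 2 1 H' ≤ hypersequentWt 4 2 1 H := by
  induction h with
  | nil H => omega
  | @step n S Ps P H G h hP hr ih =>
    have := h.wt_premiss hP (b := 4) (k := 2) (s := 1) (d := 1) (by omega) (by omega) (by omega)
    simp only [Premiss.searchFill, hypersequentWt_cons, hypersequentWt_add] at *
    rcases this with ⟨h0, h1⟩ | ⟨T, h0, h1⟩
    · simp only [h0, Multiset.map_zero, hypersequentWt_zero] at ih; omega
    · simp only [h0, Multiset.map_singleton, hypersequentWt_singleton] at ih
      by_cases hN : L.N = true
      · have := wt_applyN_le L 4 2 1 T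
        obtain ⟨h2, h3, h4⟩ := hL hN
        simp only [h2, h3, h4, Bool.false_eq_true, ne_eq, not_true, or_self, false_and,
          or_false] at h1
        omega
      · rw [wt_applyN_of_not L 4 2 1 T hN] at ih
        omega

theorem Formula.wt_mono {b c : ℕ} (h : b ≤ c) (A : Formula) : A.wt b ≤ A.wt c := by
  induction A <;> simp only [Formula.wt] <;> omega

theorem hypersequentSize_le_wt (G : Hypersequent) :
    hypersequentSize G ≤ hypersequentWt 4 2 1 G := by
  have hf : ∀ X, formulasWt 1 X ≤ formulasWt 4 X := fun X =>
    Multiset.sum_map_le_sum_map _ _ fun A _ => A.wt_mono (by omega)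
  rw [hypersequentSize_eq_wt]
  apply Multiset.sum_map_le_sum_map
  intro S _
  have h1 := hf S.form
  have h2 := hf S.succ
  have h3 : (S.blocks.map fun X => formulasWt 1 X + 1).sum ≤
      (S.blocks.map fun X => formulasWt 4 X + 2).sum :=
    Multiset.sum_map_le_sum_map _ _ fun X _ => by have := hf X; omega
  simp only [Sequent.wt]; omega

/-- Unless N is combined with one of P, D, RD, every run of the search is short. -/
theorem searchRun_bounded (L : Logic) (hL : L.N = true → L.P = false ∧ L.D = false ∧ L.RD = ∅) :
    ∃ p : Polynomial ℕ, ∀ (G : Hypersequent) (n : ℕ) (H : Hypersequent),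
      SearchRun L n (searchStart L G) H →
        n ≤ p.eval (hypersequentSize G) ∧ hypersequentSize H ≤ p.eval (hypersequentSize G) := by
  -- The factor is 4, which bounds the weight of `G` by its size, plus 3 for the ⟨⊤⟩ that each
  -- component may receive at the start.
  refine ⟨Polynomial.C 7 * Polynomial.X, fun G n H h => ?_⟩
  have h1 := h.length_add_wt_le hL
  have h2 := wt_searchStart_le L 4 2 1 G
  have h3 := hypersequentWt_le_mul_size (b := 4) (k := 2) (s := 1) (by omega) (by omega)
    (by omega) G
  have h4 := card_le_hypersequentSize G
  have h5 := hypersequentSize_le_wt H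
  simp only [Polynomial.eval_mul, Polynomial.eval_C, Polynomial.eval_X]
  omega

/-! ### A calculus for single sequents

The calculus is normalised: the rules C and N are absorbed into the modal rules, which act on
several blocks at once, and a modal rule keeps only the component that it creates. -/

/-- The numbers of blocks that can be merged into one. -/
def MergeCard (L : Logic) (k : ℕ) : Prop := 1 ≤ k ∧ (L.C = true ∨ k = 1)

/-- A rule refutes a single block. -/
def RefutesBlock (L : Logic) : Prop := L.P = true ∨ (L.D = true ∧ (L.M = true ∨ L.N = true))

/-- The numbers of blocks that can be refuted together with a single premiss. -/
def RefuteCard (L : Logic) (k : ℕ) : Prop :=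
  1 ≤ k ∧ ((L.C = true ∧ (RefutesBlock L ∨ L.RD.Nonempty)) ∨ (k = 1 ∧ RefutesBlock L) ∨
    (k ≤ 2 ∧ L.D = true ∧ L.M = true) ∨ ∃ n ∈ L.RD, k ≤ n)

/-- The rules of the normalised calculus, with the set of their premisses. -/
inductive NRule (L : Logic) : Sequent → Set Sequent → Prop
  | init (p : ℕ) (Γ Θ Δ) : NRule L ⟨.atom p ::ₘ Γ, Θ, .atom p ::ₘ Δ⟩ ∅
  | botL (Γ Θ Δ) : NRule L ⟨.bot ::ₘ Γ, Θ, Δ⟩ ∅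
  | topR (Γ Θ Δ) : NRule L ⟨Γ, Θ, .top ::ₘ Δ⟩ ∅
  | impL (A B Γ Θ Δ) : NRule L ⟨.imp A B ::ₘ Γ, Θ, Δ⟩ {⟨Γ, Θ, A ::ₘ Δ⟩, ⟨B ::ₘ Γ, Θ, Δ⟩}
  | impR (A B Γ Θ Δ) : NRule L ⟨Γ, Θ, .imp A B ::ₘ Δ⟩ {⟨A ::ₘ Γ, Θ, B ::ₘ Δ⟩}
  | andL (A B Γ Θ Δ) : NRule L ⟨.and A B ::ₘ Γ, Θ, Δ⟩ {⟨A ::ₘ B ::ₘ Γ, Θ, Δ⟩}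
  | andR (A B Γ Θ Δ) : NRule L ⟨Γ, Θ, .and A B ::ₘ Δ⟩ {⟨Γ, Θ, A ::ₘ Δ⟩, ⟨Γ, Θ, B ::ₘ Δ⟩}
  | orL (A B Γ Θ Δ) : NRule L ⟨.or A B ::ₘ Γ, Θ, Δ⟩ {⟨A ::ₘ Γ, Θ, Δ⟩, ⟨B ::ₘ Γ, Θ, Δ⟩}
  | orR (A B Γ Θ Δ) : NRule L ⟨Γ, Θ, .or A B ::ₘ Δ⟩ {⟨Γ, Θ, A ::ₘ B ::ₘ Δ⟩}
  | boxL (A Γ Θ Δ) : NRule L ⟨.box A ::ₘ Γ, Θ, Δ⟩ {⟨Γ, {A} ::ₘ Θ, Δ⟩}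
  | t (h : L.T = true) (X Γ Θ Δ) : NRule L ⟨Γ, X ::ₘ Θ, Δ⟩ {⟨X + Γ, Θ, Δ⟩}
  | boxR (hM : L.M = false) (U B Γ Θ Δ) (hU : MergeCard L U.card ∨ (L.N = true ∧ U = 0)) :
      NRule L ⟨Γ, U + Θ, .box B ::ₘ Δ⟩
        {T | T = ⟨U.join, 0, {B}⟩ ∨ ∃ A ∈ U.join, T = ⟨{B}, 0, {A}⟩}
  | boxRm (hM : L.M = true) (U B Γ Θ Δ) (hU : MergeCard L U.card ∨ (L.N = true ∧ U = 0)) :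
      NRule L ⟨Γ, U + Θ, .box B ::ₘ Δ⟩ {⟨U.join, 0, {B}⟩}
  | refute (U Γ Θ Δ) (hU : RefuteCard L U.card) : NRule L ⟨Γ, U + Θ, Δ⟩ {⟨U.join, 0, 0⟩}
  | d₁ (h : L.D = true) (hM : L.M = false) (U Γ Θ Δ) (hU : MergeCard L U.card) :
      NRule L ⟨Γ, U + Θ, Δ⟩ {T | T = ⟨U.join, 0, 0⟩ ∨ ∃ A ∈ U.join, T = ⟨0, 0, {A}⟩}
  | d₂ (h : L.D = true) (hM : L.M = false) (U V Γ Θ Δ) (hU : MergeCard L U.card)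
      (hV : MergeCard L V.card) :
      NRule L ⟨Γ, U + V + Θ, Δ⟩
        {T | T = ⟨U.join + V.join, 0, 0⟩ ∨ ∃ A ∈ U.join, ∃ B ∈ V.join, T = ⟨0, 0, {A, B}⟩}

/-- Provability in the normalised calculus. -/
inductive Prov (L : Logic) : Sequent → Prop
  | rule {S : Sequent} {Ss : Set Sequent} (h : NRule L S Ss) (hS : ∀ T ∈ Ss, Prov L T) : Prov L S

/-! ### From the normalised calculus to the bounded search -/

theorem SearchSucceeds.mono {L : Logic} {n m : ℕ} {H : Hypersequent} (h : SearchSucceeds L n H)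
    (hnm : n ≤ m) : SearchSucceeds L m H := by
  induction h generalizing m with
  | @step n S Ps G h hP ih =>
    obtain ⟨m, rfl⟩ : ∃ k, m = k + 1 := ⟨m - 1, by omega⟩
    exact .step G h fun P hP => ih P hP (by omega)

/-- Continue the search with the single component that the premiss creates. -/
theorem SearchSucceeds.of_created {L : Logic} {n : ℕ} {R T : Sequent} {G : Hypersequent}
    (h : ∀ G, SearchSucceeds L n (applyN L T ::ₘ G)) :
    SearchSucceeds L n (Premiss.searchFill L ⟨R, {T}⟩ G) := by
  simp only [Premiss.searchFill, Multiset.map_singleton, Multiset.singleton_add]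
  rw [Multiset.cons_swap]
  exact h _

theorem SearchSucceeds.of_rest {L : Logic} {n : ℕ} {R : Sequent} {G : Hypersequent}
    (h : SearchSucceeds L n (R ::ₘ G)) :
    SearchSucceeds L n (Premiss.searchFill L ⟨R, 0⟩ G) := by
  simpa [Premiss.searchFill] using h

theorem SearchSucceeds.merge_cons {L : Logic} (hC : L.C = true) {n : ℕ} {Γ Δ : Multiset Formula}
    {Θ : Multiset (Multiset Formula)} {G : Hypersequent} (U : Multiset (Multiset Formula))
    (X : Multiset Formula) (h : SearchSucceeds L n (⟨Γ, (X + U.join) ::ₘ Θ, Δ⟩ ::ₘ G)) :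
    SearchSucceeds L (n + U.card) (⟨Γ, X ::ₘ (U + Θ), Δ⟩ ::ₘ G) := by
  induction U using Multiset.induction generalizing X with
  | empty => simpa using h
  | cons Y U ih =>
    have := ih (X + Y) (by simpa [add_assoc] using h)
    rw [Multiset.card_cons, ← add_assoc, Multiset.cons_add]
    refine .step G (.c hC X Y Γ (U + Θ) Δ) fun P hP => ?_
    rw [Multiset.mem_singleton] at hP
    subst hP
    exact .of_rest this

/-- The other blocks are merged into the first, so one application of C fewer than there are blocks;
the step saved is spent on the modal rule. -/
theorem SearchSucceeds.merge {L : Logic} {n : ℕ} {Γ Δ : Multiset Formula}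
    {Θ : Multiset (Multiset Formula)} {G : Hypersequent} {U : Multiset (Multiset Formula)}
    (hU : MergeCard L U.card) (h : SearchSucceeds L n (⟨Γ, U.join ::ₘ Θ, Δ⟩ ::ₘ G)) :
    SearchSucceeds L (n + (U.card - 1)) (⟨Γ, U + Θ, Δ⟩ ::ₘ G) := by
  rcases hU with ⟨h1, hC | h2⟩
  · obtain ⟨X, hX⟩ := Multiset.card_pos_iff_exists_mem.1 h1
    obtain ⟨U, rfl⟩ := Multiset.exists_cons_of_mem hX
    rw [Multiset.cons_add]
    simpa using SearchSucceeds.merge_cons hC U X (by simpa using h)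
  · obtain ⟨X, rfl⟩ := Multiset.card_eq_one.1 h2
    simpa using h

theorem applyN_succ (L : Logic) (S : Sequent) : (applyN L S).succ = S.succ := by
  unfold applyN; split <;> rfl

theorem SearchSucceeds.topR {L : Logic} {n : ℕ} (hn : 1 ≤ n) {S : Sequent} {G : Hypersequent}
    (h : Formula.top ∈ S.succ) : SearchSucceeds L n (S ::ₘ G) := by
  obtain ⟨Γ, Θ, Δ⟩ := S
  dsimp only at h
  obtain ⟨Δ, rfl⟩ := Multiset.exists_cons_of_mem h
  obtain ⟨n, rfl⟩ : ∃ k, n = k + 1 := ⟨n - 1, by omega⟩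
  exact .step G (.topR _ _ _) (by simp)

/-- The search succeeds from every weakening of `S` to which N has been applied. -/
def SearchGood (L : Logic) (n : ℕ) (S : Sequent) : Prop :=
  ∀ (Γ : Multiset Formula) (Θ : Multiset (Multiset Formula)) (Δ : Multiset Formula)
    (G : Hypersequent), (L.N = true → {Formula.top} ∈ Θ) →
    SearchSucceeds L n (⟨S.form + Γ, S.blocks + Θ, S.succ + Δ⟩ ::ₘ G)

/-- The ⟨⊤⟩ that the search adds to a new component is the one that `SearchGood` asks for. The extra
`Γ` leaves room for a ⊤ that came out of a principal block ⟨⊤⟩. -/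
theorem SearchGood.applyN {L : Logic} {n : ℕ} {S : Sequent} (h : SearchGood L n S)
    (Γ : Multiset Formula) (G : Hypersequent) :
    SearchSucceeds L n (applyN L ⟨Γ + S.form, S.blocks, S.succ⟩ ::ₘ G) := by
  unfold NNML.applyN
  split
  · simpa [Sequent.addTop, add_comm, ← Multiset.singleton_add] using h Γ {{Formula.top}} 0 G (by simp)
  · simpa [add_comm] using h Γ 0 0 G (by tauto)

theorem SearchGood.created {L : Logic} {n : ℕ} {R S : Sequent} (h : SearchGood L n S)
    (G : Hypersequent) : SearchSucceeds L n (Premiss.searchFill L ⟨R, {S}⟩ G) :=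
  .of_created fun G => by simpa using h.applyN 0 G

theorem SearchGood.mono {L : Logic} {n m : ℕ} {S : Sequent} (h : SearchGood L n S) (hnm : n ≤ m) :
    SearchGood L m S :=
  fun Γ Θ Δ G hN => (h Γ Θ Δ G hN).mono hnm

/-- Either C first makes one block of the group, which a rule for single blocks then refutes, or one
of the rules for several blocks applies directly. -/
theorem searchSucceeds_refute {L : Logic} {n : ℕ} {U : Multiset (Multiset Formula)}
    (hU : RefuteCard L U.card) (hn : formulasWt 2 U.join ≤ n)
    (h : SearchGood L n ⟨U.join, 0, 0⟩)
    {Γ Δ : Multiset Formula} {Θ : Multiset (Multiset Formula)} {G : Hypersequent}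
    (hN : L.N = true → {Formula.top} ∈ Θ) :
    SearchSucceeds L (n + U.card) (⟨Γ, U + Θ, Δ⟩ ::ₘ G) := by
  have key : MergeCard L U.card → RefutesBlock L →
      SearchSucceeds L (n + U.card) (⟨Γ, U + Θ, Δ⟩ ::ₘ G) := by
    intro hm hr
    have hc := hU.1
    rw [show n + U.card = (n + 1) + (U.card - 1) by omega]
    refine .merge hm ?_
    by_cases hp : L.P = true ∨ (L.D = true ∧ L.M = true)
    · refine .step G (.p hp U.join Γ Θ Δ) fun P hP => ?_
      rw [Multiset.mem_singleton] at hP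
      subst hP
      exact h.created G
    · simp only [RefutesBlock] at hr
      have hD : L.D = true := by tauto
      have hM : L.M = false := by simpa using (by tauto : ¬ L.M = true)
      -- D without M but with N: the second block of D₂ can be ⟨⊤⟩. The side premisses ⇒ A, ⊤ are
      -- then axioms, and the main premiss only has an additional ⊤.
      obtain ⟨Θ, rfl⟩ := Multiset.exists_cons_of_mem (hN (by tauto))
      refine .step G (.d₂ hD hM U.join {Formula.top} Γ Θ Δ) fun P hP => ?_
      simp only [Multiset.mem_cons, Multiset.mem_map, Multiset.mem_product,
        Multiset.mem_singleton, Prod.exists] at hP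
      rcases hP with rfl | ⟨A, B, ⟨hA, rfl⟩, rfl⟩
      · exact .of_created fun G => by simpa [add_comm] using h.applyN {Formula.top} G
      · refine .of_created fun G => .topR ?_ ?_
        -- A side premiss exists only if some `A` is in the group; its weight leaves a step for the
        -- axiom.
        · have := Formula.wt_le_of_mem (b := 2) hA
          have := A.wt_pos (b := 2) (by omega)
          omega
        · simp [applyN_succ]
  have hdp : ∀ m ∈ L.RD, U.card ≤ m →
      SearchSucceeds L (n + U.card) (⟨Γ, U + Θ, Δ⟩ ::ₘ G) := by
    intro m hm hc
    have : SearchSucceeds L (n + 1) (⟨Γ, U + Θ, Δ⟩ ::ₘ G) := by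
      refine .step G (.dPlus m hm U hU.1 hc Γ Θ Δ) fun P hP => ?_
      rw [Multiset.mem_singleton] at hP
      subst hP
      exact h.created G
    exact this.mono (by have := hU.1; omega)
  rcases hU with ⟨h1, ⟨hC, hr | ⟨m, hm⟩⟩ | ⟨h2, hr⟩ | ⟨h2, hD, hM⟩ | ⟨m, hm, hc⟩⟩
  · exact key ⟨h1, Or.inl hC⟩ hr
  · rw [show n + U.card = (n + 1) + (U.card - 1) by omega]
    refine .merge ⟨h1, Or.inl hC⟩ ?_
    rw [← Multiset.singleton_add]
    -- After merging there is a single block, and the rule for one block belongs to every RD_m⁺.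
    refine .step G (.dPlus m hm {U.join} (by simp) (by rw [Multiset.card_singleton]; exact m.2) Γ Θ Δ) fun P hP => ?_
    rw [Multiset.mem_singleton] at hP
    subst hP
    simpa using h.created G
  · exact key ⟨h1, Or.inr h2⟩ hr
  · rcases (by omega : U.card = 1 ∨ U.card = 2) with h3 | h3
    · exact key ⟨h1, Or.inr h3⟩ (Or.inr ⟨hD, Or.inl hM⟩)
    · obtain ⟨X, Y, rfl⟩ := Multiset.card_eq_two.1 h3
      have : SearchSucceeds L (n + 1) (⟨Γ, X ::ₘ Y ::ₘ Θ, Δ⟩ ::ₘ G) := by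
        refine .step G (.dM hD hM X Y Γ Θ Δ) fun P hP => ?_
        rw [Multiset.mem_singleton] at hP
        subst hP
        simpa using h.created G
      simpa using this.mono (by simp : n + 1 ≤ n + 2)
  · exact hdp m hm hc

/-- The weight counts the steps: a group of blocks, each of weight 1, pays for its merging and for
the modal rule. A box weighs 2, because L□ takes a step and leaves a block that still has to pay. A
box in the succedent also pays for R□ when the group is empty. -/
theorem NRule.searchGood {L : Logic} {S : Sequent} {Ss : Set Sequent} (h : NRule L S Ss)
    (ih : ∀ T ∈ Ss, SearchGood L (T.wt 2 1 0) T) : SearchGood L (S.wt 2 1 0) S := by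
  intro Γ' Θ' Δ' G hN
  have step : ∀ {n : ℕ} {S : Sequent} {Ps : Multiset Premiss}, 1 ≤ n → Rule L S Ps →
      (∀ P ∈ Ps, SearchSucceeds L (n - 1) (P.searchFill L G)) → SearchSucceeds L n (S ::ₘ G) := by
    intro n S Ps hn h hP
    obtain ⟨n, rfl⟩ : ∃ k, n = k + 1 := ⟨n - 1, by omega⟩
    exact .step G h hP
  have hΘ : ∀ Θ : Multiset (Multiset Formula), L.N = true → {Formula.top} ∈ Θ + Θ' :=
    fun Θ h => Multiset.mem_add.2 (Or.inr (hN h))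
  cases h with
  | init p Γ Θ Δ =>
    simp only [Multiset.cons_add]
    exact step (by simp [Sequent.wt, Formula.wt]; omega) (.init _ _ _ _) (by simp)
  | botL Γ Θ Δ =>
    simp only [Multiset.cons_add]
    exact step (by simp [Sequent.wt, Formula.wt]; omega) (.botL _ _ _) (by simp)
  | topR Γ Θ Δ =>
    simp only [Multiset.cons_add]
    exact step (by simp [Sequent.wt, Formula.wt]; omega) (.topR _ _ _) (by simp)
  | impL A B Γ Θ Δ =>
    simp only [Multiset.cons_add]
    refine step (by simp [Sequent.wt, Formula.wt]; omega) (.impL _ _ _ _ _) fun P hP => ?_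
    simp only [Multiset.insert_eq_cons, Multiset.mem_cons, Multiset.mem_singleton] at hP
    rcases hP with rfl | rfl
    · have := (ih _ (Or.inl rfl)) Γ' Θ' Δ' G hN
      simp only [Multiset.cons_add] at this
      exact .of_rest (this.mono (by simp [Sequent.wt, Formula.wt]; omega))
    · have := (ih _ (Or.inr rfl)) Γ' Θ' Δ' G hN
      simp only [Multiset.cons_add] at this
      exact .of_rest (this.mono (by simp [Sequent.wt, Formula.wt]; omega))
  | impR A B Γ Θ Δ =>
    simp only [Multiset.cons_add]
    refine step (by simp [Sequent.wt, Formula.wt]; omega) (.impR _ _ _ _ _) fun P hP => ?_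
    rw [Multiset.mem_singleton] at hP
    subst hP
    have := (ih _ rfl) Γ' Θ' Δ' G hN
    simp only [Multiset.cons_add] at this
    exact .of_rest (this.mono (by simp [Sequent.wt, Formula.wt]; omega))
  | andL A B Γ Θ Δ =>
    simp only [Multiset.cons_add]
    refine step (by simp [Sequent.wt, Formula.wt]; omega) (.andL _ _ _ _ _) fun P hP => ?_
    rw [Multiset.mem_singleton] at hP
    subst hP
    have := (ih _ rfl) Γ' Θ' Δ' G hN
    simp only [Multiset.cons_add] at this
    exact .of_rest (this.mono (by simp [Sequent.wt, Formula.wt]; omega))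
  | andR A B Γ Θ Δ =>
    simp only [Multiset.cons_add]
    refine step (by simp [Sequent.wt, Formula.wt]; omega) (.andR _ _ _ _ _) fun P hP => ?_
    simp only [Multiset.insert_eq_cons, Multiset.mem_cons, Multiset.mem_singleton] at hP
    rcases hP with rfl | rfl
    · have := (ih _ (Or.inl rfl)) Γ' Θ' Δ' G hN
      simp only [Multiset.cons_add] at this
      exact .of_rest (this.mono (by simp [Sequent.wt, Formula.wt]; omega))
    · have := (ih _ (Or.inr rfl)) Γ' Θ' Δ' G hN
      simp only [Multiset.cons_add] at this
      exact .of_rest (this.mono (by simp [Sequent.wt, Formula.wt]; omega))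
  | orL A B Γ Θ Δ =>
    simp only [Multiset.cons_add]
    refine step (by simp [Sequent.wt, Formula.wt]; omega) (.orL _ _ _ _ _) fun P hP => ?_
    simp only [Multiset.insert_eq_cons, Multiset.mem_cons, Multiset.mem_singleton] at hP
    rcases hP with rfl | rfl
    · have := (ih _ (Or.inl rfl)) Γ' Θ' Δ' G hN
      simp only [Multiset.cons_add] at this
      exact .of_rest (this.mono (by simp [Sequent.wt, Formula.wt]; omega))
    · have := (ih _ (Or.inr rfl)) Γ' Θ' Δ' G hN
      simp only [Multiset.cons_add] at this
      exact .of_rest (this.mono (by simp [Sequent.wt, Formula.wt]; omega))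
  | orR A B Γ Θ Δ =>
    simp only [Multiset.cons_add]
    refine step (by simp [Sequent.wt, Formula.wt]; omega) (.orR _ _ _ _ _) fun P hP => ?_
    rw [Multiset.mem_singleton] at hP
    subst hP
    have := (ih _ rfl) Γ' Θ' Δ' G hN
    simp only [Multiset.cons_add] at this
    exact .of_rest (this.mono (by simp [Sequent.wt, Formula.wt]; omega))
  | boxL A Γ Θ Δ =>
    simp only [Multiset.cons_add]
    refine step (by simp [Sequent.wt, Formula.wt]; omega) (.boxL _ _ _ _) fun P hP => ?_
    rw [Multiset.mem_singleton] at hP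
    subst hP
    have := (ih _ rfl) Γ' Θ' Δ' G hN
    simp only [Multiset.cons_add] at this
    exact .of_rest (this.mono (by simp [Sequent.wt, Formula.wt]; omega))
  | t h X Γ Θ Δ =>
    simp only [Multiset.cons_add]
    refine step (by simp [Sequent.wt]; omega) (.t h _ _ _ _) fun P hP => ?_
    rw [Multiset.mem_singleton] at hP
    subst hP
    have := (ih _ rfl) Γ' Θ' Δ' G hN
    simp only [add_assoc] at this
    exact .of_rest (this.mono (by simp [Sequent.wt]; omega))
  | boxR hM U B Γ Θ Δ hU =>
    have ih₁ := ih _ (Or.inl rfl)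
    have ih₂ := fun A hA => ih ⟨{B}, 0, {A}⟩ (Or.inr ⟨A, hA, rfl⟩)
    simp only [Multiset.cons_add, add_assoc]
    rcases hU with hU | ⟨hN', rfl⟩
    · have hc := hU.1
      have : SearchSucceeds L (formulasWt 2 U.join + B.wt 2 + 1)
          (⟨Γ + Γ', U.join ::ₘ (Θ + Θ'), .box B ::ₘ (Δ + Δ')⟩ ::ₘ G) := by
        refine .step G (.boxR hM _ _ _ _ _) fun P hP => ?_
        simp only [Multiset.mem_cons, Multiset.mem_map] at hP
        rcases hP with rfl | ⟨A, hA, rfl⟩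
        · exact (ih₁.mono (by simp [Sequent.wt])).created G
        · refine ((ih₂ A hA).mono ?_).created G
          have := Formula.wt_le_of_mem (b := 2) hA
          simp [Sequent.wt]; omega
      refine (SearchSucceeds.merge hU this).mono ?_
      simp [Sequent.wt, Formula.wt, formulasWt_join]; omega
    -- The empty group: R□ takes the block ⟨⊤⟩ instead. Its ⊤ is a weakening of the main premiss,
    -- and the side premiss B ⇒ ⊤ is an axiom.
    · obtain ⟨Θ₁, hΘ₁⟩ := Multiset.exists_cons_of_mem (hΘ Θ hN')
      rw [hΘ₁]
      simp only [zero_add]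
      refine step (by simp [Sequent.wt, Formula.wt]; omega) (.boxR hM _ _ _ _ _) fun P hP => ?_
      simp only [Multiset.mem_cons, Multiset.mem_map, Multiset.mem_singleton] at hP
      rcases hP with rfl | ⟨A, rfl, rfl⟩
      · refine .of_created fun G => ?_
        have := ih₁.applyN {Formula.top} G
        simp only [Multiset.join_zero, add_zero] at this
        exact this.mono (by simp [Sequent.wt, Formula.wt]; omega)
      · refine .of_created fun G => .topR ?_ ?_
        · simp [Sequent.wt, Formula.wt]; omega
        · simp [applyN_succ]
  | boxRm hM U B Γ Θ Δ hU =>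
    have ih₁ := ih _ rfl
    simp only [Multiset.cons_add, add_assoc]
    rcases hU with hU | ⟨hN', rfl⟩
    · have hc := hU.1
      have : SearchSucceeds L (formulasWt 2 U.join + B.wt 2 + 1)
          (⟨Γ + Γ', U.join ::ₘ (Θ + Θ'), .box B ::ₘ (Δ + Δ')⟩ ::ₘ G) := by
        refine .step G (.boxRm hM _ _ _ _ _) fun P hP => ?_
        rw [Multiset.mem_singleton] at hP
        subst hP
        exact (ih₁.mono (by simp [Sequent.wt])).created G
      refine (SearchSucceeds.merge hU this).mono ?_
      simp [Sequent.wt, Formula.wt, formulasWt_join]; omega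
    · obtain ⟨Θ₁, hΘ₁⟩ := Multiset.exists_cons_of_mem (hΘ Θ hN')
      rw [hΘ₁]
      simp only [zero_add]
      refine step (by simp [Sequent.wt, Formula.wt]; omega) (.boxRm hM _ _ _ _ _) fun P hP => ?_
      rw [Multiset.mem_singleton] at hP
      subst hP
      refine .of_created fun G => ?_
      have := ih₁.applyN {Formula.top} G
      simp only [Multiset.join_zero, add_zero] at this
      exact this.mono (by simp [Sequent.wt, Formula.wt]; omega)
  | refute U Γ Θ Δ hU =>
    simp only [add_assoc]
    refine (searchSucceeds_refute hU le_rfl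
      ((ih _ rfl).mono (by simp [Sequent.wt])) (hΘ Θ)).mono ?_
    simp [Sequent.wt, formulasWt_join]; omega
  | d₁ h hM U Γ Θ Δ hU =>
    have ih₁ := ih _ (Or.inl rfl)
    have ih₂ := fun A hA => ih ⟨0, 0, {A}⟩ (Or.inr ⟨A, hA, rfl⟩)
    have hc := hU.1
    simp only [add_assoc]
    have : SearchSucceeds L (formulasWt 2 U.join + 1)
        (⟨Γ + Γ', U.join ::ₘ (Θ + Θ'), Δ + Δ'⟩ ::ₘ G) := by
      refine .step G (.d₁ h hM _ _ _ _) fun P hP => ?_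
      simp only [Multiset.mem_cons, Multiset.mem_map] at hP
      rcases hP with rfl | ⟨A, hA, rfl⟩
      · exact (ih₁.mono (by simp [Sequent.wt])).created G
      · refine ((ih₂ A hA).mono ?_).created G
        have := Formula.wt_le_of_mem (b := 2) hA
        simp [Sequent.wt]; omega
    refine (SearchSucceeds.merge hU this).mono ?_
    simp [Sequent.wt, formulasWt_join]; omega
  | d₂ h hM U V Γ Θ Δ hU hV =>
    have ih₁ := ih _ (Or.inl rfl)
    have ih₂ := fun A hA B hB => ih ⟨0, 0, {A, B}⟩ (Or.inr ⟨A, hA, B, hB, rfl⟩)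
    have hc := hU.1
    have hc' := hV.1
    simp only [add_assoc]
    have : SearchSucceeds L (formulasWt 2 U.join + formulasWt 2 V.join + 1)
        (⟨Γ + Γ', U.join ::ₘ V.join ::ₘ (Θ + Θ'), Δ + Δ'⟩ ::ₘ G) := by
      refine .step G (.d₂ h hM _ _ _ _ _) fun P hP => ?_
      simp only [Multiset.mem_cons, Multiset.mem_map, Multiset.mem_product, Prod.exists] at hP
      rcases hP with rfl | ⟨A, B, ⟨hA, hB⟩, rfl⟩
      · exact (ih₁.mono (by simp [Sequent.wt])).created G
      · refine ((ih₂ A hA B hB).mono ?_).created G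
        have := Formula.wt_le_of_mem (b := 2) hA
        have := Formula.wt_le_of_mem (b := 2) hB
        simp [Sequent.wt]; omega
    -- Backwards from the two merged blocks, the groups are split up one after the other, first `V`
    -- and then `U`.
    rw [Multiset.cons_swap] at this
    have := SearchSucceeds.merge (Θ := U.join ::ₘ (Θ + Θ')) hV this
    rw [Multiset.add_cons] at this
    refine (SearchSucceeds.merge hU this).mono ?_
    simp [Sequent.wt, formulasWt_join]; omega

theorem Prov.searchGood {L : Logic} {S : Sequent} (h : Prov L S) :
    SearchGood L (S.wt 2 1 0) S := by
  induction h with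
  | rule h hS ih => exact h.searchGood ih

/-- The other components are an idle context; the search works on the provable one only. -/
theorem Prov.searchSucceeds {L : Logic} {G : Hypersequent} {S : Sequent} (h : Prov L S)
    (hS : S ∈ G) : SearchSucceeds L (2 * hypersequentSize G) (searchStart L G) := by
  obtain ⟨G, rfl⟩ := Multiset.exists_cons_of_mem hS
  have := h.searchGood.applyN 0 (G.map (applyN L))
  simp only [zero_add] at this
  simp only [searchStart, Multiset.map_cons]
  refine this.mono ?_
  have := S.wt_le_mul_size (b := 2) (k := 1) (s := 0) (by omega) (by omega) (by omega)
  simp only [hypersequentSize, Multiset.map_cons, Multiset.sum_cons]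
  omega

/-! ### From the search to the calculus -/

theorem Derivable.of_applyN {L : Logic} {S : Sequent} {G : Hypersequent}
    (h : Derivable L (applyN L S ::ₘ G)) : Derivable L (S ::ₘ G) := by
  unfold applyN at h
  split at h
  · exact .n ‹_› G S h
  · exact h

theorem Derivable.of_map_applyN {L : Logic} (H : Hypersequent) {G : Hypersequent}
    (h : Derivable L (H.map (applyN L) + G)) : Derivable L (H + G) := by
  induction H using Multiset.induction generalizing G with
  | empty => simpa using h
  | cons S H ih =>
    rw [Multiset.cons_add, ← Multiset.add_cons]
    refine ih ?_
    rw [Multiset.add_cons]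
    exact .of_applyN (by simpa using h)

/-- Where the search puts ⟨⊤⟩ into a created component, the derivation has an application of N. -/
theorem SearchSucceeds.derivable_of {L : Logic} {n : ℕ} {H : Hypersequent}
    (h : SearchSucceeds L n H) : Derivable L H := by
  induction h with
  | @step n S Ps G h hP ih =>
    refine .rule G h fun P hP => ?_
    have := ih P hP
    rw [Premiss.searchFill, ← Multiset.add_cons] at this
    rw [Premiss.fill, ← Multiset.add_cons]
    exact .of_map_applyN _ this

theorem SearchSucceeds.derivable {L : Logic} {n : ℕ} {G : Hypersequent}
    (h : SearchSucceeds L n (searchStart L G)) : Derivable L G := by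
  simpa using Derivable.of_map_applyN (G := 0) G (by simpa [searchStart] using h.derivable_of)

/-! ### From the calculus to the normalised calculus -/

def Formula.isTop : Formula → Bool
  | top => true
  | _ => false

theorem Formula.isTop_iff {A : Formula} : A.isTop = true ↔ A = top := by
  cases A <;> simp [isTop]

/-- Remove all occurrences of `⊤`. -/
def strip (X : Multiset Formula) : Multiset Formula := X.filter fun A => A.isTop = false

theorem strip_add (X Y : Multiset Formula) : strip (X + Y) = strip X + strip Y :=
  Multiset.filter_add _ _ _

theorem strip_cons_of_ne {A : Formula} (hA : A.isTop = false) (X : Multiset Formula) :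
    strip (A ::ₘ X) = A ::ₘ strip X := Multiset.filter_cons_of_pos _ hA

theorem strip_le (X : Multiset Formula) : strip X ≤ X := Multiset.filter_le _ _

theorem strip_zero : strip 0 = 0 := rfl

theorem mem_strip {A : Formula} {X : Multiset Formula} :
    A ∈ strip X ↔ A ∈ X ∧ A.isTop = false := by simp [strip]

/-- The blocks `Ψ` arise from disjoint groups of blocks of `Θ` by merging, by adding and removing
formulas `⊤`, and, in the presence of N, by adding blocks that consist of formulas `⊤`. -/
inductive BlockSim (L : Logic) : Multiset (Multiset Formula) → Multiset (Multiset Formula) → Prop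
  | nil (Θ) : BlockSim L 0 Θ
  | drop {X Ψ Θ} (hN : L.N = true) (hX : strip X = 0) (h : BlockSim L Ψ Θ) :
      BlockSim L (X ::ₘ Ψ) Θ
  | merge {X U Ψ Θ} (hU : MergeCard L U.card) (hX : strip X = strip U.join)
      (h : BlockSim L Ψ Θ) : BlockSim L (X ::ₘ Ψ) (U + Θ)

theorem BlockSim.weaken {L : Logic} {Ψ Θ : Multiset (Multiset Formula)} (h : BlockSim L Ψ Θ)
    (V : Multiset (Multiset Formula)) : BlockSim L Ψ (V + Θ) := by
  induction h with
  | nil Θ => exact .nil _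
  | drop hN hX h ih => exact .drop hN hX ih
  | merge hU hX h ih => rw [add_left_comm]; exact .merge hU hX ih

/-- Recovers the group `V` from which the block `X` arose. The group is empty only for a block
supplied by N. -/
theorem BlockSim.cons_inv {L : Logic} {X : Multiset Formula} {Ψ Θ : Multiset (Multiset Formula)}
    (h : BlockSim L (X ::ₘ Ψ) Θ) :
    ∃ V Θ', Θ = V + Θ' ∧ BlockSim L Ψ Θ' ∧ strip X = strip V.join ∧
      ((L.N = true ∧ V = 0) ∨ MergeCard L V.card) := by
  generalize hΦ : X ::ₘ Ψ = Φ at h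
  induction h generalizing Ψ with
  | nil Θ => simp at hΦ
  | @drop Y Φ Θ hN hY h ih =>
    rcases Multiset.cons_eq_cons.1 hΦ with ⟨rfl, rfl⟩ | ⟨_, Φ', rfl, rfl⟩
    · exact ⟨0, Θ, by simp, h, by simpa [strip_zero] using hY, Or.inl ⟨hN, rfl⟩⟩
    · obtain ⟨V, Θ', rfl, h1, h2⟩ := ih rfl
      exact ⟨V, Θ', rfl, .drop hN hY h1, h2⟩
  | @merge Y U Φ Θ hU hY h ih =>
    rcases Multiset.cons_eq_cons.1 hΦ with ⟨rfl, rfl⟩ | ⟨_, Φ', rfl, rfl⟩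
    · exact ⟨U, Θ, rfl, h, hY, Or.inr hU⟩
    · obtain ⟨V, Θ', rfl, h1, h2⟩ := ih rfl
      exact ⟨V, U + Θ', add_left_comm _ _ _, .merge hU hY h1, h2⟩

/-- The groups of several blocks are united. Without C every group has at most one element, so the
union does not exceed the number of principal blocks that a rule allows. -/
theorem BlockSim.add_inv {L : Logic} (Ξ : Multiset (Multiset Formula))
    {Ψ Θ : Multiset (Multiset Formula)} (h : BlockSim L (Ξ + Ψ) Θ) :
    ∃ V Θ', Θ = V + Θ' ∧ BlockSim L Ψ Θ' ∧ strip Ξ.join = strip V.join ∧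
      (L.C = true ∨ V.card ≤ Ξ.card) ∧ (V = 0 → L.N = true ∨ Ξ = 0) := by
  induction Ξ using Multiset.induction generalizing Θ with
  | empty => exact ⟨0, Θ, by simp, by simpa using h, rfl, by simp, by simp⟩
  | cons X Ξ ih =>
    rw [Multiset.cons_add] at h
    obtain ⟨V, Θ', rfl, h1, h2, h3⟩ := h.cons_inv
    obtain ⟨W, Θ'', rfl, h4, h5, h6, h7⟩ := ih h1
    refine ⟨V + W, Θ'', (add_assoc _ _ _).symm, h4, by simp [strip_add, h2, h5], ?_, ?_⟩
    · rcases h3 with ⟨-, rfl⟩ | ⟨-, h3⟩ <;> simp only [Multiset.card_add, Multiset.card_cons,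
        Multiset.card_zero] <;> rcases h6 with h6 | h6
      · exact .inl h6
      · exact .inr (by omega)
      · exact .inl h6
      · exact h3.imp_right fun h3 => by omega
    · intro h
      rcases h3 with ⟨h3, -⟩ | ⟨h3, -⟩
      · exact Or.inl h3
      · simp_all

theorem BlockSim.of_cons {L : Logic} {X : Multiset Formula} {Ψ Θ : Multiset (Multiset Formula)}
    (h : BlockSim L (X ::ₘ Ψ) Θ) : BlockSim L Ψ Θ := by
  obtain ⟨V, Θ', rfl, h, -⟩ := h.cons_inv
  exact h.weaken V

theorem BlockSim.of_add {L : Logic} (Ξ : Multiset (Multiset Formula))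
    {Ψ Θ : Multiset (Multiset Formula)} (h : BlockSim L (Ξ + Ψ) Θ) : BlockSim L Ψ Θ := by
  obtain ⟨V, Θ', rfl, h, -⟩ := h.add_inv
  exact h.weaken V

theorem BlockSim.refl {L : Logic} (Θ : Multiset (Multiset Formula)) : BlockSim L Θ Θ := by
  induction Θ using Multiset.induction with
  | empty => exact .nil _
  | cons X Θ ih =>
    rw [← Multiset.singleton_add]
    exact .merge (U := {X}) ⟨by simp, by simp⟩ (by simp) ih

/-! ### Replacing sequents by the sequents that they simulate -/

/-- `S₀` can replace `S` in the normalised calculus. -/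
def SeqSim (L : Logic) (S S₀ : Sequent) : Prop :=
  strip S.form ≤ S₀.form ∧ BlockSim L S.blocks S₀.blocks ∧ S.succ ≤ S₀.succ

theorem SeqSim.refl (L : Logic) (S : Sequent) : SeqSim L S S :=
  ⟨strip_le _, .refl _, le_rfl⟩

/-- All sequents that can replace `S` are provable. -/
def ProvSim (L : Logic) (S : Sequent) : Prop := ∀ S₀, SeqSim L S S₀ → Prov L S₀

/-- No rule has ⊤ as principal formula of the antecedent; so ignoring ⊤ there never hides a
principal formula. -/
theorem form_cons_inv {A : Formula} (hA : A.isTop = false) {Γ Γ₀ : Multiset Formula}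
    (h : strip (A ::ₘ Γ) ≤ Γ₀) : ∃ Γ₁, Γ₀ = A ::ₘ Γ₁ ∧ strip Γ ≤ Γ₁ := by
  rw [strip_cons_of_ne hA] at h
  obtain ⟨Γ₁, rfl⟩ := Multiset.exists_cons_of_mem
    (Multiset.mem_of_le h (Multiset.mem_cons_self A _))
  exact ⟨Γ₁, rfl, (Multiset.cons_le_cons_iff A).1 h⟩

theorem cons_inv_of_le {A : Formula} {Δ Δ₀ : Multiset Formula}
    (h : A ::ₘ Δ ≤ Δ₀) : ∃ Δ₁, Δ₀ = A ::ₘ Δ₁ ∧ Δ ≤ Δ₁ := by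
  obtain ⟨Γ₁, rfl⟩ := Multiset.exists_cons_of_mem
    (Multiset.mem_of_le h (Multiset.mem_cons_self A _))
  exact ⟨Γ₁, rfl, (Multiset.cons_le_cons_iff A).1 h⟩

theorem strip_cons_le {A : Formula} {Γ Γ₀ : Multiset Formula} (h : strip Γ ≤ Γ₀) :
    strip (A ::ₘ Γ) ≤ A ::ₘ Γ₀ := by
  by_cases hA : A.isTop = false
  · rw [strip_cons_of_ne hA]; exact Multiset.cons_le_cons A h
  · exact (by rwa [strip, Multiset.filter_cons_of_neg Γ hA] : strip (A ::ₘ Γ) ≤ Γ₀).trans (Multiset.le_cons_self _ _)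

theorem Prov.topR {L : Logic} {Γ Δ : Multiset Formula} {Θ : Multiset (Multiset Formula)}
    (h : Formula.top ∈ Δ) : Prov L ⟨Γ, Θ, Δ⟩ := by
  obtain ⟨Δ, rfl⟩ := Multiset.exists_cons_of_mem h
  exact .rule (.topR _ _ _) (by simp)

/-- Opening a merged block amounts to opening the blocks of its group one by one, so T needs no
version for groups. -/
theorem Prov.t {L : Logic} (hT : L.T = true) (U : Multiset (Multiset Formula))
    {Γ Δ : Multiset Formula} {Θ : Multiset (Multiset Formula)}
    (h : Prov L ⟨U.join + Γ, Θ, Δ⟩) : Prov L ⟨Γ, U + Θ, Δ⟩ := by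
  induction U using Multiset.induction generalizing Γ with
  | empty => simpa using h
  | cons X U ih =>
    rw [Multiset.cons_add]
    refine .rule (.t hT _ _ _ _) fun T hT => ?_
    rw [Set.mem_singleton_iff] at hT
    subst hT
    exact ih (by simpa [add_left_comm, add_assoc] using h)

theorem ProvSim.created {L : Logic} {X Δ : Multiset Formula} (h : ProvSim L ⟨X, 0, Δ⟩)
    {Y : Multiset Formula} (hY : strip X = strip Y) : Prov L ⟨Y, 0, Δ⟩ :=
  h _ ⟨hY ▸ strip_le _, .nil _, le_rfl⟩

/-- The formulas of `V` that are not in `X` can only be ⊤, and for these the side premiss is an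
axiom. -/
theorem ProvSim.mem {L : Logic} {Γ X : Multiset Formula} {V : Multiset (Multiset Formula)}
    (hX : strip X = strip V.join) (h : ∀ A ∈ X, ProvSim L ⟨Γ, 0, {A}⟩) :
    ∀ A ∈ V.join, Prov L ⟨Γ, 0, {A}⟩ := by
  intro A hA
  by_cases ht : A.isTop = true
  · rw [Formula.isTop_iff.1 ht]; exact .topR (by simp)
  · have : A ∈ strip X := hX ▸ mem_strip.2 ⟨hA, by simpa using ht⟩
    exact (h A (mem_strip.1 this).1).created rfl

/-- If nothing but ⊤ is refuted, then the empty sequent can replace the refuted one, and hence so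
can any sequent. -/
theorem ProvSim.of_strip_eq_zero {L : Logic} {X : Multiset Formula} (h : ProvSim L ⟨X, 0, 0⟩)
    (hX : strip X = 0) (S : Sequent) : Prov L S :=
  h S ⟨by simp [hX], .nil _, zero_le⟩

theorem ProvSim.refute {L : Logic} {Ξ V : Multiset (Multiset Formula)}
    (h : ProvSim L ⟨Ξ.join, 0, 0⟩) (hV : strip Ξ.join = strip V.join)
    (hc : V ≠ 0 → RefuteCard L V.card) (Γ Θ Δ) : Prov L ⟨Γ, V + Θ, Δ⟩ := by
  by_cases h0 : V = 0
  · exact h.of_strip_eq_zero (by simpa [h0, strip_zero] using hV) _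
  · refine .rule (.refute V _ _ _ (hc h0)) fun T hT => ?_
    rw [Set.mem_singleton_iff] at hT
    subst hT
    exact h.created hV

theorem card_pos_of_ne_zero {V : Multiset (Multiset Formula)} (h : V ≠ 0) : 1 ≤ V.card :=
  Multiset.card_pos.2 h

/-- A rule on the merged blocks becomes the normalised rule on the groups from which they arose. C
itself only unites two groups and leaves no trace. A block that N supplied has the empty group,
which R□ admits and which elsewhere makes the premiss trivial or the second block of D₂ superfluous.
-/
theorem Rule.provSim {L : Logic} {S : Sequent} {Ps : Multiset Premiss} (h : Rule L S Ps)
    (hP : ∀ P ∈ Ps, ProvSim L P.rest ∨ ∃ T ∈ P.created, ProvSim L T) : ProvSim L S := by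
  rintro ⟨Γ₀, Θ₀, Δ₀⟩ ⟨hΓ, hΘ, hΔ⟩
  dsimp only at hΓ hΘ hΔ
  cases h with
  | init p Γ Θ Δ =>
    obtain ⟨Γ₀, rfl, -⟩ := form_cons_inv rfl hΓ
    obtain ⟨Δ₀, rfl, -⟩ := cons_inv_of_le hΔ
    exact .rule (.init _ _ _ _) (by simp)
  | botL Γ Θ Δ =>
    obtain ⟨Γ₀, rfl, -⟩ := form_cons_inv rfl hΓ
    exact .rule (.botL _ _ _) (by simp)
  | topR Γ Θ Δ =>
    obtain ⟨Δ₀, rfl, -⟩ := cons_inv_of_le hΔ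
    exact .topR (by simp)
  | impL A B Γ Θ Δ =>
    obtain ⟨Γ₀, rfl, hΓ'⟩ := form_cons_inv rfl hΓ
    simp only [Multiset.insert_eq_cons, Multiset.mem_cons, Multiset.mem_singleton, forall_eq_or_imp,
      forall_eq, Multiset.notMem_zero, false_and, exists_false, or_false] at hP
    refine .rule (.impL A B _ _ _) ?_
    rintro T (rfl | rfl)
    · exact hP.1 _ ⟨hΓ', hΘ, Multiset.cons_le_cons A hΔ⟩
    · exact hP.2 _ ⟨strip_cons_le hΓ', hΘ, hΔ⟩
  | impR A B Γ Θ Δ =>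
    obtain ⟨Δ₀, rfl, hΔ'⟩ := cons_inv_of_le hΔ
    simp only [Multiset.mem_singleton,
      forall_eq, Multiset.notMem_zero, false_and, exists_false, or_false] at hP
    refine .rule (.impR A B _ _ _) ?_
    rintro T rfl
    exact hP _ ⟨strip_cons_le hΓ, hΘ, Multiset.cons_le_cons B hΔ'⟩
  | andL A B Γ Θ Δ =>
    obtain ⟨Γ₀, rfl, hΓ'⟩ := form_cons_inv rfl hΓ
    simp only [Multiset.mem_singleton,
      forall_eq, Multiset.notMem_zero, false_and, exists_false, or_false] at hP
    refine .rule (.andL A B _ _ _) ?_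
    rintro T rfl
    exact hP _ ⟨strip_cons_le (strip_cons_le hΓ'), hΘ, hΔ⟩
  | andR A B Γ Θ Δ =>
    obtain ⟨Δ₀, rfl, hΔ'⟩ := cons_inv_of_le hΔ
    simp only [Multiset.insert_eq_cons, Multiset.mem_cons, Multiset.mem_singleton, forall_eq_or_imp,
      forall_eq, Multiset.notMem_zero, false_and, exists_false, or_false] at hP
    refine .rule (.andR A B _ _ _) ?_
    rintro T (rfl | rfl)
    · exact hP.1 _ ⟨hΓ, hΘ, Multiset.cons_le_cons A hΔ'⟩
    · exact hP.2 _ ⟨hΓ, hΘ, Multiset.cons_le_cons B hΔ'⟩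
  | orL A B Γ Θ Δ =>
    obtain ⟨Γ₀, rfl, hΓ'⟩ := form_cons_inv rfl hΓ
    simp only [Multiset.insert_eq_cons, Multiset.mem_cons, Multiset.mem_singleton, forall_eq_or_imp,
      forall_eq, Multiset.notMem_zero, false_and, exists_false, or_false] at hP
    refine .rule (.orL A B _ _ _) ?_
    rintro T (rfl | rfl)
    · exact hP.1 _ ⟨strip_cons_le hΓ', hΘ, hΔ⟩
    · exact hP.2 _ ⟨strip_cons_le hΓ', hΘ, hΔ⟩
  | orR A B Γ Θ Δ =>
    obtain ⟨Δ₀, rfl, hΔ'⟩ := cons_inv_of_le hΔ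
    simp only [Multiset.mem_singleton,
      forall_eq, Multiset.notMem_zero, false_and, exists_false, or_false] at hP
    refine .rule (.orR A B _ _ _) ?_
    rintro T rfl
    exact hP _ ⟨hΓ, hΘ, Multiset.cons_le_cons A (Multiset.cons_le_cons B hΔ')⟩
  | boxL A Γ Θ Δ =>
    obtain ⟨Γ₀, rfl, hΓ'⟩ := form_cons_inv rfl hΓ
    simp only [Multiset.mem_singleton,
      forall_eq, Multiset.notMem_zero, false_and, exists_false, or_false] at hP
    refine .rule (.boxL A _ _ _) ?_
    rintro T rfl
    refine hP _ ⟨hΓ', ?_, hΔ⟩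
    simpa using BlockSim.merge (L := L) (X := {A}) (U := {{A}}) ⟨by simp, by simp⟩ (by simp) hΘ
  | boxR hM X B Γ Θ Δ =>
    obtain ⟨Δ₀, rfl, hΔ'⟩ := cons_inv_of_le hΔ
    simp only [Multiset.mem_cons, Multiset.mem_map, forall_eq_or_imp, forall_exists_index, and_imp,
      forall_apply_eq_imp_iff₂, Multiset.mem_singleton, exists_eq_left] at hP
    -- If the remainder of the component is good, weakening suffices. Otherwise all premisses owe
    -- their success to what they create, and these components are jointly the premisses of one
    -- normalised rule.
    by_cases hr : ProvSim L ⟨Γ, Θ, Δ⟩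
    · exact hr _ ⟨hΓ, hΘ.of_cons, hΔ'.trans (Multiset.le_cons_self _ _)⟩
    simp only [hr, false_or] at hP
    obtain ⟨V, Θ', rfl, -, hV, hc⟩ := hΘ.cons_inv
    refine .rule (.boxR hM V B _ _ _ hc.symm) ?_
    rintro T (rfl | ⟨A, hA, rfl⟩)
    · exact hP.1.created hV
    · exact ProvSim.mem hV hP.2 A hA
  | boxRm hM X B Γ Θ Δ =>
    obtain ⟨Δ₀, rfl, hΔ'⟩ := cons_inv_of_le hΔ
    simp only [Multiset.mem_singleton, exists_eq_left, forall_eq] at hP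
    rcases hP with hr | hP
    · exact hr _ ⟨hΓ, hΘ.of_cons, hΔ'.trans (Multiset.le_cons_self _ _)⟩
    obtain ⟨V, Θ', rfl, -, hV, hc⟩ := hΘ.cons_inv
    refine .rule (.boxRm hM V B _ _ _ hc.symm) ?_
    rintro T rfl
    exact hP.created hV
  | c hC X Y Γ Θ Δ =>
    simp only [Multiset.mem_singleton,
      forall_eq, Multiset.notMem_zero, false_and, exists_false, or_false] at hP
    refine hP _ ⟨hΓ, ?_, hΔ⟩
    obtain ⟨V, Θ', rfl, h1, hV, hc⟩ := hΘ.cons_inv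
    obtain ⟨W, Θ'', rfl, h2, hW, hc'⟩ := h1.cons_inv
    dsimp only
    have hs : strip (X + Y) = strip (V + W).join := by simp [strip_add, hV, hW]
    -- If both blocks were supplied by N, their union counts as supplied by N; otherwise C makes one
    -- group of the two.
    by_cases h0 : V + W = 0
    · have hN : L.N = true := by
        rcases hc with h | h
        · exact h.1
        · have := h.1; simp_all
      refine .weaken (.weaken (.drop hN ?_ h2) _) _
      rw [hs, h0]; rfl
    · rw [← add_assoc]
      exact .merge ⟨card_pos_of_ne_zero h0, Or.inl hC⟩ hs h2
  | t hT X Γ Θ Δ =>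
    simp only [Multiset.mem_singleton,
      forall_eq, Multiset.notMem_zero, false_and, exists_false, or_false] at hP
    obtain ⟨V, Θ', rfl, h1, hV, -⟩ := hΘ.cons_inv
    refine .t hT V (hP _ ⟨?_, h1, hΔ⟩)
    rw [strip_add, hV]
    exact add_le_add (strip_le _) hΓ
  | p h X Γ Θ Δ =>
    simp only [Multiset.mem_singleton, exists_eq_left, forall_eq] at hP
    rcases hP with hr | hP
    · exact hr _ ⟨hΓ, hΘ.of_cons, hΔ⟩
    rw [← Multiset.singleton_add] at hΘ
    obtain ⟨V, Θ', rfl, -, hV, hc, -⟩ := hΘ.add_inv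
    refine ProvSim.refute (Ξ := {X}) (by simpa using hP) hV (fun h0 => ?_) _ _ _
    have h1 := card_pos_of_ne_zero h0
    have hr : RefutesBlock L := by unfold RefutesBlock; tauto
    refine ⟨h1, ?_⟩
    rcases hc with hc | hc
    · exact Or.inl ⟨hc, Or.inl hr⟩
    · exact Or.inr (Or.inl ⟨by simp at hc; omega, hr⟩)
  | d₁ h hM X Γ Θ Δ =>
    simp only [Multiset.mem_cons, Multiset.mem_map, forall_eq_or_imp, forall_exists_index, and_imp,
      forall_apply_eq_imp_iff₂, Multiset.mem_singleton, exists_eq_left] at hP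
    by_cases hr : ProvSim L ⟨Γ, Θ, Δ⟩
    · exact hr _ ⟨hΓ, hΘ.of_cons, hΔ⟩
    simp only [hr, false_or] at hP
    obtain ⟨V, Θ', rfl, -, hV, hc⟩ := hΘ.cons_inv
    -- A block supplied by N consists of ⊤ only, and the main premiss refutes it.
    rcases hc with ⟨-, rfl⟩ | hc
    · exact hP.1.of_strip_eq_zero hV _
    refine .rule (.d₁ h hM V _ _ _ hc) ?_
    rintro T (rfl | ⟨A, hA, rfl⟩)
    · exact hP.1.created hV
    · exact ProvSim.mem hV hP.2 A hA
  | d₂ h hM X Y Γ Θ Δ =>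
    simp only [Multiset.mem_cons, Multiset.mem_map, Multiset.mem_product, forall_eq_or_imp,
      forall_exists_index, and_imp, Prod.forall] at hP
    by_cases hr : ProvSim L ⟨Γ, Θ, Δ⟩
    · exact hr _ ⟨hΓ, hΘ.of_cons.of_cons, hΔ⟩
    obtain ⟨hP₁, hP₂⟩ := hP
    simp only [hr, false_or, Multiset.mem_singleton, exists_eq_left] at hP₁
    have hP₂ : ∀ A ∈ X, ∀ B ∈ Y, ProvSim L ⟨0, 0, {A, B}⟩ := fun A hA B hB => by
      simpa [hr] using hP₂ _ A B hA hB rfl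
    obtain ⟨V, Θ', rfl, h1, hV, hc⟩ := hΘ.cons_inv
    obtain ⟨W, Θ'', rfl, -, hW, hc'⟩ := h1.cons_inv
    have hs : strip (X + Y) = strip (V + W).join := by simp [strip_add, hV, hW]
    rw [← add_assoc]
    by_cases hVW : MergeCard L V.card ∧ MergeCard L W.card
    · refine .rule (.d₂ h hM V W _ _ _ hVW.1 hVW.2) ?_
      rintro T (rfl | ⟨A, hA, B, hB, rfl⟩)
      · rw [← Multiset.join_add]
        exact hP₁.created hs
      · by_cases hA' : A.isTop = true
        · rw [Formula.isTop_iff.1 hA']; exact .topR (by simp)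
        by_cases hB' : B.isTop = true
        · rw [Formula.isTop_iff.1 hB']; exact .topR (by simp)
        have h2 : A ∈ strip X := hV ▸ mem_strip.2 ⟨hA, by simpa using hA'⟩
        have h3 : B ∈ strip Y := hW ▸ mem_strip.2 ⟨hB, by simpa using hB'⟩
        exact (hP₂ A (mem_strip.1 h2).1 B (mem_strip.1 h3).1).created rfl
    -- One of the two groups is empty, so N is present and the other group alone is refuted. This is
    -- the reason why D with N counts as refuting single blocks.
    · refine ProvSim.refute (Ξ := {X + Y}) (by simpa using hP₁) (by simpa using hs)
        (fun h0 => ?_) _ _ _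
      have h1 := card_pos_of_ne_zero h0
      have hN : L.N = true := by
        rcases hc with hc | hc
        · exact hc.1
        · rcases hc' with hc' | hc'
          · exact hc'.1
          · exact absurd ⟨hc, hc'⟩ hVW
      have hr : RefutesBlock L := Or.inr ⟨h, Or.inr hN⟩
      refine ⟨h1, ?_⟩
      rcases hc with ⟨-, rfl⟩ | hc <;> rcases hc' with ⟨-, rfl⟩ | hc'
      · simp at h0
      · rw [zero_add]
        exact hc'.2.imp (fun h => ⟨h, Or.inl hr⟩) fun h => Or.inl ⟨h, hr⟩
      · rw [add_zero]
        exact hc.2.imp (fun h => ⟨h, Or.inl hr⟩) fun h => Or.inl ⟨h, hr⟩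
      · exact absurd ⟨hc, hc'⟩ hVW
  | dM h hM X Y Γ Θ Δ =>
    simp only [Multiset.mem_singleton, exists_eq_left, forall_eq] at hP
    rcases hP with hr | hP
    · exact hr _ ⟨hΓ, hΘ.of_cons.of_cons, hΔ⟩
    rw [← Multiset.singleton_add, ← Multiset.singleton_add, ← add_assoc] at hΘ
    obtain ⟨V, Θ', rfl, -, hV, hc, -⟩ := hΘ.add_inv
    refine ProvSim.refute (Ξ := {X} + {Y}) (by simpa using hP) hV (fun h0 => ?_) _ _ _
    have h1 := card_pos_of_ne_zero h0
    refine ⟨h1, ?_⟩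
    rcases hc with hc | hc
    · exact Or.inl ⟨hc, Or.inl (Or.inr ⟨h, Or.inl hM⟩)⟩
    · exact Or.inr (Or.inr (Or.inl ⟨by simpa using hc, h, hM⟩))
  | dPlus n h Ξ h₁ hn Γ Θ Δ =>
    simp only [Multiset.mem_singleton, exists_eq_left, forall_eq] at hP
    rcases hP with hr | hP
    · exact hr _ ⟨hΓ, hΘ.of_add, hΔ⟩
    obtain ⟨V, Θ', rfl, -, hV, hc, -⟩ := hΘ.add_inv
    refine ProvSim.refute (Ξ := Ξ) hP hV (fun h0 => ?_) _ _ _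
    have h1 := card_pos_of_ne_zero h0
    refine ⟨h1, ?_⟩
    rcases hc with hc | hc
    · exact Or.inl ⟨hc, Or.inr ⟨n, h⟩⟩
    · exact Or.inr (Or.inr (Or.inr ⟨n, h, hc.trans hn⟩))

/-- A disjunction property, which holds because the context is the same in all premisses and is not
used by the rule. -/
theorem Derivable.exists_provSim {L : Logic} {G : Hypersequent} (h : Derivable L G) :
    ∃ S ∈ G, ProvSim L S := by
  induction h with
  | @rule S Ps G h hP ih =>
    -- The good component may differ from premiss to premiss. If none is in the common context, each
    -- premiss has it in its own active part.
    by_cases hG : ∃ S ∈ G, ProvSim L S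
    · obtain ⟨S, hS, h⟩ := hG
      exact ⟨S, Multiset.mem_cons_of_mem hS, h⟩
    refine ⟨S, Multiset.mem_cons_self _ _, h.provSim fun P hP => ?_⟩
    obtain ⟨T, hT, hT'⟩ := ih P hP
    simp only [Premiss.fill, Multiset.mem_cons, Multiset.mem_add] at hT
    rcases hT with rfl | hT | hT
    · exact Or.inl hT'
    · exact Or.inr ⟨T, hT, hT'⟩
    · exact absurd ⟨T, hT, hT'⟩ hG
  | n hN G S hP ih =>
    obtain ⟨T, hT, h⟩ := ih
    rcases Multiset.mem_cons.1 hT with rfl | hT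
    -- The ⟨⊤⟩ that N adds corresponds to no block of `S₀`.
    · exact ⟨S, Multiset.mem_cons_self _ _, fun S₀ h₀ => h S₀ ⟨h₀.1, .drop hN rfl h₀.2.1, h₀.2.2⟩⟩
    · exact ⟨T, Multiset.mem_cons_of_mem hT, h⟩

theorem Derivable.exists_prov {L : Logic} {G : Hypersequent} (h : Derivable L G) :
    ∃ S ∈ G, Prov L S := by
  obtain ⟨S, hS, h⟩ := h.exists_provSim
  exact ⟨S, hS, h S (.refl L S)⟩

theorem derivable_iff_exists_prov {L : Logic} {G : Hypersequent} :
    Derivable L G ↔ ∃ S ∈ G, Prov L S :=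
  ⟨fun h => h.exists_prov, fun ⟨_, hS, h⟩ => (h.searchSucceeds hS).derivable⟩

theorem derivable_iff_searchSucceeds {L : Logic} {G : Hypersequent} :
    Derivable L G ↔ SearchSucceeds L (2 * hypersequentSize G) (searchStart L G) :=
  ⟨fun h => by obtain ⟨S, hS, h⟩ := h.exists_prov; exact h.searchSucceeds hS, fun h => h.derivable⟩

/-- The search is correct, also with a cut-off, up to which only small hypersequents are met. -/
theorem search_correct (L : Logic) :
    ∃ p q : Polynomial ℕ, ∀ G : Hypersequent,
      (Derivable L G ↔ ∃ n, SearchSucceeds L n (searchStart L G)) ∧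
      (Derivable L G ↔ SearchSucceeds L (p.eval (hypersequentSize G)) (searchStart L G)) ∧
      ∀ n H, n ≤ p.eval (hypersequentSize G) → SearchRun L n (searchStart L G) H →
        hypersequentSize H ≤ q.eval (hypersequentSize G) := by
  -- The search starts with size at most 3|G|, and each of the 2|G| steps adds at most 2.
  refine ⟨Polynomial.C 2 * Polynomial.X, Polynomial.C 7 * Polynomial.X, fun G => ?_⟩
  simp only [Polynomial.eval_mul, Polynomial.eval_C, Polynomial.eval_X]
  refine ⟨⟨fun h => ⟨_, derivable_iff_searchSucceeds.1 h⟩, fun ⟨n, h⟩ => h.derivable⟩,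
    derivable_iff_searchSucceeds, fun n H hn h => ?_⟩
  have h1 := h.size_le
  have h2 := wt_searchStart_le L 1 1 1 G
  have h3 := card_le_hypersequentSize G
  rw [← hypersequentSize_eq_wt, ← hypersequentSize_eq_wt] at h2
  omega

/-! ### Alternating machines with elementary instructions -/

/-- An instruction of an alternating machine with stacks `K`, alphabet `A` and control states `Q`.
The instructions `pop` and `empty` are tests, which may fail. -/
inductive Instr (K A Q : Type) : Type
  | push (k : K) (a : A) (q : Q)
  | pop (k : K) (a : A) (q : Q)
  | empty (k : K) (q : Q)
  | branch (q₁ q₂ : Q)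
  | stuck

section Machines

open Turing Function

variable {K A Q : Type} [DecidableEq K] (instr : Q → Instr K A Q) (univ : Q → Bool)

/-- `Eval instr univ n q s v`: from the state `q` with the stacks `s`, all paths have length at most
`n`, and the value of the resulting game is `v`. The player who is to move in a universal
(existential) state loses the game with value `true` (`false`) when a test fails. -/
inductive Eval : ℕ → Q → (K → List A) → Bool → Prop
  | push {n q s v k a q'} (h : instr q = .push k a q')
      (he : Eval n q' (update s k (a :: s k)) v) : Eval (n + 1) q s v
  | pop {n q s v k a q' r} (h : instr q = .pop k a q') (hs : s k = a :: r)
      (he : Eval n q' (update s k r) v) : Eval (n + 1) q s v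
  | popFail {n q s k a q'} (h : instr q = .pop k a q') (hs : (s k).head? ≠ some a) :
      Eval n q s (univ q)
  | empty {n q s v k q'} (h : instr q = .empty k q') (hs : s k = [])
      (he : Eval n q' s v) : Eval (n + 1) q s v
  | emptyFail {n q s k q'} (h : instr q = .empty k q') (hs : s k ≠ []) : Eval n q s (univ q)
  | branch {n q s q₁ q₂ v₁ v₂} (h : instr q = .branch q₁ q₂) (h₁ : Eval n q₁ s v₁)
      (h₂ : Eval n q₂ s v₂) : Eval (n + 1) q s (if v₁ = univ q then v₂ else v₁)
  | stuck {n q s} (h : instr q = .stuck) : Eval n q s (univ q)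

/-! ### Alternating polynomial time -/

/-- Halt with the answer `u`. -/
def haltStmt (u : Bool) : TM2.Stmt (fun _ : K => A) Q (Option A × Bool) :=
  .load (fun _ => (none, u)) .halt

open Classical in
/-- The transition functions of the alternating Turing machine for a list of instructions. -/
noncomputable def altStmt (b : Bool) (q : Q) : TM2.Stmt (fun _ : K => A) Q (Option A × Bool) :=
  match instr q with
  | .push k a q' => .push k (fun _ => a) (.goto fun _ => q')
  | .pop k a q' => .peek k (fun v x => (x, v.2)) (.branch (fun v => decide (v.1 = some a))
      (.pop k (fun v _ => v) (.goto fun _ => q')) (haltStmt (univ q)))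
  | .empty k q' => .peek k (fun v x => (x, v.2)) (.branch (fun v => v.1.isNone)
      (.goto fun _ => q') (haltStmt (univ q)))
  | .branch q₁ q₂ => .goto fun _ => if b then q₂ else q₁
  | .stuck => haltStmt (univ q)

/-- The alternating Turing machine for a list of instructions. -/
noncomputable def altMachine [Fintype K] [Fintype A] [Fintype Q] (k₀ : K) (q₀ : Q) :
    AltMachine where
  base :=
    { k₀ := k₀
      k₁ := k₀
      Γ := fun _ : K => A
      Λ := Q
      main := q₀
      σ := Option A × Bool
      initialState := (none, false)
      m := altStmt instr univ false }
  finite_alphabet := fun _ => inferInstanceAs (Finite A)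
  second := altStmt instr univ true
  isUniversal := {q | univ q = true}
  accepting := {v | v.2 = true}

def PathBound (M : AltMachine) (c : M.base.Cfg) (N : ℕ) : Prop :=
  ∀ (n : ℕ) (f : ℕ → M.base.Cfg), f 0 = c → (∀ i < n, ∃ b, f (i + 1) ∈ M.next b (f i)) → n ≤ N

theorem PathBound.step {M : AltMachine} {c : M.base.Cfg} {N : ℕ}
    (h : ∀ b, ∀ c' ∈ M.next b c, PathBound M c' N) : PathBound M c (N + 1) := by
  intro n f h0 hf
  rcases n with _ | n
  · omega
  · obtain ⟨b, hb⟩ := hf 0 (by omega)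
    have := h b (f 1) (h0 ▸ hb) n (fun i => f (i + 1)) rfl fun i hi => hf (i + 1) (by omega)
    omega

theorem PathBound.halted {M : AltMachine} {v : M.base.σ} {s : ∀ k, List (M.base.Γ k)} {N : ℕ} :
    PathBound M ⟨none, v, s⟩ N := by
  intro n f h0 hf
  rcases n with _ | n
  · omega
  · obtain ⟨b, hb⟩ := hf 0 (by omega)
    rw [h0] at hb
    exact absurd hb (Option.not_mem_none _)

open Classical in
theorem AltMachine.accepts_some_iff {M : AltMachine} {q : M.base.Λ} {v : M.base.σ}
    {s : ∀ k, List (M.base.Γ k)} {c' : Bool → M.base.Cfg}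
    (hc : ∀ b, M.next b ⟨some q, v, s⟩ = some (c' b)) :
    M.Accepts ⟨some q, v, s⟩ ↔
      if q ∈ M.isUniversal then ∀ b, M.Accepts (c' b) else ∃ b, M.Accepts (c' b) := by
  constructor
  · intro ha
    cases ha with
    | halt _ h' => exact absurd h' (by simp)
    | existential _ c₁ q' h' hq b hb ha =>
      obtain rfl : q = q' := Option.some.inj h'
      rw [if_neg hq]
      rw [hc b] at hb
      exact ⟨b, (Option.mem_some.1 hb) ▸ ha⟩
    | universal _ q' h' hq ha =>
      obtain rfl : q = q' := Option.some.inj h'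
      rw [if_pos hq]
      exact fun b => ha b _ (hc b)
  · intro ha
    split at ha
    · exact .universal _ q rfl ‹_› fun b c₁ h₁ => by
        rw [hc b] at h₁
        exact Option.mem_some.1 h₁ ▸ ha b
    · obtain ⟨b, ha⟩ := ha
      exact .existential _ _ q rfl ‹_› b (hc b) ha

theorem AltMachine.accepts_none_iff {M : AltMachine} {v : M.base.σ}
    {s : ∀ k, List (M.base.Γ k)} :
    M.Accepts ⟨none, v, s⟩ ↔ v ∈ M.accepting := by
  constructor
  · intro ha
    cases ha with
    | halt _ _ ha => exact ha
    | existential _ _ _ h' => exact absurd h' (by simp)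
    | universal _ _ h' => exact absurd h' (by simp)
  · exact AltMachine.Accepts.halt ⟨none, v, s⟩ rfl

/-- Acceptance and time of the machine for a list of instructions, in terms of its statements. -/
structure AltSpec (acc : TM2.Cfg (fun _ : K => A) Q (Option A × Bool) → Prop)
    (bound : TM2.Cfg (fun _ : K => A) Q (Option A × Bool) → ℕ → Prop) : Prop where
  accSome : ∀ q x s, acc ⟨some q, x, s⟩ ↔
    if univ q = true then ∀ b, acc (TM2.stepAux (altStmt instr univ b q) x s)
    else ∃ b, acc (TM2.stepAux (altStmt instr univ b q) x s)
  accNone : ∀ x s, acc ⟨none, x, s⟩ ↔ x.2 = true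
  boundSome : ∀ q x s n, (∀ b, bound (TM2.stepAux (altStmt instr univ b q) x s) n) →
    bound ⟨some q, x, s⟩ (n + 1)
  boundNone : ∀ x s n, bound ⟨none, x, s⟩ n

/-- All that the induction on `Eval` needs, stated for configurations over a constant alphabet; this
hides the dependent types of `AltMachine`. -/
theorem altMachine_spec [Fintype K] [Fintype A] [Fintype Q] (k₀ : K) (q₀ : Q) :
    AltSpec instr univ (altMachine instr univ k₀ q₀).Accepts
      (PathBound (altMachine instr univ k₀ q₀)) where
  accSome q x s := by
    have := AltMachine.accepts_some_iff (M := altMachine instr univ k₀ q₀) (q := q) (v := x)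
      (s := s) (c' := fun b => TM2.stepAux (altStmt instr univ b q) x s)
      (fun b => by cases b <;> rfl)
    refine this.trans ?_
    by_cases h : univ q = true
    · rw [if_pos h]
      exact iff_of_eq (if_pos h)
    · rw [if_neg h]
      exact iff_of_eq (if_neg h)
  accNone x s := AltMachine.accepts_none_iff (M := altMachine instr univ k₀ q₀)
  boundSome q x s n h := .step fun b c' hc => by
    have := h b
    cases b <;> exact Option.some.inj hc ▸ this
  boundNone x s n := PathBound.halted

variable {instr univ}

/-- One step is added to the bound because a failing test costs nothing in `Eval`, while the machine
takes a step to halt. -/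
theorem Eval.altSpec {acc : TM2.Cfg (fun _ : K => A) Q (Option A × Bool) → Prop}
    {bound : TM2.Cfg (fun _ : K => A) Q (Option A × Bool) → ℕ → Prop}
    (hs : AltSpec instr univ acc bound)
    {n : ℕ} {q : Q} {s : K → List A} {v : Bool} (h : Eval instr univ n q s v)
    (x : Option A × Bool) :
    (acc ⟨some q, x, s⟩ ↔ v = true) ∧ bound ⟨some q, x, s⟩ (n + 1) := by
  have key : ∀ {n q x s v} (c : Bool → TM2.Cfg (fun _ : K => A) Q (Option A × Bool)),
      (∀ b, TM2.stepAux (altStmt instr univ b q) x s = c b) →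
      (∀ b, bound (c b) n) →
      ((if univ q = true then ∀ b, acc (c b) else ∃ b, acc (c b)) ↔ v = true) →
      ((acc ⟨some q, x, s⟩ ↔ v = true) ∧ bound ⟨some q, x, s⟩ (n + 1)) := by
    intro n q x s v c hc hb hv
    obtain rfl : (fun b => TM2.stepAux (altStmt instr univ b q) x s) = c := funext hc
    exact ⟨(hs.accSome q x s).trans hv, hs.boundSome q x s n hb⟩
  have hfail : ∀ {n q x s}, (∀ b, TM2.stepAux (altStmt instr univ b q) x s =
        ⟨none, (none, univ q), s⟩) →
      ((acc ⟨some q, x, s⟩ ↔ univ q = true) ∧ bound ⟨some q, x, s⟩ (n + 1)) := by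
    intro n q x s hc
    refine key (fun _ => ⟨none, (none, univ q), s⟩) hc (fun b => hs.boundNone _ _ _) ?_
    rw [hs.accNone]
    simp
  induction h generalizing x with
  | @push n q s v k a q' h he ih =>
    refine key (fun _ => ⟨some q', x, update s k (a :: s k)⟩) (fun b => ?_) (fun b => (ih x).2) ?_
    · simp [altStmt, h]
    · simpa using (ih x).1
  | @pop n q s v k a q' r h hk he ih =>
    refine key (fun _ => ⟨some q', (some a, x.2), update s k r⟩) (fun b => ?_)
      (fun b => (ih _).2) ?_
    · simp [altStmt, h, hk]
    · simpa using (ih _).1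
  | @popFail n q s k a q' h hk =>
    refine hfail fun b => ?_
    simp [altStmt, h, hk, haltStmt]
  | @empty n q s v k q' h hk he ih =>
    refine key (fun _ => ⟨some q', (none, x.2), s⟩) (fun b => ?_) (fun b => (ih _).2) ?_
    · simp [altStmt, h, hk]
    · simpa using (ih _).1
  | @emptyFail n q s k q' h hk =>
    refine hfail fun b => ?_
    obtain ⟨a, r, hr⟩ := List.exists_cons_of_ne_nil hk
    simp [altStmt, h, hr, haltStmt]
  | @branch n q s q₁ q₂ v₁ v₂ h h₁ h₂ ih₁ ih₂ =>
    refine key (fun b => ⟨some (if b then q₂ else q₁), x, s⟩) (fun b => ?_) (fun b => ?_) ?_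
    · simp [altStmt, h]
    · cases b
      · exact (ih₁ x).2
      · exact (ih₂ x).2
    · have h3 := (ih₁ x).1
      have h4 := (ih₂ x).1
      cases v₁ <;> cases v₂ <;> cases hu : univ q <;> simp_all
  | @stuck n q s h =>
    refine hfail fun b => ?_
    simp [altStmt, h, haltStmt]

theorem initList_stk (M : FinTM2) (w : List (M.Γ M.k₀)) :
    (initList M w).stk = update (fun _ => []) M.k₀ w := by
  funext k
  by_cases h : k = M.k₀
  · subst h
    simp [initList]
  · simp [initList, h]

theorem initList_eq (M : FinTM2) (w : List (M.Γ M.k₀)) :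
    initList M w = ⟨some M.main, M.initialState, update (fun _ => []) M.k₀ w⟩ := by
  rw [← initList_stk]
  rfl

theorem inAlternatingPTime_of_eval [Fintype K] [Fintype A] [Fintype Q] {α : Type} {S : Set (List α)} (k₀ : K) (q₀ : Q) (e : α ↪ A)
    (p : Polynomial ℕ)
    (h : ∀ w : List α, ∃ v, Eval instr univ (p.eval w.length) q₀
      (update (fun _ => []) k₀ (w.map e)) v ∧ (v = true ↔ w ∈ S)) :
    InAlternatingPTime S := by
  refine ⟨altMachine instr univ k₀ q₀, e, p + 1, fun w => ?_⟩
  obtain ⟨v, hv, hw⟩ := h w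
  have h1 := hv.altSpec (altMachine_spec instr univ k₀ q₀) (none, false)
  have h2 := initList_eq (altMachine instr univ k₀ q₀).base (w.map e)
  refine ⟨?_, fun n c h0 hc => ?_⟩
  · refine hw.symm.trans (h1.1.symm.trans ?_)
    exact iff_of_eq (congrArg (altMachine instr univ k₀ q₀).Accepts h2.symm)
  · have := h1.2 n c (h0.trans h2) hc
    simpa using this

end Machines

/-! ### Polynomial space -/

/-- `c` leads to `d` by steps of `f` through configurations of space at most `B`. -/
inductive BoundedReach {C : Type} (f : C → Option C) (sp : C → ℕ) (B : ℕ) : C → C → Prop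
  | refl (c) (h : sp c ≤ B) : BoundedReach f sp B c c
  | head {c c' d} (h : sp c ≤ B) (hc : f c = some c') (hd : BoundedReach f sp B c' d) :
      BoundedReach f sp B c d

theorem BoundedReach.trans {C : Type} {f : C → Option C} {sp : C → ℕ} {B : ℕ} {c d e : C}
    (h : BoundedReach f sp B c d) (h' : BoundedReach f sp B d e) : BoundedReach f sp B c e := by
  induction h with
  | refl => exact h'
  | head h hc _ ih => exact .head h hc (ih h')

theorem BoundedReach.reaches {C : Type} {f : C → Option C} {sp : C → ℕ} {B : ℕ} {c d : C}
    (h : BoundedReach f sp B c d) : StateTransition.Reaches f c d := by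
  induction h with
  | refl => exact .refl
  | head h hc _ ih => exact .head hc ih

/-- By determinism, everything reachable lies on the one path that ends in the halted `d`. -/
theorem BoundedReach.space_le {C : Type} {f : C → Option C} {sp : C → ℕ} {B : ℕ} {c d e : C}
    (h : BoundedReach f sp B c d) (hd : f d = none) (he : StateTransition.Reaches f c e) :
    sp e ≤ B := by
  induction h with
  | refl c h =>
    rcases he.cases_head with rfl | ⟨c', hc', -⟩
    · exact h
    · rw [hd] at hc'; exact absurd hc' (Option.not_mem_none _)
  | head h hc _ ih =>
    rcases he.cases_head with rfl | ⟨c', hc', he⟩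
    · exact h
    · rw [hc] at hc'
      obtain rfl := Option.some.inj hc'
      exact ih hd he

section Machines

open Turing Function

variable {K A Q : Type} [DecidableEq K] (instr : Q → Instr K A Q) (univ : Q → Bool)

/-- The labels of the deterministic machine that evaluates the game of an alternating machine:
go forward from a state, go backward with a value, or undo the step that was taken from a state. -/
abbrev DfsLabel (Q : Type) : Type := Q ⊕ Bool ⊕ (Q × Bool × Bool)

abbrev DfsLabel.fwd {Q : Type} (q : Q) : DfsLabel Q := .inl q

abbrev DfsLabel.bwd {Q : Type} (v : Bool) : DfsLabel Q := .inr (.inl v)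

abbrev DfsLabel.undo {Q : Type} (q : Q) (b v : Bool) : DfsLabel Q := .inr (.inr (q, b, v))

/-- The symbols of the deterministic machine: those of the alternating machine, and the entries of
the history stack, which record the states and which successor was taken. -/
abbrev DfsSym (A Q : Type) : Type := A ⊕ (Q × Bool)

abbrev DfsState (A Q : Type) : Type := Option (DfsSym A Q) × Bool

abbrev DfsStmt (K A Q : Type) : Type :=
  TM2.Stmt (fun _ : Option K => DfsSym A Q) (DfsLabel Q) (DfsState A Q)

abbrev DfsCfg (K A Q : Type) : Type :=
  TM2.Cfg (fun _ : Option K => DfsSym A Q) (DfsLabel Q) (DfsState A Q)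

def goBack (v : Bool) : DfsStmt K A Q := .goto fun _ => .bwd v

def record (q : Q) (b : Bool) (q' : Q) : DfsStmt K A Q :=
  .push none (fun _ => .inr (q, b)) (.goto fun _ => .fwd q')

-- A failed test is not recorded in the history: it has changed no stack, and its value, a loss for
-- the player to move, is known at once.
open Classical in
noncomputable def fwdStmt (q : Q) : DfsStmt K A Q :=
  match instr q with
  | .push k a q' => .push (some k) (fun _ => .inl a) (record q false q')
  | .pop k a q' => .peek (some k) (fun v x => (x, v.2))
      (.branch (fun v => decide (v.1 = some (.inl a)))
        (.pop (some k) (fun v _ => v) (record q false q')) (goBack (univ q)))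
  | .empty k q' => .peek (some k) (fun v x => (x, v.2))
      (.branch (fun v => v.1.isNone) (record q false q') (goBack (univ q)))
  | .branch q₁ _ => record q false q₁
  | .stuck => goBack (univ q)

/-- An empty history means that `v` is the value of the initial position, which is then the answer.
-/
def bwdStmt (v : Bool) : DfsStmt K A Q :=
  .pop none (fun _ x => (x, v)) (.branch (fun x => x.1.isNone) .halt
    (.goto fun x => match x.1 with
      | some (.inr (q, b)) => .undo q b v
      | _ => .bwd v))

/-- The recorded state determines which stack operation to invert. At a branch the second successor
is visited only after the first, and only if the first value does not yet decide. -/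
def undoStmt (q : Q) (b v : Bool) : DfsStmt K A Q :=
  match instr q with
  | .push k _ _ => .pop (some k) (fun x _ => x) (goBack v)
  | .pop k a _ => .push (some k) (fun _ => .inl a) (goBack v)
  | .empty _ _ => goBack v
  | .branch _ q₂ => if b = false ∧ v = univ q then record q true q₂ else goBack v
  | .stuck => goBack v

noncomputable def dfsStmt : DfsLabel Q → DfsStmt K A Q
  | .inl q => fwdStmt instr univ q
  | .inr (.inl v) => bwdStmt v
  | .inr (.inr (q, b, v)) => undoStmt instr univ q b v

/-- The stacks of the deterministic machine, with the history `H`. -/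
def dfsStk (s : K → List A) (H : List (Q × Bool)) : Option K → List (DfsSym A Q)
  | some k => (s k).map .inl
  | none => H.map .inr

omit [DecidableEq K] in
@[simp] theorem dfsStk_some (s : K → List A) (H : List (Q × Bool)) (k : K) :
    dfsStk s H (some k) = (s k).map .inl := rfl

omit [DecidableEq K] in
@[simp] theorem dfsStk_none (s : K → List A) (H : List (Q × Bool)) :
    dfsStk s H none = H.map .inr := rfl

theorem update_dfsStk_none (s : K → List A) (H : List (Q × Bool)) (l : List (Q × Bool)) :
    update (dfsStk s H) none (l.map .inr) = dfsStk s l := by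
  funext k
  cases k <;> simp [dfsStk]

theorem update_dfsStk_some (s : K → List A) (H : List (Q × Bool)) (k : K) (l : List A) :
    update (dfsStk s H) (some k) (l.map .inl) = dfsStk (update s k l) H := by
  funext k'
  cases k' with
  | none => simp [dfsStk]
  | some k' =>
    by_cases h : k' = k
    · subst h; simp [dfsStk]
    · simp [dfsStk, h]

theorem update_dfsStk_none_cons (s : K → List A) (H : List (Q × Bool)) (x : Q × Bool) :
    update (dfsStk s H) none (.inr x :: H.map .inr) = dfsStk s (x :: H) :=
  update_dfsStk_none s H (x :: H)

theorem update_dfsStk_some_cons (s : K → List A) (H : List (Q × Bool)) (k : K) (a : A)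
    (l : List A) :
    update (dfsStk s H) (some k) (.inl a :: l.map .inl) = dfsStk (update s k (a :: l)) H :=
  update_dfsStk_some s H k (a :: l)

/-- The deterministic machine that evaluates the game by depth-first search. -/
noncomputable def dfsMachine [Fintype K] [Fintype A] [Fintype Q] (k₀ : K) (q₀ : Q) : FinTM2 where
  K := Option K
  k₀ := some k₀
  k₁ := none
  Γ := fun _ => DfsSym A Q
  Λ := DfsLabel Q
  main := .fwd q₀
  σ := DfsState A Q
  initialState := (none, false)
  m := dfsStmt instr univ

variable [Fintype K]

def stacksSize (s : K → List A) : ℕ := ∑ k, (s k).length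

theorem stacksSize_update (s : K → List A) (k : K) (l : List A) :
    stacksSize (update s k l) + (s k).length = stacksSize s + l.length := by
  have h : ∀ s : K → List A, stacksSize s = (s k).length + ∑ k' ∈ Finset.univ.erase k, (s k').length :=
    fun s => (Finset.add_sum_erase _ (fun k => (s k).length) (Finset.mem_univ k)).symm
  have h' : ∑ k' ∈ Finset.univ.erase k, (update s k l k').length =
      ∑ k' ∈ Finset.univ.erase k, (s k').length :=
    Finset.sum_congr rfl fun k' hk' => by rw [update_of_ne (Finset.ne_of_mem_erase hk')]
  rw [h, h s, h', update_self]
  omega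

def dfsSpace (c : DfsCfg K A Q) : ℕ := ∑ k, (c.stk k).length

omit [DecidableEq K] in
theorem dfsSpace_dfsStk (l : Option (DfsLabel Q)) (x : DfsState A Q) (s : K → List A)
    (H : List (Q × Bool)) : dfsSpace ⟨l, x, dfsStk s H⟩ = stacksSize s + H.length := by
  simp [dfsSpace, stacksSize, Fintype.sum_option, add_comm]

variable {instr univ}

/-- Reaching in the depth-first search. -/
abbrev DfsReach (instr : Q → Instr K A Q) (univ : Q → Bool) (B : ℕ) :
    DfsCfg K A Q → DfsCfg K A Q → Prop :=
  BoundedReach (TM2.step (dfsStmt instr univ)) dfsSpace B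

theorem BoundedReach.dfsHead {B : ℕ} {l : DfsLabel Q} {x : DfsState A Q} {s : K → List A}
    {H : List (Q × Bool)} {c' d : DfsCfg K A Q} (hB : stacksSize s + H.length ≤ B)
    (hc : TM2.stepAux (dfsStmt instr univ l) x (dfsStk s H) = c')
    (hd : DfsReach instr univ B c' d) : DfsReach instr univ B ⟨some l, x, dfsStk s H⟩ d :=
  .head (by rwa [dfsSpace_dfsStk]) (congrArg some hc) hd

theorem BoundedReach.dfsPop {B : ℕ} {v : Bool} {x : DfsState A Q} {s : K → List A}
    {H : List (Q × Bool)} {q : Q} {b : Bool} {d : DfsCfg K A Q}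
    (hB : stacksSize s + H.length + 1 ≤ B)
    (hd : DfsReach instr univ B ⟨some (.undo q b v), (some (.inr (q, b)), v), dfsStk s H⟩ d) :
    DfsReach instr univ B ⟨some (.bwd v), x, dfsStk s ((q, b) :: H)⟩ d := by
  refine .dfsHead (by simpa [← add_assoc] using hB) ?_ hd
  simp [dfsStmt, bwdStmt, update_dfsStk_none]

/-- The visit of a position leaves stacks and history as they were found. Every step down adds at
most one symbol to the stacks and one to the history, hence the 2n. -/
theorem Eval.dfsReach {n : ℕ} {q : Q} {s : K → List A} {v : Bool}
    (h : Eval instr univ n q s v) (x : DfsState A Q) (H : List (Q × Bool)) (B : ℕ)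
    (hB : stacksSize s + H.length + 2 * n ≤ B) :
    ∃ x', DfsReach instr univ B ⟨some (.fwd q), x, dfsStk s H⟩ ⟨some (.bwd v), x', dfsStk s H⟩ := by
  have hfail : ∀ {n q s x H}, stacksSize s + H.length + 2 * n ≤ B → ∀ x',
      TM2.stepAux (fwdStmt instr univ q) x (dfsStk s H) = ⟨some (.bwd (univ q)), x', dfsStk s H⟩ →
      ∃ x', DfsReach instr univ B ⟨some (.fwd q), x, dfsStk s H⟩
        ⟨some (.bwd (univ q)), x', dfsStk s H⟩ := by
    intro n q s x H hB x' hc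
    exact ⟨x', .dfsHead (by omega) hc (.refl _ (by rw [dfsSpace_dfsStk]; omega))⟩
  induction h generalizing x H with
  | @push n q s v k a q' h he ih =>
    have hs := stacksSize_update s k (a :: s k)
    rw [List.length_cons] at hs
    obtain ⟨x', hx'⟩ := ih x ((q, false) :: H) (by rw [List.length_cons]; omega)
    refine ⟨(some (.inr (q, false)), v), .dfsHead (by omega) ?_ (hx'.trans (.dfsPop (by omega) (.dfsHead (by omega) ?_
      (.refl _ (by rw [dfsSpace_dfsStk]; omega)))))⟩
    · simp [dfsStmt, fwdStmt, h, record, update_dfsStk_none_cons, update_dfsStk_some_cons]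
    · simp [dfsStmt, undoStmt, h, goBack, update_dfsStk_some]
  | @pop n q s v k a q' r h hk he ih =>
    have hs := stacksSize_update s k r
    rw [hk, List.length_cons] at hs
    obtain ⟨x', hx'⟩ := ih (some (.inl a), x.2) ((q, false) :: H)
      (by rw [List.length_cons]; omega)
    refine ⟨(some (.inr (q, false)), v), .dfsHead (by omega) ?_ (hx'.trans (.dfsPop (by omega) (.dfsHead (by omega) ?_
      (.refl _ (by rw [dfsSpace_dfsStk]; omega)))))⟩
    · simp [dfsStmt, fwdStmt, h, hk, record, update_dfsStk_none_cons, update_dfsStk_some]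
    · simp [dfsStmt, undoStmt, h, goBack, update_dfsStk_some_cons, ← hk]
  | @popFail n q s k a q' h hk =>
    refine hfail hB ((s k).head?.map .inl, x.2) ?_
    have : ¬ (s k).head?.map (Sum.inl (β := Q × Bool)) = some (.inl a) := by
      simpa using hk
    simp only [fwdStmt, h, TM2.stepAux, dfsStk_some, List.head?_map, this, decide_false, cond_false,
      goBack]
  | @empty n q s v k q' h hk he ih =>
    obtain ⟨x', hx'⟩ := ih (none, x.2) ((q, false) :: H) (by rw [List.length_cons]; omega)
    refine ⟨(some (.inr (q, false)), v), .dfsHead (by omega) ?_ (hx'.trans (.dfsPop (by omega) (.dfsHead (by omega) ?_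
      (.refl _ (by rw [dfsSpace_dfsStk]; omega)))))⟩
    · simp [dfsStmt, fwdStmt, h, hk, record, update_dfsStk_none_cons]
    · simp [dfsStmt, undoStmt, h, goBack]
  | @emptyFail n q s k q' h hk =>
    refine hfail hB ((s k).head?.map .inl, x.2) ?_
    obtain ⟨a, r, hr⟩ := List.exists_cons_of_ne_nil hk
    simp [fwdStmt, h, hr, goBack]
  | @branch n q s q₁ q₂ v₁ v₂ h h₁ h₂ ih₁ ih₂ =>
    obtain ⟨x₁, hx₁⟩ := ih₁ x ((q, false) :: H) (by rw [List.length_cons]; omega)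
    -- The value `univ q` is the loss of the player to move, so then the second successor decides.
    by_cases hv : v₁ = univ q
    · obtain ⟨x₂, hx₂⟩ := ih₂ (some (.inr (q, false)), v₁) ((q, true) :: H)
        (by rw [List.length_cons]; omega)
      rw [if_pos hv]
      refine ⟨(some (.inr (q, true)), v₂), .dfsHead (by omega) ?_ (hx₁.trans (.dfsPop (by omega) (.dfsHead (by omega) ?_
        (hx₂.trans (.dfsPop (by omega) (.dfsHead (by omega) ?_
          (.refl _ (by rw [dfsSpace_dfsStk]; omega))))))))⟩
      · simp [dfsStmt, fwdStmt, h, record, update_dfsStk_none_cons]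
      · simp [dfsStmt, undoStmt, h, record, hv, update_dfsStk_none_cons]
      · simp [dfsStmt, undoStmt, h, goBack]
    · rw [if_neg hv]
      refine ⟨(some (.inr (q, false)), v₁), .dfsHead (by omega) ?_ (hx₁.trans (.dfsPop (by omega) (.dfsHead (by omega) ?_
        (.refl _ (by rw [dfsSpace_dfsStk]; omega)))))⟩
      · simp [dfsStmt, fwdStmt, h, record, update_dfsStk_none_cons]
      · simp [dfsStmt, undoStmt, h, goBack, hv]
  | @stuck n q s h =>
    refine hfail hB x ?_
    simp [fwdStmt, h, goBack]

variable [Fintype A] [Fintype Q]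

theorem inPSPACE_of_eval {α : Type} {S : Set (List α)} (k₀ : K) (q₀ : Q) (e : α ↪ A)
    (p : Polynomial ℕ)
    (h : ∀ w : List α, ∃ v, Eval instr univ (p.eval w.length) q₀
      (update (fun _ => []) k₀ (w.map e)) v ∧ (v = true ↔ w ∈ S)) :
    InPSPACE S := by
  -- The summand `X` of the bound is for the input, the summand `2 * p` for the growth along a path.
  refine ⟨dfsMachine instr univ k₀ q₀, e.trans ⟨Sum.inl, Sum.inl_injective⟩, {x | x.2 = true},
    2 * p + Polynomial.X, fun _ => inferInstanceAs (Finite (DfsSym A Q)), fun w => ?_⟩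
  obtain ⟨v, hv, hw⟩ := h w
  set B : ℕ := (2 * p + Polynomial.X).eval w.length with hBdef
  have hsize : stacksSize (update (fun _ => []) k₀ (w.map e)) = w.length := by
    have := stacksSize_update (fun _ => []) k₀ (w.map e)
    simpa [stacksSize] using this
  obtain ⟨x', hx'⟩ := hv.dfsReach (none, false) [] B (by simp [hsize, hBdef, add_comm])
  set s := update (fun _ => []) k₀ (w.map e) with hs
  have hend : DfsReach instr univ B ⟨some (.bwd v), x', dfsStk s []⟩
      ⟨none, (none, v), dfsStk s []⟩ := by
    have hB : stacksSize s + ([] : List (Q × Bool)).length ≤ B := by simp [hsize, hBdef]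
    refine .dfsHead hB ?_ (.refl _ (by rwa [dfsSpace_dfsStk]))
    simp only [dfsStmt, bwdStmt, TM2.stepAux, dfsStk_none, List.map_nil, List.head?_nil,
      Option.isNone_none, cond_true, List.tail_nil]
    rw [show ([] : List (DfsSym A Q)) = ([] : List (Q × Bool)).map .inr from rfl,
      update_dfsStk_none]
  have hreach := hx'.trans hend
  have hstk : update (fun _ => []) (some k₀) ((w.map e).map .inl) =
      dfsStk s ([] : List (Q × Bool)) := by
    rw [hs, ← update_dfsStk_some]
    congr 1
    funext k
    cases k <;> rfl
  have hinit : ∀ w' : List (DfsSym A Q), w' = (w.map e).map .inl →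
      initList (dfsMachine instr univ k₀ q₀) w' =
        (⟨some (.fwd q₀), (none, false), dfsStk s []⟩ : DfsCfg K A Q) := by
    rintro _ rfl
    exact (initList_eq _ _).trans
      (congrArg (TM2.Cfg.mk (some (DfsLabel.fwd q₀)) (none, false)) hstk)
  have hi := hinit (w.map (e.trans ⟨Sum.inl, Sum.inl_injective⟩)) (by simp)
  constructor
  · intro c hc
    exact hreach.space_le rfl (Eq.mp (congrArg (fun z => StateTransition.Reaches
      (TM2.step (dfsStmt instr univ)) z c) hi) hc)
  · exact ⟨(⟨none, (none, v), dfsStk s []⟩ : DfsCfg K A Q),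
      Eq.mpr (congrArg (fun z => StateTransition.Reaches (TM2.step (dfsStmt instr univ)) z
        ⟨none, (none, v), dfsStk s []⟩) hi) hreach.reaches, rfl, hw⟩

end Machines

/-! ### Nondeterministic stack programs -/

/-- Nondeterministic programs over stacks: regular expressions over tests and stack operations. -/
inductive Prog (K A : Type) : Type
  | one
  | zero
  | push (k : K) (a : A)
  | pop (k : K) (a : A)
  | empty (k : K)
  | seq (p q : Prog K A)
  | alt (p q : Prog K A)
  | star (p : Prog K A)

/-- The players' turns: the choice of the initial position, a guess of the existential player, and
a reply of the universal player. -/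
inductive Phase : Type
  | init
  | guess
  | reply

namespace Phase

def isUniv : Phase → Bool
  | reply => true
  | _ => false

def next : Phase → Phase
  | guess => reply
  | _ => guess

end Phase

section Programs

open Function

variable {K A : Type} [DecidableEq K]

/-- The input-output relation of a program. -/
def Prog.Rel : Prog K A → (K → List A) → (K → List A) → Prop
  | one, s, s' => s' = s
  | zero, _, _ => False
  | push k a, s, s' => s' = update s k (a :: s k)
  | pop k a, s, s' => ∃ r, s k = a :: r ∧ s' = update s k r
  | empty k, s, s' => s k = [] ∧ s' = s
  | seq p q, s, s' => ∃ s₁, p.Rel s s₁ ∧ q.Rel s₁ s'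
  | alt p q, s, s' => p.Rel s s' ∨ q.Rel s s'
  | star p, s, s' => Relation.ReflTransGen p.Rel s s'

/-- The instruction at a position of the game: the programs in the list are to be run one after
another. -/
def gameInstr (G : Phase → Prog K A) :
    Phase × List (Prog K A) → Instr K A (Phase × List (Prog K A))
  | (ph, []) => .branch (ph.next, [G ph.next]) (ph.next, [G ph.next])
  | (ph, .one :: c) => .branch (ph, c) (ph, c)
  | (_, .zero :: _) => .stuck
  | (ph, .push k a :: c) => .push k a (ph, c)
  | (ph, .pop k a :: c) => .pop k a (ph, c)
  | (ph, .empty k :: c) => .empty k (ph, c)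
  | (ph, .seq p q :: c) => .branch (ph, p :: q :: c) (ph, p :: q :: c)
  | (ph, .alt p q :: c) => .branch (ph, p :: c) (ph, q :: c)
  | (ph, .star p :: c) => .branch (ph, c) (ph, p :: .star p :: c)

/-! ### Finiteness of the control -/

def Instr.All {K A Q : Type} (P : Q → Prop) : Instr K A Q → Prop
  | push _ _ q => P q
  | pop _ _ q => P q
  | empty _ q => P q
  | branch q₁ q₂ => P q₁ ∧ P q₂
  | stuck => True

def Instr.map {K A Q R : Type} (f : Q → R) : Instr K A Q → Instr K A R
  | push k a q => push k a (f q)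
  | pop k a q => pop k a (f q)
  | empty k q => empty k (f q)
  | branch q₁ q₂ => branch (f q₁) (f q₂)
  | stuck => stuck

/-- The lists of programs that remain to be run while `p` is run. -/
def conts : Prog K A → Set (List (Prog K A))
  | .seq p q => {[.seq p q]} ∪ (· ++ [q]) '' conts p ∪ conts q
  | .alt p q => {[.alt p q]} ∪ conts p ∪ conts q
  | .star p => {[.star p]} ∪ (· ++ [.star p]) '' conts p
  | p => {[p]}

-- As with the partial derivatives of a regular expression, only finitely many lists of remaining
-- programs occur, although the lists of all programs are infinitely many.
omit [DecidableEq K] in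
theorem conts_finite (p : Prog K A) : (conts p).Finite := by
  induction p with
  | seq p q hp hq => exact ((Set.finite_singleton _).union (hp.image _)).union hq
  | alt p q hp hq => exact ((Set.finite_singleton _).union hp).union hq
  | star p hp => exact (Set.finite_singleton _).union (hp.image _)
  | _ => exact Set.finite_singleton _

omit [DecidableEq K] in
theorem self_mem_conts (p : Prog K A) : [p] ∈ conts p := by
  cases p <;> simp [conts]

omit [DecidableEq K] in
theorem nil_notMem_conts (p : Prog K A) : [] ∉ conts p := by
  induction p <;> simp_all [conts]

-- An instruction depends on the first remaining program only; the tail is carried along.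
omit [DecidableEq K] in
theorem gameInstr_append (G : Phase → Prog K A) (ph : Phase) (p : Prog K A)
    (c d : List (Prog K A)) :
    gameInstr G (ph, p :: c ++ d) = (gameInstr G (ph, p :: c)).map fun x => (x.1, x.2 ++ d) := by
  cases p <;> simp [gameInstr, Instr.map]

omit [DecidableEq K] in
theorem Instr.All.mono {Q : Type} {P P' : Q → Prop} {i : Instr K A Q} (h : i.All P)
    (hP : ∀ q, P q → P' q) : i.All P' := by
  cases i <;> simp_all [Instr.All]

omit [DecidableEq K] in
theorem Instr.all_map {Q R : Type} {P : R → Prop} {f : Q → R} {i : Instr K A Q}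
    (h : i.All fun q => P (f q)) : (i.map f).All P := by
  cases i <;> simp_all [Instr.All, Instr.map]

-- In a sequence or an iteration, the subprogram runs in front of one fixed further program. When
-- the subprogram is used up, that program alone remains, and it is again a listed continuation.
omit [DecidableEq K] in
theorem conts_closed (G : Phase → Prog K A) (ph : Phase) (p : Prog K A) :
    ∀ l ∈ conts p, (gameInstr G (ph, l)).All fun x => x.1 = ph ∧ (x.2 = [] ∨ x.2 ∈ conts p) := by
  have app : ∀ (p r : Prog K A) (R : Set (List (Prog K A))), [r] ∈ R →
      (∀ l ∈ conts p, l ++ [r] ∈ R) →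
      (∀ l ∈ conts p, (gameInstr G (ph, l)).All fun x => x.1 = ph ∧ (x.2 = [] ∨ x.2 ∈ conts p)) →
      ∀ l ∈ conts p, (gameInstr G (ph, l ++ [r])).All fun x => x.1 = ph ∧ (x.2 = [] ∨ x.2 ∈ R) := by
    intro p r R h1 h2 h l hl
    cases l with
    | nil => exact absurd hl (nil_notMem_conts p)
    | cons a l =>
      rw [gameInstr_append]
      refine Instr.all_map ((h _ hl).mono ?_)
      rintro ⟨ph', l'⟩ ⟨rfl, h'⟩
      refine ⟨rfl, Or.inr ?_⟩
      rcases h' with h' | h'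
      · dsimp only at h'
        rw [h']; exact h1
      · exact h2 _ h'
  induction p with
  | one | zero | push | pop | empty =>
    intro l hl
    obtain rfl := Set.mem_singleton_iff.1 hl
    simp [gameInstr, Instr.All]
  | seq p q hp hq =>
    rintro l ((hl | ⟨l, hl, rfl⟩) | hl)
    · obtain rfl := Set.mem_singleton_iff.1 hl
      have : [p, q] ∈ conts (.seq p q) := Or.inl (Or.inr ⟨[p], self_mem_conts p, rfl⟩)
      simp [gameInstr, Instr.All, this]
    · exact app p q _ (Or.inr (self_mem_conts q)) (fun l hl => Or.inl (Or.inr ⟨l, hl, rfl⟩)) hp l hl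
    · exact (hq l hl).mono fun x hx => ⟨hx.1, hx.2.imp_right Or.inr⟩
  | alt p q hp hq =>
    rintro l ((hl | hl) | hl)
    · obtain rfl := Set.mem_singleton_iff.1 hl
      have h1 : [p] ∈ conts (.alt p q) := Or.inl (Or.inr (self_mem_conts p))
      have h2 : [q] ∈ conts (.alt p q) := Or.inr (self_mem_conts q)
      simp [gameInstr, Instr.All, h1, h2]
    · exact (hp l hl).mono fun x hx => ⟨hx.1, hx.2.imp_right fun h => Or.inl (Or.inr h)⟩
    · exact (hq l hl).mono fun x hx => ⟨hx.1, hx.2.imp_right Or.inr⟩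
  | star p hp =>
    rintro l (hl | ⟨l, hl, rfl⟩)
    · obtain rfl := Set.mem_singleton_iff.1 hl
      have : [p, .star p] ∈ conts (.star p) := Or.inr ⟨[p], self_mem_conts p, rfl⟩
      simp [gameInstr, Instr.All, this]
    · exact app p _ _ (self_mem_conts (.star p)) (fun l hl => Or.inr ⟨l, hl, rfl⟩) hp l hl

/-- The positions that can be reached in the game. -/
def gamePositions (G : Phase → Prog K A) : Set (Phase × List (Prog K A)) :=
  {x | x.2 = [] ∨ x.2 ∈ conts (G x.1)}

omit [DecidableEq K] in
theorem gamePositions_finite (G : Phase → Prog K A) : (gamePositions G).Finite := by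
  have h : gamePositions G ⊆ ((·, ·) .init) '' ({[]} ∪ conts (G .init)) ∪
      ((·, ·) .guess) '' ({[]} ∪ conts (G .guess)) ∪
      ((·, ·) .reply) '' ({[]} ∪ conts (G .reply)) := by
    rintro ⟨ph, l⟩ h
    cases ph
    · exact Or.inl (Or.inl ⟨l, h, rfl⟩)
    · exact Or.inl (Or.inr ⟨l, h, rfl⟩)
    · exact Or.inr ⟨l, h, rfl⟩
  refine Set.Finite.subset ?_ h
  have : ∀ p : Prog K A, ({[]} ∪ conts p).Finite := fun p =>
    (Set.finite_singleton _).union (conts_finite p)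
  exact (((this _).image _).union ((this _).image _)).union ((this _).image _)

omit [DecidableEq K] in
theorem gamePositions_closed (G : Phase → Prog K A) :
    ∀ x ∈ gamePositions G, (gameInstr G x).All (· ∈ gamePositions G) := by
  rintro ⟨ph, l⟩ h
  cases l with
  | nil => simp [gameInstr, Instr.All, gamePositions, self_mem_conts]
  | cons p l =>
    have h' : p :: l ∈ conts (G ph) := h.resolve_left (by simp)
    refine (conts_closed G ph _ _ h').mono ?_
    rintro ⟨ph', l'⟩ ⟨rfl, h⟩
    exact h

/-! ### Larger time bounds, and restriction of the game to a closed set of positions -/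

theorem Eval.mono {Q : Type} {instr : Q → Instr K A Q} {univ : Q → Bool} {n m : ℕ} {q : Q}
    {s : K → List A} {v : Bool} (h : Eval instr univ n q s v) (hnm : n ≤ m) :
    Eval instr univ m q s v := by
  induction h generalizing m with
  | popFail h hs => exact .popFail h hs
  | emptyFail h hs => exact .emptyFail h hs
  | stuck h => exact .stuck h
  | @push n =>
    obtain ⟨m, rfl⟩ : ∃ k, m = k + 1 := ⟨m - 1, by omega⟩
    rename_i h _ ih; exact .push h (ih (by omega))
  | @pop n =>
    obtain ⟨m, rfl⟩ : ∃ k, m = k + 1 := ⟨m - 1, by omega⟩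
    rename_i h hs _ ih; exact .pop h hs (ih (by omega))
  | @empty n =>
    obtain ⟨m, rfl⟩ : ∃ k, m = k + 1 := ⟨m - 1, by omega⟩
    rename_i h hs _ ih; exact .empty h hs (ih (by omega))
  | @branch n =>
    obtain ⟨m, rfl⟩ : ∃ k, m = k + 1 := ⟨m - 1, by omega⟩
    rename_i h _ _ ih₁ ih₂; exact .branch h (ih₁ (by omega)) (ih₂ (by omega))

open Classical in
/-- Restrict a list of instructions to a closed set of states. -/
noncomputable def restrictInstr {Q : Type} (instr : Q → Instr K A Q) (R : Set Q) (d : R) (q : R) :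
    Instr K A R :=
  (instr q).map fun q' => if h : q' ∈ R then ⟨q', h⟩ else d

theorem Eval.restrict {Q : Type} {instr : Q → Instr K A Q} {univ : Q → Bool} {n : ℕ} {q : Q}
    {s : K → List A} {v : Bool} (h : Eval instr univ n q s v) {R : Set Q}
    (hR : ∀ q ∈ R, (instr q).All (· ∈ R)) (d : R) (hq : q ∈ R) :
    Eval (restrictInstr instr R d) (fun q => univ q) n ⟨q, hq⟩ s v := by
  induction h with
  | @push n q s v k a q' h he ih =>
    have hq' : q' ∈ R := by have := hR q hq; rw [h] at this; exact this
    exact .push (by simp only [restrictInstr, h, Instr.map]; rw [dif_pos hq']) (ih hq')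
  | @pop n q s v k a q' r h hs he ih =>
    have hq' : q' ∈ R := by have := hR q hq; rw [h] at this; exact this
    exact .pop (by simp only [restrictInstr, h, Instr.map]; rw [dif_pos hq']) hs (ih hq')
  | @popFail n q s k a q' h hs =>
    exact .popFail (q := (⟨q, hq⟩ : R)) (by simp only [restrictInstr, h, Instr.map]; rfl) hs
  | @empty n q s v k q' h hs he ih =>
    have hq' : q' ∈ R := by have := hR q hq; rw [h] at this; exact this
    exact .empty (by simp only [restrictInstr, h, Instr.map]; rw [dif_pos hq']) hs (ih hq')
  | @emptyFail n q s k q' h hs =>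
    exact .emptyFail (q := (⟨q, hq⟩ : R)) (by simp only [restrictInstr, h, Instr.map]; rfl) hs
  | @branch n q s q₁ q₂ v₁ v₂ h h₁ h₂ ih₁ ih₂ =>
    have hq' : q₁ ∈ R ∧ q₂ ∈ R := by have := hR q hq; rw [h] at this; exact this
    exact .branch (q := (⟨q, hq⟩ : R)) (by
      simp only [restrictInstr, h, Instr.map]
      rw [dif_pos hq'.1, dif_pos hq'.2]) (ih₁ hq'.1) (ih₂ hq'.2)
  | @stuck n q s h =>
    exact .stuck (q := (⟨q, hq⟩ : R)) (by simp only [restrictInstr, h, Instr.map])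

/-! ### Evaluation of programs -/

/-- From the position `q` with the stacks `s`, all paths have length at most `n`, and the
existential player wins if and only if `P`. -/
def Wins (G : Phase → Prog K A) (n : ℕ) (q : Phase × List (Prog K A)) (s : K → List A)
    (P : Prop) : Prop :=
  ∃ v, Eval (gameInstr G) (fun x => x.1.isUniv) n q s v ∧ (v = true ↔ P)

theorem Wins.mono {G : Phase → Prog K A} {n m : ℕ} {q s} {P : Prop} (h : Wins G n q s P)
    (hnm : n ≤ m) : Wins G m q s P :=
  h.imp fun _ h => ⟨h.1.mono hnm, h.2⟩

theorem Wins.congr {G : Phase → Prog K A} {n : ℕ} {q s} {P P' : Prop} (h : Wins G n q s P)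
    (hP : P ↔ P') : Wins G n q s P' :=
  h.imp fun _ h => ⟨h.1, h.2.trans hP⟩

theorem Wins.goto {G : Phase → Prog K A} {n : ℕ} {q q' s} {P : Prop}
    (hq : gameInstr G q = .branch q' q') (h : Wins G n q' s P) : Wins G (n + 1) q s P := by
  obtain ⟨v, hv, hP⟩ := h
  exact ⟨v, by simpa using Eval.branch hq hv hv, hP⟩

theorem Wins.branch {G : Phase → Prog K A} {n : ℕ} {q q₁ q₂ s} {P₁ P₂ : Prop}
    (hq : gameInstr G q = .branch q₁ q₂) (h₁ : Wins G n q₁ s P₁) (h₂ : Wins G n q₂ s P₂) :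
    Wins G (n + 1) q s (if q.1.isUniv then P₁ ∧ P₂ else P₁ ∨ P₂) := by
  obtain ⟨v₁, hv₁, hP₁⟩ := h₁
  obtain ⟨v₂, hv₂, hP₂⟩ := h₂
  refine ⟨_, Eval.branch hq hv₁ hv₂, ?_⟩
  rw [← hP₁, ← hP₂]
  cases hu : q.1.isUniv <;> cases v₁ <;> cases v₂ <;> simp

/-- The player who chooses the outcome of a program reaches `P`: the existential player chooses
unless `u` holds. -/
def Outcome (u : Bool) {S : Type} (X P : S → Prop) : Prop :=
  if u then ∀ s, X s → P s else ∃ s, X s ∧ P s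

/-- All paths through `p` from the stacks `s` have length at most `t`. -/
def Time (G : Phase → Prog K A) (p : Prog K A) (s : K → List A) (t : ℕ) : Prop :=
  ∀ (ph : Phase) (c : List (Prog K A)) (n : ℕ) (P : (K → List A) → Prop),
    (∀ s', p.Rel s s' → Wins G n (ph, c) s' (P s')) →
    Wins G (n + t) (ph, p :: c) s (Outcome ph.isUniv (p.Rel s) P)

theorem Time.mono {G : Phase → Prog K A} {p : Prog K A} {s : K → List A} {t t' : ℕ}
    (h : Time G p s t) (ht : t ≤ t') : Time G p s t' :=
  fun ph c n P hP => (h ph c n P hP).mono (by omega)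

theorem Time.one {G : Phase → Prog K A} {s : K → List A} : Time G .one s 1 := by
  intro ph c n P hP
  refine (Wins.goto rfl (hP s rfl)).congr ?_
  cases h : ph.isUniv <;> simp [Outcome, Prog.Rel]

/-- A stuck player loses, and this is what `Outcome` says for an empty set of results: universal
choice is vacuously true, existential choice false. -/
theorem Time.of_stuck {G : Phase → Prog K A} {p : Prog K A} {s : K → List A}
    (h : ∀ (ph : Phase) c n, Eval (gameInstr G) (fun x => x.1.isUniv) n (ph, p :: c) s ph.isUniv)
    (hp : ∀ s', ¬ p.Rel s s') : Time G p s 1 := by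
  intro ph c n P _
  refine ⟨_, h ph c _, ?_⟩
  cases h : ph.isUniv <;> simp [Outcome, hp]

theorem Time.zero {G : Phase → Prog K A} {s : K → List A} : Time G .zero s 1 :=
  .of_stuck (fun _ _ _ => .stuck rfl) fun _ h => h

theorem Time.push {G : Phase → Prog K A} {s : K → List A} {k : K} {a : A} :
    Time G (.push k a) s 1 := by
  intro ph c n P hP
  obtain ⟨v, hv, h⟩ := hP _ rfl
  refine ⟨v, .push rfl hv, h.trans ?_⟩
  cases h : ph.isUniv <;> simp [Outcome, Prog.Rel]

theorem Time.pop {G : Phase → Prog K A} {s : K → List A} {k : K} {a : A} :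
    Time G (.pop k a) s 1 := by
  by_cases hs : (s k).head? = some a
  · obtain ⟨r, hr⟩ := List.head?_eq_some_iff.1 hs
    intro ph c n P hP
    obtain ⟨v, hv, h⟩ := hP _ ⟨r, hr, rfl⟩
    refine ⟨v, .pop rfl hr hv, h.trans ?_⟩
    cases h : ph.isUniv <;> simp [Outcome, Prog.Rel, hr]
  · refine .of_stuck (fun _ _ _ => .popFail rfl hs) ?_
    rintro s' ⟨r, hr, -⟩
    simp [hr] at hs

theorem Time.empty {G : Phase → Prog K A} {s : K → List A} {k : K} :
    Time G (.empty k) s 1 := by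
  by_cases hs : s k = []
  · intro ph c n P hP
    obtain ⟨v, hv, h⟩ := hP s ⟨hs, rfl⟩
    refine ⟨v, .empty rfl hs hv, h.trans ?_⟩
    cases h : ph.isUniv <;> simp [Outcome, Prog.Rel, hs]
  · exact .of_stuck (fun _ _ _ => .emptyFail rfl hs) fun _ h => hs h.1

theorem Time.seq {G : Phase → Prog K A} {p q : Prog K A} {s : K → List A} {t₁ t₂ : ℕ}
    (h₁ : Time G p s t₁) (h₂ : ∀ s', p.Rel s s' → Time G q s' t₂) :
    Time G (.seq p q) s (t₁ + t₂ + 1) := by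
  intro ph c n P hP
  have := h₁ ph (q :: c) (n + t₂) (fun s' => Outcome ph.isUniv (q.Rel s') P) fun s' hs' =>
    h₂ s' hs' ph c n P fun s'' hs'' => hP s'' ⟨s', hs', hs''⟩
  refine ((Wins.goto rfl this).mono (by omega)).congr ?_
  cases h : ph.isUniv
  · simp only [Outcome, Prog.Rel, Bool.false_eq_true, if_false]
    constructor
    · rintro ⟨s₁, h1, s₂, h2, h3⟩; exact ⟨s₂, ⟨s₁, h1, h2⟩, h3⟩
    · rintro ⟨s₂, ⟨s₁, h1, h2⟩, h3⟩; exact ⟨s₁, h1, s₂, h2, h3⟩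
  · simp only [Outcome, Prog.Rel, if_true]
    constructor
    · rintro h s₂ ⟨s₁, h1, h2⟩; exact h s₁ h1 s₂ h2
    · intro h s₁ h1 s₂ h2; exact h s₂ ⟨s₁, h1, h2⟩

theorem Time.alt {G : Phase → Prog K A} {p q : Prog K A} {s : K → List A} {t₁ t₂ : ℕ}
    (h₁ : Time G p s t₁) (h₂ : Time G q s t₂) : Time G (.alt p q) s (t₁ + t₂ + 1) := by
  intro ph c n P hP
  have h1 := (h₁ ph c n P fun s' hs' => hP s' (Or.inl hs')).mono (by omega : _ ≤ n + (t₁ + t₂))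
  have h2 := (h₂ ph c n P fun s' hs' => hP s' (Or.inr hs')).mono (by omega : _ ≤ n + (t₁ + t₂))
  refine (Wins.branch rfl h1 h2).congr ?_
  cases h : ph.isUniv
  · simp only [Outcome, Prog.Rel, Bool.false_eq_true, if_false, or_and_right, exists_or]
  · simp only [Outcome, Prog.Rel, if_true, or_imp, forall_and]

/-- Each iteration shortens the stack `k`, so there are at most `N` of them. Each costs `t` and one
branch that decides whether to go on. -/
theorem Time.star {G : Phase → Prog K A} {p : Prog K A} {k : K} {t N : ℕ}
    (h : ∀ s, (s k).length ≤ N → Time G p s t)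
    (hp : ∀ s s', p.Rel s s' → (s' k).length < (s k).length) (s : K → List A)
    (hs : (s k).length ≤ N) : Time G (.star p) s ((N + 1) * (t + 1)) := by
  suffices ∀ m s, (s k).length = m → m ≤ N → Time G (.star p) s ((m + 1) * (t + 1)) from
    (this _ s rfl hs).mono (Nat.mul_le_mul_right _ (by omega))
  intro m
  induction m using Nat.strong_induction_on with
  | _ m ih =>
    intro s hm hmN ph c n P hP
    have h1 : Wins G (n + m * (t + 1) + t) (ph, c) s (P s) :=
      (hP s .refl).mono (by omega)
    have h2 := h s (hm ▸ hmN) ph (.star p :: c) (n + m * (t + 1))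
      (fun s' => Outcome ph.isUniv ((Prog.star p).Rel s') P) fun s' hs' => by
        have hlt := hp s s' hs'
        refine (ih _ (hm ▸ hlt) s' rfl (by omega) ph c n P fun s'' hs'' =>
          hP s'' (.head hs' hs'')).mono ?_
        have : ((s' k).length + 1) * (t + 1) ≤ m * (t + 1) := Nat.mul_le_mul_right _ (by omega)
        omega
    refine ((Wins.branch rfl h1 h2).mono (by ring_nf; omega)).congr ?_
    have hstar : ∀ s', (Prog.star p).Rel s s' ↔ s' = s ∨ ∃ s₁, p.Rel s s₁ ∧ (Prog.star p).Rel s₁ s' := by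
      intro s'
      refine (Relation.ReflTransGen.cases_head_iff).trans ?_
      rw [eq_comm]
      rfl
    cases h : ph.isUniv
    · simp only [Outcome, Bool.false_eq_true, if_false, hstar]
      constructor
      · rintro (h | ⟨s₁, h1, s₂, h2, h3⟩)
        · exact ⟨s, Or.inl rfl, h⟩
        · exact ⟨s₂, Or.inr ⟨s₁, h1, h2⟩, h3⟩
      · rintro ⟨s₂, rfl | ⟨s₁, h1, h2⟩, h3⟩
        · exact Or.inl h3
        · exact Or.inr ⟨s₁, h1, s₂, h2, h3⟩
    · simp only [Outcome, if_true, hstar]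
      constructor
      · rintro ⟨h1, h2⟩ s₂ (rfl | ⟨s₁, h3, h4⟩)
        · exact h1
        · exact h2 s₁ h3 s₂ h4
      · exact fun h => ⟨h s (Or.inl rfl), fun s₁ h1 s₂ h2 => h s₂ (Or.inr ⟨s₁, h1, h2⟩)⟩

/-! ### Programs that run in polynomial time -/

/-- `p` pops at least one symbol from the stack `k`. -/
def Prog.mustPop (k : K) : Prog K A → Bool
  | pop k' _ => k' = k
  | zero => true
  | seq p q => p.mustPop k || q.mustPop k
  | alt p q => p.mustPop k && q.mustPop k
  | _ => false

/-- `p` does not push symbols on the stack `k`, and every iteration pops a symbol from it. -/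
def Prog.driven (k : K) : Prog K A → Bool
  | push k' _ => k' ≠ k
  | seq p q => p.driven k && q.driven k
  | alt p q => p.driven k && q.driven k
  | star p => p.driven k && p.mustPop k
  | _ => true

/-- A polynomial bound for the time of programs that are driven by one stack. -/
noncomputable def Prog.time : Prog K A → Polynomial ℕ
  | seq p q => p.time + q.time + 1
  | alt p q => p.time + q.time + 1
  | star p => (Polynomial.X + 1) * (p.time + 1)
  | _ => 1

theorem Prog.Rel.length_le {k : K} {p : Prog K A} (hp : p.driven k) {s s' : K → List A}
    (h : p.Rel s s') :
    (s' k).length ≤ (s k).length ∧ (p.mustPop k → (s' k).length < (s k).length) := by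
  induction p generalizing s s' with
  | one => cases h; simp [mustPop]
  | zero => cases h
  | push k' a =>
    cases h
    simp only [driven, ne_eq, decide_not, Bool.not_eq_eq_eq_not, Bool.not_true,
      decide_eq_false_iff_not] at hp
    simp [mustPop, update_of_ne (Ne.symm hp)]
  | pop k' a =>
    obtain ⟨r, hr, rfl⟩ := h
    by_cases hk : k' = k
    · subst hk; simp [hr]
    · simp [mustPop, hk, update_of_ne (Ne.symm hk)]
  | empty k' => obtain ⟨-, rfl⟩ := h; simp [mustPop]
  | seq p q ihp ihq =>
    obtain ⟨s₁, h1, h2⟩ := h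
    simp only [driven, Bool.and_eq_true] at hp
    have h3 := ihp hp.1 h1
    have h4 := ihq hp.2 h2
    refine ⟨h4.1.trans h3.1, fun h => ?_⟩
    simp only [mustPop, Bool.or_eq_true] at h
    rcases h with h | h
    · exact h4.1.trans_lt (h3.2 h)
    · exact (h4.2 h).trans_le h3.1
  | alt p q ihp ihq =>
    simp only [driven, Bool.and_eq_true] at hp
    simp only [mustPop, Bool.and_eq_true]
    rcases h with h | h
    · exact ⟨(ihp hp.1 h).1, fun h' => (ihp hp.1 h).2 h'.1⟩
    · exact ⟨(ihq hp.2 h).1, fun h' => (ihq hp.2 h).2 h'.2⟩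
  | star p ih =>
    simp only [driven, Bool.and_eq_true] at hp
    refine ⟨?_, by simp [mustPop]⟩
    induction (h : Relation.ReflTransGen p.Rel s s') with
    | refl => exact le_rfl
    | tail _ hstep ih' => exact (ih hp.1 hstep).1.trans ih'

theorem Time.driven {G : Phase → Prog K A} {k : K} {p : Prog K A} (hp : p.driven k) {N : ℕ}
    (s : K → List A) (hs : (s k).length ≤ N) : Time G p s (p.time.eval N) := by
  induction p generalizing s with
  | one => simpa [Prog.time] using Time.one
  | zero => simpa [Prog.time] using Time.zero
  | push => simpa [Prog.time] using Time.push
  | pop => simpa [Prog.time] using Time.pop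
  | empty => simpa [Prog.time] using Time.empty
  | seq p q ihp ihq =>
    simp only [Prog.driven, Bool.and_eq_true] at hp
    simpa [Prog.time] using Time.seq (ihp hp.1 s hs) fun s' h =>
      ihq hp.2 s' ((h.length_le hp.1).1.trans hs)
  | alt p q ihp ihq =>
    simp only [Prog.driven, Bool.and_eq_true] at hp
    simpa [Prog.time] using Time.alt (ihp hp.1 s hs) (ihq hp.2 s hs)
  | star p ih =>
    simp only [Prog.driven, Bool.and_eq_true] at hp
    simpa [Prog.time] using Time.star (k := k) (fun s hs => ih hp.1 s hs)
      (fun s s' h => (h.length_le hp.1).2 hp.2) s hs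

theorem Prog.Rel.length_le_add {k : K} {p : Prog K A} (hp : p.driven k) {N : ℕ} (j : K)
    {s s' : K → List A} (hs : (s k).length ≤ N) (h : p.Rel s s') :
    (s' j).length ≤ (s j).length + p.time.eval N := by
  induction p generalizing s s' with
  | one => cases h; simp
  | zero => cases h
  | push k' a =>
    cases h
    by_cases hj : j = k'
    · subst hj; simp [Prog.time]
    · simp [update_of_ne hj]
  | pop k' a =>
    obtain ⟨r, hr, rfl⟩ := h
    by_cases hj : j = k'
    · subst hj; simp [hr, add_assoc]
    · simp [update_of_ne hj]
  | empty k' => obtain ⟨-, rfl⟩ := h; simp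
  | seq p q ihp ihq =>
    obtain ⟨s₁, h1, h2⟩ := h
    simp only [driven, Bool.and_eq_true] at hp
    have h3 := ihp hp.1 hs h1
    have h4 := ihq hp.2 ((h1.length_le hp.1).1.trans hs) h2
    simp only [time, Polynomial.eval_add, Polynomial.eval_one]
    omega
  | alt p q ihp ihq =>
    simp only [driven, Bool.and_eq_true] at hp
    simp only [time, Polynomial.eval_add, Polynomial.eval_one]
    rcases h with h | h
    · have := ihp hp.1 hs h; omega
    · have := ihq hp.2 hs h; omega
  | star p ih =>
    simp only [driven, Bool.and_eq_true] at hp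
    -- A potential: an iteration may lengthen the stack `j` by the time of `p`, but in return
    -- removes a symbol from the driving stack `k`.
    suffices (s' k).length ≤ (s k).length ∧ (s' j).length + (s' k).length * (p.time.eval N) ≤
        (s j).length + (s k).length * (p.time.eval N) by
      have h1 : (s k).length * (p.time.eval N) ≤ (N + 1) * (p.time.eval N + 1) :=
        Nat.mul_le_mul (by omega) (by omega)
      simp only [time, Polynomial.eval_add, Polynomial.eval_mul, Polynomial.eval_X,
        Polynomial.eval_one]
      omega
    induction (h : Relation.ReflTransGen p.Rel s s') with
    | refl => exact ⟨le_rfl, le_rfl⟩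
    | @tail s₁ s₂ _ hstep ih' =>
      have h1 := ih hp.1 (ih'.1.trans hs) hstep
      have h2 := (hstep.length_le hp.1).2 hp.2
      refine ⟨by omega, le_trans ?_ ih'.2⟩
      have : ((s₂ k).length + 1) * (p.time.eval N) ≤ (s₁ k).length * (p.time.eval N) :=
        Nat.mul_le_mul_right _ h2
      rw [add_mul] at this
      omega

/-- Programs that take polynomial time, and thus produce only polynomially large stacks. -/
def PTime (p : Prog K A) : Prop :=
  ∃ T : Polynomial ℕ, ∀ (N : ℕ) (s : K → List A), (∀ k, (s k).length ≤ N) →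
    (∀ G, Time G p s (T.eval N)) ∧ ∀ s', p.Rel s s' → ∀ k, (s' k).length ≤ T.eval N

theorem PTime.driven {k : K} {p : Prog K A} (hp : p.driven k) : PTime p :=
  ⟨Polynomial.X + p.time, fun N s hs =>
    ⟨fun _ => (Time.driven hp s (hs k)).mono (by simp), fun s' h j => by
      have := h.length_le_add hp j (hs k)
      have := hs j
      simp only [Polynomial.eval_add, Polynomial.eval_X]
      omega⟩⟩

/-- The second program starts with stacks of polynomial size, so its bound is composed with that of
the first. -/
theorem PTime.seq {p q : Prog K A} (hp : PTime p) (hq : PTime q) : PTime (.seq p q) := by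
  obtain ⟨T₁, h₁⟩ := hp
  obtain ⟨T₂, h₂⟩ := hq
  refine ⟨T₁ + T₂.comp T₁ + 1, fun N s hs => ⟨fun G => ?_, ?_⟩⟩
  · refine (Time.seq ((h₁ N s hs).1 G) fun s' h => (h₂ _ s' ((h₁ N s hs).2 s' h)).1 G).mono ?_
    simp [Polynomial.eval_comp]
  · rintro s'' ⟨s', h, h'⟩ k
    refine ((h₂ _ s' ((h₁ N s hs).2 s' h)).2 s'' h' k).trans ?_
    simp only [Polynomial.eval_add, Polynomial.eval_comp, Polynomial.eval_one]
    omega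

theorem PTime.alt {p q : Prog K A} (hp : PTime p) (hq : PTime q) : PTime (.alt p q) := by
  obtain ⟨T₁, h₁⟩ := hp
  obtain ⟨T₂, h₂⟩ := hq
  refine ⟨T₁ + T₂ + 1, fun N s hs => ⟨fun G => ?_, ?_⟩⟩
  · exact (Time.alt ((h₁ N s hs).1 G) ((h₂ N s hs).1 G)).mono (by simp)
  · simp only [Polynomial.eval_add, Polynomial.eval_one]
    rintro s' (h | h) k
    · have := (h₁ N s hs).2 s' h k; omega
    · have := (h₂ N s hs).2 s' h k; omega

/-! ### Games -/

/-- The value of a game of alternating guesses and replies: `inv m s` says that the stacks `s`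
describe a position of rank `m`. -/
theorem Wins.game {G : Phase → Prog K A} {N : ℕ} {inv : ℕ → (K → List A) → Prop}
    {W : (K → List A) → Prop} {tE tA : ℕ}
    (hE : ∀ m ≤ N, ∀ s, inv m s → Time G (G .guess) s tE)
    (hA : ∀ m ≤ N, ∀ s s', inv m s → (G .guess).Rel s s' → Time G (G .reply) s' tA)
    (hinv : ∀ m s s' s'', inv m s → (G .guess).Rel s s' → (G .reply).Rel s' s'' →
      ∃ m' < m, inv m' s'')
    (hW : ∀ m s, inv m s →
      (W s ↔ ∃ s', (G .guess).Rel s s' ∧ ∀ s'', (G .reply).Rel s' s'' → W s''))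
    (m : ℕ) (hm : m ≤ N) (s : K → List A) (hs : inv m s) :
    Wins G ((m + 1) * (tE + tA + 2)) (.guess, [G .guess]) s (W s) := by
  induction m using Nat.strong_induction_on generalizing s with
  | _ m ih =>
    -- The two single steps hand over the turn, once to each player; the next position has smaller
    -- rank.
    have h1 : ∀ s', (G .guess).Rel s s' → Wins G (m * (tE + tA + 2) + 1 + tA + 1) (.guess, []) s'
        (∀ s'', (G .reply).Rel s' s'' → W s'') := by
      intro s' hs'
      refine Wins.goto rfl (hA m hm s s' hs hs' .reply [] _ W fun s'' hs'' => ?_)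
      obtain ⟨m', h2, h3⟩ := hinv m s s' s'' hs hs' hs''
      refine Wins.goto rfl ((ih m' h2 (by omega) s'' h3).mono ?_)
      exact Nat.mul_le_mul_right _ (by omega)
    refine ((hE m hm s hs .guess [] _ _ h1).mono (by ring_nf; omega)).congr (hW m s hs).symm

/-- The type of all positions is infinite; restricted to the closed finite set of possible ones, the
game becomes a finite control. -/
theorem decides_of_wins [Fintype K] [Fintype A] {α : Type} {S : Set (List α)}
    (G : Phase → Prog K A) (k₀ : K) (e : α ↪ A) (p : Polynomial ℕ)
    (h : ∀ w : List α, Wins G (p.eval w.length) (.init, [G .init])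
      (update (fun _ => []) k₀ (w.map e)) (w ∈ S)) :
    InAlternatingPTime S ∧ InPSPACE S := by
  have : Fintype (gamePositions G) := (gamePositions_finite G).fintype
  have hmem : (Phase.init, [G .init]) ∈ gamePositions G := Or.inr (self_mem_conts _)
  have key : ∀ w : List α, ∃ v,
      Eval (restrictInstr (gameInstr G) (gamePositions G) ⟨_, hmem⟩) (fun x => x.1.1.isUniv)
        (p.eval w.length) ⟨_, hmem⟩ (update (fun _ => []) k₀ (w.map e)) v ∧
        (v = true ↔ w ∈ S) := by
    intro w
    obtain ⟨v, hv, hw⟩ := h w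
    exact ⟨v, hv.restrict (gamePositions_closed G) _ hmem, hw⟩
  exact ⟨inAlternatingPTime_of_eval k₀ _ e p key, inPSPACE_of_eval k₀ _ e p key⟩

end Programs

/-! ### Programs that read one stack and write another -/

/-- The stacks: a source, an output, and a counter. -/
inductive Stk : Type
  | S | O | C
  deriving DecidableEq

instance : Fintype Stk := ⟨{.S, .O, .C}, fun k => by cases k <;> simp⟩

/-- Marks in front of the formulas of a sequent: antecedent and succedent, active formulas of a
propositional rule, active formulas of a modal rule. -/
inductive Mark : Type
  | L | R | gL | gR | a | b | c | d | r | w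
  deriving DecidableEq

instance : Fintype Mark :=
  ⟨{.L, .R, .gL, .gR, .a, .b, .c, .d, .r, .w}, fun k => by cases k <;> simp⟩

open Classical in
noncomputable instance : Fintype Letter :=
  ⟨{.var, .zero, .one, .bot, .top, .and, .or, .imp, .box, .blockOpen, .blockClose, .arrow, .bar},
    fun k => by cases k <;> simp⟩

abbrev Sym := Letter ⊕ Mark

abbrev Program := Prog Stk Sym

open Prog Function

def tape (x o c : List Sym) : Stk → List Sym
  | .S => x
  | .O => o
  | .C => c

section tape

variable (x o c y : List Sym)

@[simp] theorem tape_S : tape x o c .S = x := rfl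
@[simp] theorem tape_O : tape x o c .O = o := rfl
@[simp] theorem tape_C : tape x o c .C = c := rfl

@[simp] theorem update_tape_S : update (tape x o c) .S y = tape y o c := by
  funext k; cases k <;> simp

@[simp] theorem update_tape_O : update (tape x o c) .O y = tape x y c := by
  funext k; cases k <;> simp

@[simp] theorem update_tape_C : update (tape x o c) .C y = tape x o y := by
  funext k; cases k <;> simp

@[simp] theorem tape_inj {x o c x' o' c' : List Sym} :
    tape x o c = tape x' o' c' ↔ x = x' ∧ o = o' ∧ c = c' :=
  ⟨fun h => ⟨congrFun h .S, congrFun h .O, congrFun h .C⟩, by rintro ⟨rfl, rfl, rfl⟩; rfl⟩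

end tape

/-- The program `p` reads one of the words `f t` from the source, and writes `g t`. -/
def Tr {τ : Type} (p : Program) (f g : τ → List Sym) : Prop :=
  ∀ x o c s', p.Rel (tape x o c) s' ↔
    ∃ t u, x = f t ++ u ∧ s' = tape u ((g t).reverse ++ o) c

theorem Tr.congr {τ τ' : Type} {p : Program} {f g : τ → List Sym} (h : Tr p f g)
    {f' g' : τ' → List Sym} (h₁ : ∀ t, ∃ t', f t = f' t' ∧ g t = g' t')
    (h₂ : ∀ t', ∃ t, f t = f' t' ∧ g t = g' t') : Tr p f' g' := by
  intro x o c s'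
  rw [h]
  constructor
  · rintro ⟨t, u, hx, hs⟩
    obtain ⟨t', hf, hg⟩ := h₁ t
    exact ⟨t', u, hf ▸ hx, hg ▸ hs⟩
  · rintro ⟨t', u, hx, hs⟩
    obtain ⟨t, hf, hg⟩ := h₂ t'
    exact ⟨t, u, hf ▸ hx, hg ▸ hs⟩

theorem Tr.one : Tr .one (fun _ : Unit => []) (fun _ => []) := by
  intro x o c s'
  simp [Prog.Rel]

theorem Tr.pop (a : Sym) : Tr (.pop .S a) (fun _ : Unit => [a]) (fun _ => []) := by
  intro x o c s'
  simp [Prog.Rel]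

theorem Tr.push (a : Sym) : Tr (.push .O a) (fun _ : Unit => []) (fun _ => [a]) := by
  intro x o c s'
  simp [Prog.Rel]

theorem Tr.seq {τ τ' : Type} {p q : Program} {f g : τ → List Sym} {f' g' : τ' → List Sym}
    (hp : Tr p f g) (hq : Tr q f' g') :
    Tr (.seq p q) (fun t : τ × τ' => f t.1 ++ f' t.2) (fun t => g t.1 ++ g' t.2) := by
  intro x o c s'
  simp only [Prog.Rel]
  constructor
  · rintro ⟨s₁, h₁, h₂⟩
    obtain ⟨t, u, rfl, rfl⟩ := (hp _ _ _ _).1 h₁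
    obtain ⟨t', u', rfl, rfl⟩ := (hq _ _ _ _).1 h₂
    exact ⟨(t, t'), u', by simp⟩
  · rintro ⟨⟨t, t'⟩, u, rfl, rfl⟩
    exact ⟨_, (hp _ _ _ _).2 ⟨t, f' t' ++ u, by simp, rfl⟩, (hq _ _ _ _).2 ⟨t', u, by simp, by simp⟩⟩

theorem Tr.alt {τ τ' : Type} {p q : Program} {f g : τ → List Sym} {f' g' : τ' → List Sym}
    (hp : Tr p f g) (hq : Tr q f' g') : Tr (.alt p q) (Sum.elim f f') (Sum.elim g g') := by
  intro x o c s'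
  simp [Prog.Rel, hp x o c s', hq x o c s']

theorem Tr.star {τ : Type} {p : Program} {f g : τ → List Sym} (hp : Tr p f g) :
    Tr (.star p) (fun t : List τ => t.flatMap f) (fun t => t.flatMap g) := by
  intro x o c s'
  constructor
  · intro h
    replace h : Relation.ReflTransGen p.Rel (tape x o c) s' := h
    induction h with
    | refl => exact ⟨[], x, by simp⟩
    | tail _ h ih =>
      obtain ⟨l, u, rfl, rfl⟩ := ih
      obtain ⟨t, v, rfl, rfl⟩ := (hp _ _ _ _).1 h
      exact ⟨l ++ [t], v, by simp⟩
  · rintro ⟨l, u, rfl, rfl⟩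
    show Relation.ReflTransGen p.Rel _ _
    induction l generalizing o with
    | nil => exact .refl
    | cons t l ih =>
      exact .head ((hp _ _ _ _).2 ⟨t, l.flatMap f ++ u, by simp, rfl⟩) (by simpa using ih (o := _))

theorem Tr.popSeq {τ : Type} {p : Program} {f g : τ → List Sym} (a : Sym) (hp : Tr p f g) :
    Tr (.seq (.pop .S a) p) (fun t => a :: f t) g :=
  ((Tr.pop a).seq hp).congr (fun t => ⟨t.2, by simp⟩) fun t => ⟨((), t), by simp⟩

theorem Tr.pushSeq {τ : Type} {p : Program} {f g : τ → List Sym} (a : Sym) (hp : Tr p f g) :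
    Tr (.seq (.push .O a) p) f (fun t => a :: g t) :=
  ((Tr.push a).seq hp).congr (fun t => ⟨t.2, by simp⟩) fun t => ⟨((), t), by simp⟩

/-! ### Reading formulas -/

/-- The word `y` if `out` holds, and otherwise the empty word. -/
def outWord (out : Bool) (y : List Sym) : List Sym := if out then y else []

@[simp] theorem outWord_nil (out : Bool) : outWord out [] = [] := by simp [outWord]

theorem outWord_append (out : Bool) (y z : List Sym) :
    outWord out (y ++ z) = outWord out y ++ outWord out z := by
  cases out <;> simp [outWord]

/-- Read the letter `a`, and write it if `out` holds. -/
def readP (out : Bool) (a : Letter) : Program :=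
  .seq (.pop .S (.inl a)) (if out then .push .O (.inl a) else .one)

theorem tr_readP (out : Bool) (a : Letter) :
    Tr (readP out a) (fun _ : Unit => [.inl a]) (fun _ => outWord out [.inl a]) := by
  refine Tr.popSeq (f := fun _ => []) _ ?_
  cases out
  · exact Tr.one
  · exact Tr.push _

def digit (b : Bool) : Letter := if b then .one else .zero

def bitsWord (l : List Bool) : List Sym := l.map fun b => .inl (digit b)

@[simp] theorem bitsWord_append (l l' : List Bool) :
    bitsWord (l ++ l') = bitsWord l ++ bitsWord l' := by simp [bitsWord]

/-- The least significant digit comes first, so the last digit of a positive number is 1. With the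
converse below, the codes of indices form a regular language. -/
theorem bits_eq_nil_or (i : ℕ) : i.bits = [] ∨ ∃ l, i.bits = l ++ [true] := by
  induction i using Nat.binaryRec' with
  | zero => simp
  | bit b n h ih =>
    right
    rw [Nat.bits_append_bit _ _ h]
    rcases ih with h' | ⟨l, hl⟩
    · refine ⟨[], ?_⟩
      have hn : n = 0 := by
        rcases Nat.eq_zero_or_pos n with h0 | h0
        · exact h0
        · have := congrArg List.length h'
          rw [Nat.size_eq_bits_len, List.length_nil] at this
          exact absurd (Nat.size_eq_zero.1 this) h0.ne'
      simp [h', h hn]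
    · exact ⟨b :: l, by simp [hl]⟩

theorem exists_bits_eq (l : List Bool) : ∃ i : ℕ, i ≠ 0 ∧ i.bits = l ++ [true] := by
  induction l with
  | nil => exact ⟨1, by simp⟩
  | cons b l ih =>
    obtain ⟨i, h0, hi⟩ := ih
    refine ⟨Nat.bit b i, by simp [Nat.bit_eq_zero_iff, h0], ?_⟩
    rw [Nat.bits_append_bit _ _ (by simp [h0]), hi]
    simp

/-- Read the binary expansion of a natural number. -/
def bitsP (out : Bool) : Program :=
  .alt .one (.seq (.star (.alt (readP out .one) (readP out .zero))) (readP out .one))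

theorem tr_bitsP (out : Bool) :
    Tr (bitsP out) (fun i : ℕ => bitsWord i.bits) (fun i => outWord out (bitsWord i.bits)) := by
  have h1 : Tr (.star (.alt (readP out .one) (readP out .zero))) bitsWord
      (fun l => outWord out (bitsWord l)) := by
    refine ((tr_readP out .one).alt (tr_readP out .zero)).star.congr (fun l => ?_) fun l => ?_
    · induction l with
      | nil => exact ⟨[], by simp [bitsWord]⟩
      | cons t l ih =>
        obtain ⟨l', h⟩ := ih
        cases t
        · refine ⟨true :: l', ?_⟩
          have : bitsWord (true :: l') = [.inl .one] ++ bitsWord l' := rfl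
          rw [this, outWord_append]
          simp [h]
        · refine ⟨false :: l', ?_⟩
          have : bitsWord (false :: l') = [.inl .zero] ++ bitsWord l' := rfl
          rw [this, outWord_append]
          simp [h]
    · induction l with
      | nil => exact ⟨[], by simp [bitsWord]⟩
      | cons b l ih =>
        obtain ⟨l', h⟩ := ih
        cases b
        · refine ⟨.inr () :: l', ?_⟩
          have : bitsWord (false :: l) = [.inl .zero] ++ bitsWord l := rfl
          rw [this, outWord_append]
          simpa using h
        · refine ⟨.inl () :: l', ?_⟩
          have : bitsWord (true :: l) = [.inl .one] ++ bitsWord l := rfl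
          rw [this, outWord_append]
          simpa using h
  have h2 : bitsWord [true] = [.inl .one] := rfl
  refine (Tr.one.alt (h1.seq (tr_readP out .one))).congr ?_ fun i => ?_
  · rintro (_ | ⟨l, _⟩)
    · exact ⟨0, by simp [bitsWord]⟩
    · obtain ⟨i, -, hi⟩ := exists_bits_eq l
      exact ⟨i, by simp [hi, h2, outWord_append]⟩
  · rcases bits_eq_nil_or i with h | ⟨l, h⟩
    · exact ⟨.inl (), by simp [h, bitsWord]⟩
    · exact ⟨.inr (l, ()), by simp [h, h2, outWord_append]⟩

def Formula.word (A : Formula) : List Sym := A.encode.map .inl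

theorem Formula.word_atom (i : ℕ) : (atom i).word = .inl .var :: bitsWord i.bits := by
  simp [word, encode, bitsWord, digit]

/-- Read the first symbol of a formula, and count its immediate subformulas. -/
def headP (out : Bool) : Program :=
  .seq (.pop .C (.inl .bar)) <|
    .alt (.seq (readP out .var) (bitsP out)) <| .alt (readP out .bot) <| .alt (readP out .top) <|
    .alt (.seq (readP out .box) (.push .C (.inl .bar))) <|
    .seq (.alt (readP out .and) (.alt (readP out .or) (readP out .imp)))
      (.seq (.push .C (.inl .bar)) (.push .C (.inl .bar)))

/-- The first symbols of the formulas, and the numbers of their immediate subformulas. -/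
def IsHead (y : List Sym) (n : ℕ) : Prop :=
  (n = 0 ∧ ((∃ i, y = (Formula.atom i).word) ∨ y = [.inl .bot] ∨ y = [.inl .top])) ∨
  (n = 1 ∧ y = [.inl .box]) ∨
  (n = 2 ∧ (y = [.inl .and] ∨ y = [.inl .or] ∨ y = [.inl .imp]))

theorem rel_headP (out : Bool) (x o c : List Sym) (s' : Stk → List Sym) :
    (headP out).Rel (tape x o c) s' ↔ ∃ c' y n u, c = .inl .bar :: c' ∧ IsHead y n ∧ x = y ++ u ∧
      s' = tape u ((outWord out y).reverse ++ o) (List.replicate n (.inl .bar) ++ c') := by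
  have hat : ∀ c', ((readP out .var).seq (bitsP out)).Rel (tape x o c') s' ↔
      ∃ i u, x = (Formula.atom i).word ++ u ∧
        s' = tape u ((outWord out (Formula.atom i).word).reverse ++ o) c' := by
    intro c'
    have := ((tr_readP out .var).seq (tr_bitsP out)).congr (f' := fun i => (Formula.atom i).word)
      (g' := fun i => outWord out (Formula.atom i).word) (fun t => ⟨t.2, ?_⟩) fun i => ⟨((), i), ?_⟩
    · exact this x o c' s'
    all_goals
      simp only [Formula.word_atom]
      rw [← List.singleton_append (l := bitsWord _), outWord_append]
      exact ⟨rfl, rfl⟩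
  have hr : ∀ a c' s', (readP out a).Rel (tape x o c') s' ↔
      ∃ u, x = [.inl a] ++ u ∧ s' = tape u ((outWord out [.inl a]).reverse ++ o) c' := by
    intro a c' s'
    rw [tr_readP out a x o c' s']
    simp
  simp only [headP, Prog.Rel, tape_C, update_tape_C]
  constructor
  · rintro ⟨_, ⟨c', rfl, rfl⟩, h⟩
    rcases h with h | h | h | ⟨_, h, rfl⟩ | ⟨_, h, _, rfl, rfl⟩
    · obtain ⟨i, u, rfl, rfl⟩ := (hat c').1 h
      exact ⟨c', _, 0, u, rfl, .inl ⟨rfl, .inl ⟨i, rfl⟩⟩, rfl, rfl⟩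
    · obtain ⟨u, rfl, rfl⟩ := (hr _ _ _).1 h
      exact ⟨c', _, 0, u, rfl, .inl ⟨rfl, .inr (.inl rfl)⟩, rfl, rfl⟩
    · obtain ⟨u, rfl, rfl⟩ := (hr _ _ _).1 h
      exact ⟨c', _, 0, u, rfl, .inl ⟨rfl, .inr (.inr rfl)⟩, rfl, rfl⟩
    · obtain ⟨u, rfl, rfl⟩ := (hr _ _ _).1 h
      exact ⟨c', _, 1, u, rfl, .inr (.inl ⟨rfl, rfl⟩), rfl, by simp⟩
    · rcases h with h | h | h
      · obtain ⟨u, rfl, rfl⟩ := (hr _ _ _).1 h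
        exact ⟨c', _, 2, u, rfl, .inr (.inr ⟨rfl, .inl rfl⟩), rfl, by simp [List.replicate]⟩
      · obtain ⟨u, rfl, rfl⟩ := (hr _ _ _).1 h
        exact ⟨c', _, 2, u, rfl, .inr (.inr ⟨rfl, .inr (.inl rfl)⟩), rfl, by simp [List.replicate]⟩
      · obtain ⟨u, rfl, rfl⟩ := (hr _ _ _).1 h
        exact ⟨c', _, 2, u, rfl, .inr (.inr ⟨rfl, .inr (.inr rfl)⟩), rfl, by simp [List.replicate]⟩
  · rintro ⟨c', y, n, u, rfl, hy, rfl, rfl⟩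
    refine ⟨_, ⟨c', rfl, rfl⟩, ?_⟩
    rcases hy with ⟨rfl, ⟨i, rfl⟩ | rfl | rfl⟩ | ⟨rfl, rfl⟩ | ⟨rfl, rfl | rfl | rfl⟩
    · exact .inl ((hat c').2 ⟨i, u, rfl, rfl⟩)
    · exact .inr (.inl ((hr _ _ _).2 ⟨u, rfl, rfl⟩))
    · exact .inr (.inr (.inl ((hr _ _ _).2 ⟨u, rfl, rfl⟩)))
    · exact .inr (.inr (.inr (.inl ⟨_, (hr _ _ _).2 ⟨u, rfl, rfl⟩, by simp⟩)))
    · exact .inr (.inr (.inr (.inr ⟨_, .inl ((hr _ _ _).2 ⟨u, rfl, rfl⟩), _, rfl,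
        by simp [List.replicate]⟩)))
    · exact .inr (.inr (.inr (.inr ⟨_, .inr (.inl ((hr _ _ _).2 ⟨u, rfl, rfl⟩)), _, rfl,
        by simp [List.replicate]⟩)))
    · exact .inr (.inr (.inr (.inr ⟨_, .inr (.inr ((hr _ _ _).2 ⟨u, rfl, rfl⟩)), _, rfl,
        by simp [List.replicate]⟩)))

/-- Build a formula from its first symbol and its immediate subformulas. -/
theorem IsHead.exists_formula {y : List Sym} {n : ℕ} (h : IsHead y n) (l : List Formula)
    (hl : l.length = n) : ∃ A : Formula, A.word = y ++ l.flatMap Formula.word := by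
  rcases h with ⟨rfl, ⟨i, rfl⟩ | rfl | rfl⟩ | ⟨rfl, rfl⟩ | ⟨rfl, h⟩
  · exact ⟨.atom i, by simp [List.length_eq_zero_iff.1 hl]⟩
  · exact ⟨.bot, by simp [List.length_eq_zero_iff.1 hl, Formula.word, Formula.encode]⟩
  · exact ⟨.top, by simp [List.length_eq_zero_iff.1 hl, Formula.word, Formula.encode]⟩
  · obtain ⟨A, rfl⟩ := List.length_eq_one_iff.1 hl
    exact ⟨.box A, by simp [Formula.word, Formula.encode]⟩
  · obtain ⟨A, B, rfl⟩ := List.length_eq_two.1 hl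
    rcases h with rfl | rfl | rfl
    · exact ⟨.and A B, by simp [Formula.word, Formula.encode]⟩
    · exact ⟨.or A B, by simp [Formula.word, Formula.encode]⟩
    · exact ⟨.imp A B, by simp [Formula.word, Formula.encode]⟩

theorem Formula.exists_isHead (A : Formula) : ∃ (y : List Sym) (l : List Formula),
    IsHead y l.length ∧ A.word = y ++ l.flatMap Formula.word ∧
      (l.map Formula.size).sum < A.size := by
  cases A with
  | atom i => exact ⟨_, [], .inl ⟨rfl, .inl ⟨i, rfl⟩⟩, by simp, by simp [size]⟩
  | bot => exact ⟨_, [], .inl ⟨rfl, .inr (.inl rfl)⟩, by simp [word, encode], by simp [size]⟩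
  | top => exact ⟨_, [], .inl ⟨rfl, .inr (.inr rfl)⟩, by simp [word, encode], by simp [size]⟩
  | and A B =>
    exact ⟨_, [A, B], .inr (.inr ⟨rfl, .inl rfl⟩), by simp [word, encode],
      by simp [size]⟩
  | or A B =>
    exact ⟨_, [A, B], .inr (.inr ⟨rfl, .inr (.inl rfl)⟩), by simp [word, encode],
      by simp [size]⟩
  | imp A B =>
    exact ⟨_, [A, B], .inr (.inr ⟨rfl, .inr (.inr rfl)⟩), by simp [word, encode],
      by simp [size]⟩
  | box A => exact ⟨_, [A], .inr (.inl ⟨rfl, rfl⟩), by simp [word, encode], by simp [size]⟩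

/-- The counter replaces a recursion: it holds a bar for every formula that is still to be read, and
a head symbol exchanges one bar for as many as it has arguments. -/
theorem star_headP_of_words (out : Bool) (l : List Formula) (u o c : List Sym) :
    Relation.ReflTransGen (headP out).Rel
      (tape (l.flatMap Formula.word ++ u) o (List.replicate l.length (.inl .bar) ++ c))
      (tape u ((outWord out (l.flatMap Formula.word)).reverse ++ o) c) := by
  suffices ∀ n (l : List Formula), (l.map Formula.size).sum = n → ∀ o,
      Relation.ReflTransGen (headP out).Rel
      (tape (l.flatMap Formula.word ++ u) o (List.replicate l.length (.inl .bar) ++ c))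
      (tape u ((outWord out (l.flatMap Formula.word)).reverse ++ o) c) from this _ l rfl o
  intro n
  induction n using Nat.strong_induction_on with
  | _ n ih =>
    rintro (_ | ⟨A, l⟩) hl o
    · simp [outWord_nil]; exact .refl
    · obtain ⟨y, l', hy, hA, hs⟩ := A.exists_isHead
      -- After its head, `A` is replaced in the list by its immediate subformulas. The list may
      -- grow, but its total size falls.
      have hlt : ((l' ++ l).map Formula.size).sum < n := by
        rw [← hl, List.map_append, List.sum_append, List.map_cons, List.sum_cons]
        omega
      have := ih _ hlt (l' ++ l) rfl ((outWord out y).reverse ++ o)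
      refine .head ((rel_headP ..).2 ⟨List.replicate l.length (.inl .bar) ++ c, y, l'.length,
        (l' ++ l).flatMap Formula.word ++ u, ?_, hy, ?_, rfl⟩) ?_
      · simp [List.replicate_succ]
      · rw [List.flatMap_cons, hA, List.flatMap_append]
        simp only [List.append_assoc]
      · rw [List.flatMap_cons, hA, List.append_assoc y, ← List.flatMap_append, outWord_append,
          List.reverse_append]
        simpa only [List.length_append, List.replicate_add, List.append_assoc] using this

/-- The marker ⊥ below the bars cannot be popped by `headP`; when it is on top, exactly the `k`
announced formulas have been read. -/
theorem words_of_star_headP {out : Bool} {k : ℕ} {x o c r : List Sym} {s : Stk → List Sym}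
    (h : Relation.ReflTransGen (headP out).Rel
      (tape x o (List.replicate k (.inl .bar) ++ .inl .bot :: c)) s) (hs : s .C = .inl .bot :: r) :
    ∃ (l : List Formula) (u : List Sym), l.length = k ∧ x = l.flatMap Formula.word ++ u ∧
      s = tape u ((outWord out (l.flatMap Formula.word)).reverse ++ o) (.inl .bot :: c) := by
  generalize ha : tape x o (List.replicate k (.inl .bar) ++ .inl .bot :: c) = a at h
  induction h using Relation.ReflTransGen.head_induction_on generalizing k x o with
  | refl =>
    subst ha
    cases k with
    | zero => exact ⟨[], x, by simp⟩
    | succ k => simp [List.replicate_succ] at hs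
  | head h _ ih =>
    subst ha
    obtain ⟨c', y, n, u, hc, hy, rfl, rfl⟩ := (rel_headP ..).1 h
    cases k with
    | zero => simp at hc
    | succ k =>
      simp only [List.replicate_succ, List.cons_append, List.cons.injEq, true_and] at hc
      obtain ⟨l, v, hl, rfl, hs'⟩ := ih (k := n + k) (x := u) (o := (outWord out y).reverse ++ o)
        (by rw [List.replicate_add, List.append_assoc, hc])
      -- Of the formulas that follow the head, the first `n` are its arguments.
      obtain ⟨A, hA⟩ := hy.exists_formula (l.take n) (by simp [hl])
      have hw : (A :: l.drop n).flatMap Formula.word = y ++ l.flatMap Formula.word := by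
        rw [List.flatMap_cons, hA, List.append_assoc, ← List.flatMap_append, List.take_append_drop]
      refine ⟨A :: l.drop n, v, by simp [hl], by rw [hw, List.append_assoc], ?_⟩
      rw [hs', hw, outWord_append, List.reverse_append, List.append_assoc]

/-- Read a formula, and write it if `out` holds. -/
def formulaP (out : Bool) : Program :=
  .seq (.push .C (.inl .bot)) <| .seq (.push .C (.inl .bar)) <| .seq (headP out) <|
    .seq (.star (headP out)) (.pop .C (.inl .bot))

theorem tr_formulaP (out : Bool) :
    Tr (formulaP out) Formula.word fun A => outWord out A.word := by
  intro x o c s'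
  simp only [formulaP, Prog.Rel, tape_C, update_tape_C]
  constructor
  · rintro ⟨_, rfl, _, rfl, s₁, h₁, s, h, r, hr, rfl⟩
    simp only [tape_C, update_tape_C] at h₁
    obtain ⟨l, u, hl, rfl, rfl⟩ := words_of_star_headP (k := 1) (c := c) (.head h₁ h) hr
    obtain ⟨A, rfl⟩ := List.length_eq_one_iff.1 hl
    simp only [tape_C, List.cons.injEq, true_and] at hr
    exact ⟨A, u, by simp, by simp [hr]⟩
  · rintro ⟨A, u, rfl, rfl⟩
    have h := star_headP_of_words out [A] u o (.inl .bot :: c)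
    rcases Relation.ReflTransGen.cases_head h with h | ⟨s₁, h₁, h₂⟩
    · simp at h
    · exact ⟨_, rfl, _, rfl, s₁, by simpa using h₁, _, h₂, c, by simp⟩

open Prog Function

/-! ### Sequents on the tape -/

/-- The items of a sequent that is written on the tape. -/
inductive Item : Type
  | fm (m : Mark) (A : Formula)
  | blk (X : List Formula)

/-- The items of a sequent, up to the order in the blocks. -/
inductive AItem : Type
  | fm (m : Mark) (A : Formula)
  | blk (X : Multiset Formula)

def Item.word : Item → List Sym
  | fm m A => .inr m :: A.word
  | blk X => .inl .blockOpen :: (X.flatMap Formula.word ++ [.inl .blockClose])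

def Item.abs : Item → AItem
  | fm m A => .fm m A
  | blk X => .blk X

def words (l : List Item) : List Sym := l.flatMap Item.word

def content (l : List Item) : Multiset AItem := (l.map Item.abs : List AItem)

@[simp] theorem words_nil : words [] = [] := rfl
@[simp] theorem words_cons (i : Item) (l : List Item) : words (i :: l) = i.word ++ words l := rfl
@[simp] theorem words_append (l l' : List Item) : words (l ++ l') = words l ++ words l' := by
  simp [words]
@[simp] theorem content_nil : content [] = 0 := rfl
@[simp] theorem content_cons (i : Item) (l : List Item) :
    content (i :: l) = i.abs ::ₘ content l := rfl
@[simp] theorem content_append (l l' : List Item) :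
    content (l ++ l') = content l + content l' := by simp [content]

/-! ### Unique readability of the tape -/

/-- The word does not start with a binary digit. -/
def NoDigit (u : List Sym) : Prop := ∀ b r, u ≠ .inl (digit b) :: r

/-- Indices are not self-delimiting; the next symbol that is not a digit ends them. -/
theorem bitsWord_append_inj {l l' : List Bool} {u u' : List Sym} (hu : NoDigit u)
    (hu' : NoDigit u') (h : bitsWord l ++ u = bitsWord l' ++ u') : l = l' ∧ u = u' := by
  induction l generalizing l' with
  | nil =>
    cases l' with
    | nil => exact ⟨rfl, h⟩
    | cons b l' => exact absurd h (hu b _)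
  | cons b l ih =>
    cases l' with
    | nil => exact absurd h.symm (hu' b _)
    | cons b' l' =>
      simp only [bitsWord, List.map_cons, List.cons_append, List.cons.injEq, Sum.inl.injEq] at h
      obtain ⟨rfl, rfl⟩ := ih h.2
      have : b = b' := by cases b <;> cases b' <;> simp_all [digit]
      exact ⟨by rw [this], rfl⟩

theorem bits_injective : Injective Nat.bits := fun i j h =>
  Nat.eq_of_testBit_eq fun k => by
    rw [Nat.testBit_eq_inth, Nat.testBit_eq_inth, h]

theorem Formula.noDigit_word (A : Formula) (u : List Sym) : NoDigit (A.word ++ u) := by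
  intro b r h
  cases A <;> cases b <;> simp [word, encode, digit] at h

/-- Prefix notation needs no brackets. Only a variable at the end of the formula could absorb what
follows, which the hypotheses exclude. -/
theorem Formula.word_append_inj {A B : Formula} {u v : List Sym} (hu : NoDigit u)
    (hv : NoDigit v) (h : A.word ++ u = B.word ++ v) : A = B ∧ u = v := by
  induction A generalizing B u v with
  | atom i =>
    cases B with
    | atom j =>
      simp only [word_atom, List.cons_append, List.cons.injEq, true_and] at h
      obtain ⟨hb, h⟩ := bitsWord_append_inj hu hv h
      exact ⟨by rw [bits_injective hb], h⟩
    | _ => simp [word, encode] at h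
  | bot =>
    cases B with
    | bot => exact ⟨rfl, by simpa [word, encode] using h⟩
    | _ => simp [word, encode] at h
  | top =>
    cases B with
    | top => exact ⟨rfl, by simpa [word, encode] using h⟩
    | _ => simp [word, encode] at h
  | box A ih =>
    cases B with
    | box B =>
      obtain ⟨rfl, h₁⟩ := ih hu hv (by simpa [word, encode] using h)
      exact ⟨rfl, h₁⟩
    | _ => simp [word, encode] at h
  | and A A' ih ih' =>
    cases B with
    | and B B' =>
      obtain ⟨rfl, h₁⟩ := ih (A'.noDigit_word u) (B'.noDigit_word v)
        (by simpa [word, encode] using h)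
      obtain ⟨rfl, h₂⟩ := ih' hu hv h₁
      exact ⟨rfl, h₂⟩
    | _ => simp [word, encode] at h
  | or A A' ih ih' =>
    cases B with
    | or B B' =>
      obtain ⟨rfl, h₁⟩ := ih (A'.noDigit_word u) (B'.noDigit_word v)
        (by simpa [word, encode] using h)
      obtain ⟨rfl, h₂⟩ := ih' hu hv h₁
      exact ⟨rfl, h₂⟩
    | _ => simp [word, encode] at h
  | imp A A' ih ih' =>
    cases B with
    | imp B B' =>
      obtain ⟨rfl, h₁⟩ := ih (A'.noDigit_word u) (B'.noDigit_word v)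
        (by simpa [word, encode] using h)
      obtain ⟨rfl, h₂⟩ := ih' hu hv h₁
      exact ⟨rfl, h₂⟩
    | _ => simp [word, encode] at h

theorem Formula.word_ne_blockClose (A : Formula) (u v : List Sym) :
    A.word ++ u ≠ .inl .blockClose :: v := by
  cases A <;> simp [word, encode]

theorem noDigit_blockClose (u : List Sym) : NoDigit (.inl .blockClose :: u) := by
  intro b r h
  cases b <;> simp [digit] at h

theorem noDigit_flatMap_word (X : List Formula) {u : List Sym} (hu : NoDigit u) :
    NoDigit (X.flatMap Formula.word ++ u) := by
  cases X with
  | nil => exact hu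
  | cons A X =>
    rw [List.flatMap_cons, List.append_assoc]
    exact A.noDigit_word _

theorem flatMap_word_inj {X Y : List Formula} {u v : List Sym}
    (h : X.flatMap Formula.word ++ .inl .blockClose :: u =
      Y.flatMap Formula.word ++ .inl .blockClose :: v) : X = Y ∧ u = v := by
  induction X generalizing Y with
  | nil =>
    cases Y with
    | nil => exact ⟨rfl, by simpa using h⟩
    | cons B Y =>
      rw [List.flatMap_cons, List.append_assoc] at h
      exact absurd h.symm (B.word_ne_blockClose _ _)
  | cons A X ih =>
    cases Y with
    | nil =>
      rw [List.flatMap_cons, List.append_assoc] at h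
      exact absurd h (A.word_ne_blockClose _ _)
    | cons B Y =>
      rw [List.flatMap_cons, List.append_assoc, List.flatMap_cons, List.append_assoc] at h
      obtain ⟨rfl, h₁⟩ := Formula.word_append_inj (noDigit_flatMap_word _ (noDigit_blockClose _))
        (noDigit_flatMap_word _ (noDigit_blockClose _)) h
      obtain ⟨rfl, h₂⟩ := ih h₁
      exact ⟨rfl, h₂⟩

theorem noDigit_words (l : List Item) : NoDigit (words l) := by
  intro b r h
  rcases l with _ | ⟨_ | _, l⟩
  · simp at h
  · simp [Item.word] at h
  · cases b <;> simp [Item.word, digit] at h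

/-- A pass that has consumed the whole source has read the items that were written there and no
others. -/
theorem words_injective : Injective words := by
  intro l
  induction l with
  | nil =>
    rintro (_ | ⟨_ | _, l'⟩) h
    · rfl
    · simp [Item.word] at h
    · simp [Item.word] at h
  | cons i l ih =>
    rintro (_ | ⟨j, l'⟩) h
    · cases i <;> simp [Item.word] at h
    · cases i with
      | fm m A =>
        cases j with
        | fm m' A' =>
          simp only [words_cons, Item.word, List.cons_append, List.cons.injEq, Sum.inr.injEq] at h
          obtain ⟨rfl, h₁⟩ := h
          obtain ⟨rfl, h₂⟩ := Formula.word_append_inj (noDigit_words l) (noDigit_words l') h₁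
          rw [ih h₂]
        | blk X => simp [Item.word] at h
      | blk X =>
        cases j with
        | fm m' A' => simp [Item.word] at h
        | blk X' =>
          simp only [words_cons, Item.word, List.cons_append, List.cons.injEq, true_and,
            List.append_assoc, List.nil_append] at h
          obtain ⟨rfl, h₁⟩ := flatMap_word_inj h
          rw [ih h₁]

/-! ### Rewriting items -/

/-- The program reads an item and writes items that are related to it. -/
def ItemTr (p : Program) (r : AItem → Multiset AItem → Prop) : Prop :=
  (∀ x o c s', p.Rel (tape x o c) s' → ∃ (i : Item) (js : List Item) (u : List Sym), x = i.word ++ u ∧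
    s' = tape u ((words js).reverse ++ o) c ∧ r i.abs (content js)) ∧
  ∀ (i : Item) (J : Multiset AItem), r i.abs J → ∃ js, content js = J ∧
    ∀ u o c, p.Rel (tape (i.word ++ u) o c) (tape u ((words js).reverse ++ o) c)

theorem ItemTr.of_tr {τ : Type} {p : Program} {f g : τ → List Sym} (h : Tr p f g)
    {r : AItem → Multiset AItem → Prop}
    (h₁ : ∀ t, ∃ (i : Item) (js : List Item), f t = i.word ∧ g t = words js ∧ r i.abs (content js))
    (h₂ : ∀ (i : Item) J, r i.abs J → ∃ t js, f t = i.word ∧ g t = words js ∧ content js = J) :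
    ItemTr p r := by
  constructor
  · intro x o c s' hs
    obtain ⟨t, u, rfl, rfl⟩ := (h _ _ _ _).1 hs
    obtain ⟨i, js, hf, hg, hr⟩ := h₁ t
    exact ⟨i, js, u, by rw [hf], by rw [hg], hr⟩
  · intro i J hr
    obtain ⟨t, js, hf, hg, hJ⟩ := h₂ i J hr
    exact ⟨js, hJ, fun u o c => (h _ _ _ _).2 ⟨t, u, by rw [hf], by rw [hg]⟩⟩

theorem ItemTr.congr {p : Program} {r r' : AItem → Multiset AItem → Prop} (h : ItemTr p r)
    (hr : ∀ i J, r i J ↔ r' i J) : ItemTr p r' := by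
  have : r = r' := funext fun i => funext fun J => propext (hr i J)
  exact this ▸ h

theorem ItemTr.alt {p q : Program} {r r' : AItem → Multiset AItem → Prop} (hp : ItemTr p r)
    (hq : ItemTr q r') : ItemTr (.alt p q) fun i J => r i J ∨ r' i J := by
  constructor
  · rintro x o c s' (h | h)
    · obtain ⟨i, js, u, h1, h2, h3⟩ := hp.1 _ _ _ _ h
      exact ⟨i, js, u, h1, h2, .inl h3⟩
    · obtain ⟨i, js, u, h1, h2, h3⟩ := hq.1 _ _ _ _ h
      exact ⟨i, js, u, h1, h2, .inr h3⟩
  · rintro i J (h | h)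
    · obtain ⟨js, h1, h2⟩ := hp.2 _ _ h
      exact ⟨js, h1, fun u o c => .inl (h2 u o c)⟩
    · obtain ⟨js, h1, h2⟩ := hq.2 _ _ h
      exact ⟨js, h1, fun u o c => .inr (h2 u o c)⟩

theorem ItemTr.zero : ItemTr .zero fun _ _ => False :=
  ⟨fun _ _ _ _ h => h.elim, fun _ _ h => h.elim⟩

/-! ### Programs for single items -/

def choice : List Program → Program
  | [] => .zero
  | p :: l => .alt p (choice l)

theorem rel_choice {l : List Program} {s s' : Stk → List Sym} :
    (choice l).Rel s s' ↔ ∃ p ∈ l, p.Rel s s' := by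
  induction l with
  | nil => simp [choice, Prog.Rel]
  | cons p l ih => simp [choice, Prog.Rel, ih]

theorem driven_choice {l : List Program} {k : Stk} (h : ∀ p ∈ l, p.driven k) :
    (choice l).driven k := by
  induction l with
  | nil => rfl
  | cons p l ih =>
    simp only [choice, driven, Bool.and_eq_true]
    exact ⟨h p (by simp), ih fun q hq => h q (by simp [hq])⟩

theorem mustPop_choice {l : List Program} {k : Stk} (h : ∀ p ∈ l, p.mustPop k) :
    (choice l).mustPop k := by
  induction l with
  | nil => rfl
  | cons p l ih =>
    simp only [choice, mustPop, Bool.and_eq_true]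
    exact ⟨h p (by simp), ih fun q hq => h q (by simp [hq])⟩

/-- Read a formula marked with `m`, and write it with the mark `m'`. -/
def moveP (m m' : Mark) : Program :=
  .seq (.pop .S (.inr m)) (.seq (.push .O (.inr m')) (formulaP true))

theorem tr_copy : Tr (formulaP true) Formula.word Formula.word := tr_formulaP true

theorem tr_skip : Tr (formulaP false) Formula.word fun _ => [] := tr_formulaP false

theorem itemTr_moveP (m m' : Mark) :
    ItemTr (moveP m m') fun i J => ∃ A, i = .fm m A ∧ J = {.fm m' A} := by
  refine .of_tr ((tr_copy.pushSeq (.inr m')).popSeq (.inr m))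
    (fun A => ⟨.fm m A, [.fm m' A], rfl, by simp [Item.word], A, rfl, rfl⟩) ?_
  rintro (⟨m, A⟩ | X) J ⟨A, h, rfl⟩
  · cases h; exact ⟨A, [.fm m' A], rfl, by simp [Item.word], rfl⟩
  · cases h

/-- Delete a formula marked with `m`. -/
def delP (m : Mark) : Program := .seq (.pop .S (.inr m)) (formulaP false)

theorem itemTr_delP (m : Mark) : ItemTr (delP m) fun i J => (∃ A, i = .fm m A) ∧ J = 0 := by
  refine .of_tr (tr_skip.popSeq (.inr m)) (fun A => ⟨.fm m A, [], rfl, rfl, ⟨A, rfl⟩, rfl⟩) ?_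
  rintro (⟨m, A⟩ | X) J ⟨⟨A, h⟩, rfl⟩
  · cases h; exact ⟨A, [], rfl, rfl, rfl⟩
  · cases h

def closeP : Program := .seq (.pop .S (.inl .blockClose)) (.push .O (.inl .blockClose))

/-- Copy a block. -/
def copyBlk : Program :=
  .seq (.pop .S (.inl .blockOpen)) <| .seq (.push .O (.inl .blockOpen)) <|
    .seq (.star (formulaP true)) closeP

theorem tr_closeP : Tr closeP (fun _ : Unit => [.inl .blockClose]) fun _ => [.inl .blockClose] :=
  (Tr.push _).popSeq _

theorem itemTr_copyBlk : ItemTr copyBlk fun i J => ∃ X, i = .blk X ∧ J = {.blk X} := by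
  refine .of_tr (((tr_copy.star.seq tr_closeP).pushSeq _).popSeq _)
    (fun t => ⟨.blk t.1, [.blk t.1], rfl, by simp [Item.word], t.1, rfl, rfl⟩) ?_
  rintro (⟨m, A⟩ | X) J ⟨Y, h, rfl⟩
  · cases h
  · cases h; exact ⟨(X, ()), [.blk X], rfl, by simp [Item.word], rfl⟩

/-- Replace a block by its formulas, marked with `m`. -/
def openBlk (m : Mark) : Program :=
  .seq (.pop .S (.inl .blockOpen)) <|
    .seq (.star (.seq (.push .O (.inr m)) (formulaP true))) (.pop .S (.inl .blockClose))

theorem words_map_fm (m : Mark) (X : List Formula) :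
    words (X.map (.fm m)) = X.flatMap fun A => .inr m :: A.word := by
  induction X with
  | nil => rfl
  | cons A X ih => simp [ih, Item.word]

theorem content_map_fm (m : Mark) (X : List Formula) :
    content (X.map (.fm m)) = (X : Multiset Formula).map (.fm m) := by
  simp [content, Item.abs, Function.comp_def]

theorem itemTr_openBlk (m : Mark) :
    ItemTr (openBlk m) fun i J => ∃ X, i = .blk X ∧ J = X.map (.fm m) := by
  refine .of_tr (((tr_copy.pushSeq (.inr m)).star.seq (Tr.pop _)).popSeq _)
    (fun t => ⟨.blk t.1, t.1.map (.fm m), rfl, by simp [words_map_fm],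
      t.1, rfl, content_map_fm m t.1⟩) ?_
  rintro (⟨m, A⟩ | X) J ⟨Y, h, rfl⟩
  · cases h
  · cases h; exact ⟨(X, ()), X.map (.fm m), rfl, by simp [words_map_fm], content_map_fm m X⟩

/-- Delete a block. -/
def delBlk : Program :=
  .seq (.pop .S (.inl .blockOpen)) (.seq (.star (formulaP false)) (.pop .S (.inl .blockClose)))

theorem itemTr_delBlk : ItemTr delBlk fun i J => (∃ X, i = .blk X) ∧ J = 0 := by
  refine .of_tr ((tr_skip.star.seq (Tr.pop _)).popSeq _)
    (fun t => ⟨.blk t.1, [], rfl, by simp, ⟨t.1, rfl⟩, rfl⟩) ?_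
  rintro (⟨m, A⟩ | X) J ⟨⟨Y, h⟩, rfl⟩
  · cases h
  · cases h; exact ⟨(X, ()), [], rfl, by simp, rfl⟩

/-- Replace a boxed formula of the antecedent by a block. -/
def boxP : Program :=
  .seq (.pop .S (.inr .L)) <| .seq (.pop .S (.inl .box)) <|
    .seq (.push .O (.inl .blockOpen)) <| .seq (formulaP true) (.push .O (.inl .blockClose))

theorem itemTr_boxP : ItemTr boxP fun i J => ∃ A, i = .fm .L (.box A) ∧ J = {.blk {A}} := by
  refine .of_tr ((((tr_copy.seq (Tr.push _)).pushSeq _).popSeq _).popSeq _)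
    (fun t => ⟨.fm .L (.box t.1), [.blk [t.1]], by simp [Item.word, Formula.word, Formula.encode],
      by simp [Item.word], t.1, rfl, rfl⟩) ?_
  rintro (⟨m, A⟩ | X) J ⟨B, h, rfl⟩
  · cases h
    exact ⟨(B, ()), [.blk [B]], by simp [Item.word, Formula.word, Formula.encode],
      by simp [Item.word], rfl⟩
  · cases h

/-- Replace a formula with the main connective `a` by its two immediate subformulas. -/
def binP (m : Mark) (a : Letter) (m₁ m₂ : Mark) : Program :=
  .seq (.pop .S (.inr m)) <| .seq (.pop .S (.inl a)) <| .seq (.push .O (.inr m₁)) <|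
    .seq (formulaP true) (.seq (.push .O (.inr m₂)) (formulaP true))

theorem itemTr_binP (m : Mark) {a : Letter} (m₁ m₂ : Mark) {F : Formula → Formula → Formula}
    (hF : ∀ A B, (F A B).word = .inl a :: (A.word ++ B.word)) :
    ItemTr (binP m a m₁ m₂) fun i J => ∃ A B, i = .fm m (F A B) ∧ J = {.fm m₁ A, .fm m₂ B} := by
  refine .of_tr ((((tr_copy.seq (tr_copy.pushSeq _)).pushSeq _).popSeq _).popSeq _)
    (fun t => ⟨.fm m (F t.1 t.2), [.fm m₁ t.1, .fm m₂ t.2], by simp [Item.word, hF],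
      by simp [Item.word], t.1, t.2, rfl, rfl⟩) ?_
  rintro (⟨m, A⟩ | X) J ⟨B, C, h, rfl⟩
  · cases h
    exact ⟨(B, C), [.fm m₁ B, .fm m₂ C], by simp [Item.word, hF], by simp [Item.word], rfl⟩
  · cases h

/-- Change the mark of a formula that consists of the letter `a`. -/
def leafP (m : Mark) (a : Letter) (m' : Mark) : Program :=
  .seq (.pop .S (.inr m)) <| .seq (.pop .S (.inl a)) <| .seq (.push .O (.inr m')) <|
    .push .O (.inl a)

theorem itemTr_leafP (m : Mark) {a : Letter} (m' : Mark) {F : Formula} (hF : F.word = [.inl a]) :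
    ItemTr (leafP m a m') fun i J => i = .fm m F ∧ J = {.fm m' F} := by
  refine .of_tr ((((Tr.push _).pushSeq _).popSeq _).popSeq _)
    (fun t => ⟨.fm m F, [.fm m' F], by simp [Item.word, hF], by simp [Item.word, hF], rfl, rfl⟩) ?_
  rintro (⟨m, A⟩ | X) J ⟨h, rfl⟩
  · cases h
    exact ⟨(), [.fm m' F], by simp [Item.word, hF], by simp [Item.word, hF], rfl⟩
  · cases h

/-- Change the mark of a variable. -/
def atomP (m m' : Mark) : Program :=
  .seq (.pop .S (.inr m)) <| .seq (.pop .S (.inl .var)) <| .seq (.push .O (.inr m')) <|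
    .seq (.push .O (.inl .var)) (bitsP true)

theorem itemTr_atomP (m m' : Mark) :
    ItemTr (atomP m m') fun i J => ∃ p, i = .fm m (.atom p) ∧ J = {.fm m' (.atom p)} := by
  have tr_bits : Tr (bitsP true) (fun i : ℕ => bitsWord i.bits) fun i => bitsWord i.bits :=
    tr_bitsP true
  refine .of_tr ((((tr_bits.pushSeq _).pushSeq _).popSeq _).popSeq _)
    (fun p => ⟨.fm m (.atom p), [.fm m' (.atom p)], by simp [Item.word, Formula.word_atom],
      by simp [Item.word, Formula.word_atom], p, rfl, rfl⟩) ?_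
  rintro (⟨m, A⟩ | X) J ⟨p, h, rfl⟩
  · cases h
    exact ⟨p, [.fm m' (.atom p)], by simp [Item.word, Formula.word_atom],
      by simp [Item.word, Formula.word_atom], rfl⟩
  · cases h

/-- Copy an item. -/
noncomputable def copyP : Program :=
  .alt copyBlk (choice (Finset.univ.toList.map fun m => moveP m m))

theorem ItemTr.choice {p : Mark → Program} {r : Mark → AItem → Multiset AItem → Prop}
    (hp : ∀ m, ItemTr (p m) (r m)) :
    ItemTr (choice (Finset.univ.toList.map p)) fun i J => ∃ m, r m i J := by
  constructor
  · intro x o c s' hs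
    obtain ⟨_, hq, h⟩ := rel_choice.1 hs
    obtain ⟨m, -, rfl⟩ := List.mem_map.1 hq
    obtain ⟨i, js, u, h1, h2, h3⟩ := (hp m).1 _ _ _ _ h
    exact ⟨i, js, u, h1, h2, m, h3⟩
  · rintro i J ⟨m, h⟩
    obtain ⟨js, h1, h2⟩ := (hp m).2 _ _ h
    exact ⟨js, h1, fun u o c => rel_choice.2 ⟨_, List.mem_map.2 ⟨m, by simp, rfl⟩, h2 u o c⟩⟩

theorem itemTr_copyP : ItemTr copyP fun i J => J = {i} := by
  refine (itemTr_copyBlk.alt (.choice fun m => itemTr_moveP m m)).congr fun i J => ?_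
  cases i <;> simp

/-! ### Rewriting sequents -/

/-- One item is rewritten. -/
def One (r : AItem → Multiset AItem → Prop) (I J : Multiset AItem) : Prop :=
  ∃ i c j, I = i ::ₘ c ∧ r i j ∧ J = j + c

/-- Every element is rewritten. -/
def All {α : Type} (r : α → Multiset AItem → Prop) (I : Multiset α) (J : Multiset AItem) : Prop :=
  ∃ K : Multiset (Multiset AItem), Multiset.Rel r I K ∧ J = K.join

/-- The program rewrites a part of the source. -/
def ListTr (p : Program) (ρ : Multiset AItem → Multiset AItem → Prop) : Prop :=
  (∀ x o c s', p.Rel (tape x o c) s' → ∃ (is js : List Item) (u : List Sym), x = words is ++ u ∧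
    s' = tape u ((words js).reverse ++ o) c ∧ ρ (content is) (content js)) ∧
  ∀ is J, ρ (content is) J → ∃ js, content js = J ∧
    ∀ u o c, p.Rel (tape (words is ++ u) o c) (tape u ((words js).reverse ++ o) c)

theorem All.zero_left {α : Type} {r : α → Multiset AItem → Prop} {J : Multiset AItem} :
    All r 0 J ↔ J = 0 := by
  simp [All, Multiset.rel_zero_left]

theorem All.cons_left {α : Type} {r : α → Multiset AItem → Prop} {i : α} {I : Multiset α}
    {J : Multiset AItem} :
    All r (i ::ₘ I) J ↔ ∃ j J', r i j ∧ All r I J' ∧ J = j + J' := by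
  constructor
  · rintro ⟨K, h, rfl⟩
    obtain ⟨j, K, h1, h2, rfl⟩ := Multiset.rel_cons_left.1 h
    exact ⟨j, K.join, h1, ⟨K, h2, rfl⟩, by simp⟩
  · rintro ⟨j, J', h1, ⟨K, h2, rfl⟩, rfl⟩
    exact ⟨j ::ₘ K, Multiset.rel_cons_left.2 ⟨j, K, h1, h2, rfl⟩, by simp⟩

theorem All.add_left {α : Type} {r : α → Multiset AItem → Prop} {I I' : Multiset α}
    {J : Multiset AItem} :
    All r (I + I') J ↔ ∃ J₁ J₂, All r I J₁ ∧ All r I' J₂ ∧ J = J₁ + J₂ := by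
  constructor
  · rintro ⟨K, h, rfl⟩
    obtain ⟨K₁, K₂, h1, h2, rfl⟩ := Multiset.rel_add_left.1 h
    exact ⟨_, _, ⟨K₁, h1, rfl⟩, ⟨K₂, h2, rfl⟩, by simp⟩
  · rintro ⟨J₁, J₂, ⟨K₁, h1, rfl⟩, ⟨K₂, h2, rfl⟩, rfl⟩
    exact ⟨K₁ + K₂, Multiset.rel_add_left.2 ⟨K₁, K₂, h1, h2, rfl⟩, by simp⟩

theorem ItemTr.star {p : Program} {r : AItem → Multiset AItem → Prop} (hp : ItemTr p r) :
    ListTr (.star p) (All r) := by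
  constructor
  · intro x o c s' h
    replace h : Relation.ReflTransGen p.Rel (tape x o c) s' := h
    induction h with
    | refl => exact ⟨[], [], x, by simp [All.zero_left]⟩
    | tail _ h ih =>
      obtain ⟨is, js, u, rfl, rfl, hr⟩ := ih
      obtain ⟨i, js', v, rfl, rfl, hr'⟩ := hp.1 _ _ _ _ h
      refine ⟨is ++ [i], js ++ js', v, by simp, by simp, ?_⟩
      rw [content_append, content_append]
      refine All.add_left.2 ⟨_, _, hr, ?_, rfl⟩
      exact All.cons_left.2 ⟨_, 0, hr', All.zero_left.2 rfl, by simp⟩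
  · intro is
    induction is with
    | nil =>
      intro J h
      exact ⟨[], (All.zero_left.1 h).symm, fun u o c => .refl⟩
    | cons i is ih =>
      intro J h
      rw [content_cons] at h
      obtain ⟨j, J', h1, h2, rfl⟩ := All.cons_left.1 h
      obtain ⟨js, rfl, h3⟩ := hp.2 _ _ h1
      obtain ⟨js', rfl, h4⟩ := ih _ h2
      refine ⟨js ++ js', by simp, fun u o c => .head
        (b := tape (words is ++ u) ((words js).reverse ++ o) c) ?_ ?_⟩
      · simpa using h3 (words is ++ u) o c
      · have : Relation.ReflTransGen p.Rel _ _ := h4 u ((words js).reverse ++ o) c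
        simpa using this

theorem All.map_left {α β : Type} {r : β → Multiset AItem → Prop} {f : α → β} {I : Multiset α}
    {J : Multiset AItem} : All r (I.map f) J ↔ All (fun a => r (f a)) I J := by
  simp [All, Multiset.rel_map_left]

theorem All.singleton_iff {α : Type} {f : α → AItem} {I : Multiset α} {J : Multiset AItem} :
    All (fun a J => J = {f a}) I J ↔ J = I.map f := by
  induction I using Multiset.induction generalizing J with
  | empty => exact All.zero_left
  | cons i I ih => simp [All.cons_left, ih]

theorem All.zero_iff {α : Type} {I : Multiset α} {J : Multiset AItem} :
    All (fun _ J => J = 0) I J ↔ J = 0 := by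
  induction I using Multiset.induction generalizing J with
  | empty => exact All.zero_left
  | cons i I ih => simp [All.cons_left, ih]

theorem All.false_iff {α : Type} {I : Multiset α} {J : Multiset AItem} :
    All (fun _ _ => False) I J ↔ I = 0 ∧ J = 0 := by
  induction I using Multiset.induction generalizing J with
  | empty => simp [All.zero_left]
  | cons i I ih => simp [All.cons_left]

theorem All.eq_of_copy {I J : Multiset AItem} : All (fun i J => J = {i}) I J ↔ J = I := by
  simpa using All.singleton_iff (f := id) (I := I) (J := J)

theorem content_eq_cons {is : List Item} {i : AItem} {c : Multiset AItem}
    (h : content is = i ::ₘ c) : ∃ l j l', is = l ++ j :: l' ∧ j.abs = i ∧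
      c = content l + content l' := by
  have hi : i ∈ content is := h ▸ Multiset.mem_cons_self i c
  obtain ⟨j, hj, rfl⟩ := List.mem_map.1 (show i ∈ is.map Item.abs from hi)
  obtain ⟨l, l', rfl⟩ := List.append_of_mem hj
  refine ⟨l, j, l', rfl, rfl, ?_⟩
  simpa using h.symm

/-- Rewrite one item. -/
noncomputable def oneP (p : Program) : Program := .seq (.star copyP) (.seq p (.star copyP))

/-- The place of the item is guessed: some items are copied, one is rewritten, the others are
copied. Requiring the whole source to be read is left to `pass`. -/
theorem ItemTr.oneP {p : Program} {r : AItem → Multiset AItem → Prop} (hp : ItemTr p r) :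
    ListTr (oneP p) (One r) := by
  have hc := itemTr_copyP.star
  constructor
  · rintro x o c s' ⟨s₁, h1, s₂, h2, h3⟩
    obtain ⟨is₁, js₁, u₁, rfl, rfl, h4⟩ := hc.1 _ _ _ _ h1
    obtain ⟨i, js, u, rfl, rfl, h5⟩ := hp.1 _ _ _ _ h2
    obtain ⟨is₃, js₃, u₃, rfl, rfl, h6⟩ := hc.1 _ _ _ _ h3
    refine ⟨is₁ ++ i :: is₃, js₁ ++ js ++ js₃, u₃, by simp, by simp, ?_⟩
    refine ⟨i.abs, content is₁ + content is₃, _, by simp, h5, ?_⟩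
    rw [content_append, content_append, All.eq_of_copy.1 h4, All.eq_of_copy.1 h6]
    abel
  · rintro is J ⟨i, c, j, h1, h2, rfl⟩
    obtain ⟨l, i, l', rfl, rfl, rfl⟩ := content_eq_cons h1
    obtain ⟨js, rfl, h5⟩ := hp.2 _ _ h2
    obtain ⟨js₁, h3, h3'⟩ := hc.2 l _ (All.eq_of_copy.2 rfl)
    obtain ⟨js₂, h4, h4'⟩ := hc.2 l' _ (All.eq_of_copy.2 rfl)
    refine ⟨js₁ ++ js ++ js₂, ?_, fun u o c =>
      ⟨_, ?_, _, h5 (words l' ++ u) ((words js₁).reverse ++ o) c, ?_⟩⟩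
    · rw [content_append, content_append, h3, h4]
      abel
    · simpa using h3' (i.word ++ (words l' ++ u)) o c
    · simpa using h4' u ((words js).reverse ++ ((words js₁).reverse ++ o)) c

/-- Move the output back to the source. -/
noncomputable def rewindP : Program :=
  .seq (.star (choice (Finset.univ.toList.map fun a => .seq (.pop .O a) (.push .S a)))) (.empty .O)

theorem rel_rewindP {x o c : List Sym} {s' : Stk → List Sym} :
    rewindP.Rel (tape x o c) s' ↔ s' = tape (o.reverse ++ x) [] c := by
  have hstep : ∀ x o c s', (choice (Finset.univ.toList.map fun a =>
      .seq (.pop .O a) (.push .S a))).Rel (tape x o c) s' ↔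
        ∃ a r, o = a :: r ∧ s' = tape (a :: x) r c := by
    intro x o c s'
    rw [rel_choice]
    constructor
    · rintro ⟨p, hp, h⟩
      obtain ⟨a, -, rfl⟩ := List.mem_map.1 hp
      obtain ⟨_, ⟨r, hr, rfl⟩, rfl⟩ := h
      exact ⟨a, r, hr, by simp⟩
    · rintro ⟨a, r, rfl, rfl⟩
      exact ⟨_, List.mem_map.2 ⟨a, by simp, rfl⟩, _, ⟨r, rfl, rfl⟩, by simp [Prog.Rel]⟩
  constructor
  · rintro ⟨s₁, h, h', rfl⟩
    replace h : Relation.ReflTransGen _ (tape x o c) s' := h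
    generalize hs : tape x o c = s at h
    induction h using Relation.ReflTransGen.head_induction_on generalizing x o with
    | refl => subst hs; simp at h'; simp [h']
    | head h _ ih =>
      subst hs
      obtain ⟨a, r, rfl, rfl⟩ := (hstep _ _ _ _).1 h
      simp [ih rfl]
  · rintro rfl
    refine ⟨_, ?_, rfl, rfl⟩
    show Relation.ReflTransGen _ _ _
    induction o generalizing x with
    | nil => exact .refl
    | cons a o ih => exact .head ((hstep _ _ _ _).2 ⟨a, o, rfl, rfl⟩) (by simpa using ih (x := _))

/-- Run `p`, which has to read the whole source, and move the output back to the source. -/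
noncomputable def pass (p : Program) : Program := .seq p (.seq (.empty .S) rewindP)

/-- The program rewrites the whole tape. -/
def Rewrites (p : Program) (ρ : Multiset AItem → Multiset AItem → Prop) : Prop :=
  (∀ is s', p.Rel (tape (words is) [] []) s' →
    ∃ js, s' = tape (words js) [] [] ∧ ρ (content is) (content js)) ∧
  ∀ is J, ρ (content is) J →
    ∃ js, content js = J ∧ p.Rel (tape (words is) [] []) (tape (words js) [] [])

theorem ListTr.pass {p : Program} {ρ : Multiset AItem → Multiset AItem → Prop} (h : ListTr p ρ) :
    Rewrites (pass p) ρ := by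
  constructor
  · rintro is s' ⟨s₁, h1, _, ⟨hS, rfl⟩, h2⟩
    obtain ⟨is', js, u, hx, rfl, hρ⟩ := h.1 _ _ _ _ h1
    obtain rfl : u = [] := hS
    rw [List.append_nil] at hx
    -- The program may have split the source in its own way; by unique readability that is the given
    -- way.
    rw [words_injective hx]
    exact ⟨js, by simpa using rel_rewindP.1 h2, hρ⟩
  · intro is J hJ
    obtain ⟨js, rfl, h1⟩ := h.2 is J hJ
    exact ⟨js, rfl, _, by simpa using h1 [] [] [], _, ⟨rfl, rfl⟩, rel_rewindP.2 (by simp)⟩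

theorem Rewrites.seq {p q : Program} {ρ σ : Multiset AItem → Multiset AItem → Prop}
    (hp : Rewrites p ρ) (hq : Rewrites q σ) :
    Rewrites (.seq p q) fun I J => ∃ K, ρ I K ∧ σ K J := by
  constructor
  · rintro is s' ⟨s₁, h1, h2⟩
    obtain ⟨ks, rfl, h3⟩ := hp.1 _ _ h1
    obtain ⟨js, rfl, h4⟩ := hq.1 _ _ h2
    exact ⟨js, rfl, _, h3, h4⟩
  · rintro is J ⟨K, h1, h2⟩
    obtain ⟨ks, rfl, h3⟩ := hp.2 _ _ h1
    obtain ⟨js, rfl, h4⟩ := hq.2 _ _ h2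
    exact ⟨js, rfl, _, h3, h4⟩

theorem Rewrites.alt {p q : Program} {ρ σ : Multiset AItem → Multiset AItem → Prop}
    (hp : Rewrites p ρ) (hq : Rewrites q σ) :
    Rewrites (.alt p q) fun I J => ρ I J ∨ σ I J := by
  constructor
  · rintro is s' (h | h)
    · obtain ⟨js, rfl, h'⟩ := hp.1 _ _ h
      exact ⟨js, rfl, .inl h'⟩
    · obtain ⟨js, rfl, h'⟩ := hq.1 _ _ h
      exact ⟨js, rfl, .inr h'⟩
  · rintro is J (h | h)
    · obtain ⟨js, rfl, h'⟩ := hp.2 _ _ h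
      exact ⟨js, rfl, .inl h'⟩
    · obtain ⟨js, rfl, h'⟩ := hq.2 _ _ h
      exact ⟨js, rfl, .inr h'⟩

theorem Rewrites.one : Rewrites .one fun I J => J = I :=
  ⟨fun is _ h => ⟨is, h, rfl⟩, fun is _ h => ⟨is, h.symm, rfl⟩⟩

theorem Rewrites.zero : Rewrites .zero fun _ _ => False :=
  ⟨fun _ _ h => h.elim, fun _ _ h => h.elim⟩

open Prog Function

/-! ### Passes over the tape -/

theorem One.add_left {r : AItem → Multiset AItem → Prop} {I I' J : Multiset AItem} :
    One r (I + I') J ↔ (∃ J', One r I J' ∧ J = J' + I') ∨ ∃ J', One r I' J' ∧ J = I + J' := by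
  constructor
  · rintro ⟨i, c, j, h, hr, rfl⟩
    have hi : i ∈ I + I' := h ▸ Multiset.mem_cons_self i c
    rcases Multiset.mem_add.1 hi with hi | hi
    · obtain ⟨I, rfl⟩ := Multiset.exists_cons_of_mem hi
      rw [Multiset.cons_add, Multiset.cons_inj_right] at h
      exact .inl ⟨_, ⟨i, I, j, rfl, hr, rfl⟩, by rw [← h, add_assoc]⟩
    · obtain ⟨I', rfl⟩ := Multiset.exists_cons_of_mem hi
      rw [Multiset.add_cons, Multiset.cons_inj_right] at h
      exact .inr ⟨_, ⟨i, I', j, rfl, hr, rfl⟩, by rw [← h]; abel⟩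
  · rintro (⟨_, ⟨i, c, j, rfl, hr, rfl⟩, rfl⟩ | ⟨_, ⟨i, c, j, rfl, hr, rfl⟩, rfl⟩)
    · exact ⟨i, c + I', j, by simp, hr, by abel⟩
    · exact ⟨i, I + c, j, by simp, hr, by abel⟩

open Classical in
theorem One.map_left {α : Type} {r : AItem → Multiset AItem → Prop} {f : α → AItem}
    {X : Multiset α} {J : Multiset AItem} :
    One r (X.map f) J ↔ ∃ a Y j, X = a ::ₘ Y ∧ r (f a) j ∧ J = j + Y.map f := by
  constructor
  · rintro ⟨i, c, j, h, hr, rfl⟩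
    obtain ⟨a, ha, rfl, rfl⟩ := (Multiset.map_eq_cons f X c i).2 h
    exact ⟨a, _, j, (Multiset.cons_erase ha).symm, hr, rfl⟩
  · rintro ⟨a, Y, j, rfl, hr, rfl⟩
    exact ⟨f a, Y.map f, j, by simp, hr, rfl⟩

theorem One.singleton_left {r : AItem → Multiset AItem → Prop} {i : AItem} {J : Multiset AItem} :
    One r {i} J ↔ r i J := by
  simpa [and_assoc, Multiset.singleton_eq_cons_iff] using
    One.map_left (r := r) (f := id) (X := {i}) (J := J)

theorem One.cons_left {r : AItem → Multiset AItem → Prop} {i : AItem} {I J : Multiset AItem} :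
    One r (i ::ₘ I) J ↔ (∃ j, r i j ∧ J = j + I) ∨ ∃ J', One r I J' ∧ J = i ::ₘ J' := by
  rw [← Multiset.singleton_add, One.add_left]
  simp [One.singleton_left]

/-- What is done with a formula: nothing is possible, it is deleted, or it gets a new mark. -/
abbrev Action := Option (Option Mark)

def Action.rel : Action → Formula → Multiset AItem → Prop
  | none => fun _ _ => False
  | some none => fun _ J => J = 0
  | some (some m) => fun A J => J = {.fm m A}

def Action.prog (m : Mark) : Action → Program
  | none => .zero
  | some none => delP m
  | some (some m') => moveP m m'

/-- Rewrite formulas according to `φ`, and blocks according to `β`. -/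
def itemRel (φ : Mark → Action) (β : Multiset Formula → Multiset AItem → Prop) :
    AItem → Multiset AItem → Prop
  | .fm m A => (φ m).rel A
  | .blk X => β X

/-- The program acts on blocks. -/
def BlockTr (p : Program) (β : Multiset Formula → Multiset AItem → Prop) : Prop :=
  ItemTr p (fun i J => ∃ X, i = .blk X ∧ β X J) ∧ p.driven .S ∧ p.mustPop .S

/-- A pass over the tape that rewrites one item. -/
noncomputable def onePass (p : Program) : Program := pass (oneP p)

/-- A pass over the tape that rewrites all items. -/
noncomputable def allPass (φ : Mark → Action) (p : Program) : Program :=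
  pass (.star (.alt (choice (Finset.univ.toList.map fun m => (φ m).prog m)) p))

/-- No single stack drives a pass: the source drives the rewriting and the output drives the way
back. Hence `PTime`, which composes. -/
theorem ptime_pass {p : Program} (hp : p.driven .S) : PTime (pass p) :=
  (PTime.driven hp).seq <| (PTime.driven (k := .S) rfl).seq <| PTime.driven (k := .O) <| by
    simp only [rewindP, driven, Bool.and_eq_true, and_true]
    exact ⟨driven_choice (by rintro p hp; obtain ⟨a, -, rfl⟩ := List.mem_map.1 hp; rfl),
      mustPop_choice (by rintro p hp; obtain ⟨a, -, rfl⟩ := List.mem_map.1 hp; rfl)⟩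

theorem driven_moveP (m m' : Mark) : (moveP m m').driven .S ∧ (moveP m m').mustPop .S :=
  ⟨rfl, rfl⟩

theorem driven_copyP : copyP.driven .S ∧ copyP.mustPop .S := by
  simp only [copyP, driven, mustPop, Bool.and_eq_true]
  exact ⟨⟨rfl, driven_choice (by simp [driven_moveP])⟩, rfl, mustPop_choice (by simp [driven_moveP])⟩

theorem rewrites_onePass {p : Program} {r : AItem → Multiset AItem → Prop} (hp : ItemTr p r) :
    Rewrites (onePass p) (One r) := hp.oneP.pass

theorem ptime_onePass {p : Program} (hp : p.driven .S) : PTime (onePass p) :=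
  ptime_pass (by simp [oneP, driven, driven_copyP, hp])

theorem itemTr_prog (m : Mark) (a : Action) :
    ItemTr (a.prog m) fun i J => ∃ A, i = .fm m A ∧ a.rel A J := by
  rcases a with _ | _ | m'
  · exact ItemTr.zero.congr (by simp [Action.rel])
  · exact (itemTr_delP m).congr (by simp [Action.rel])
  · exact itemTr_moveP m m'

theorem rewrites_allPass (φ : Mark → Action) {p : Program}
    {β : Multiset Formula → Multiset AItem → Prop} (hp : BlockTr p β) :
    Rewrites (allPass φ p) (All (itemRel φ β)) := by
  refine ItemTr.star (((ItemTr.choice fun m => itemTr_prog m (φ m)).alt hp.1).congr ?_) |>.pass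
  rintro (⟨m, A⟩ | X) J <;> simp [itemRel]

theorem ptime_allPass (φ : Mark → Action) {p : Program}
    {β : Multiset Formula → Multiset AItem → Prop} (hp : BlockTr p β) :
    PTime (allPass φ p) := by
  refine ptime_pass ?_
  simp only [driven, mustPop, Bool.and_eq_true]
  have : ∀ m (a : Action), (a.prog m).driven .S ∧ (a.prog m).mustPop .S := by
    rintro m (_ | _ | m') <;> exact ⟨rfl, rfl⟩
  exact ⟨⟨driven_choice (by simp [this]), hp.2.1⟩, mustPop_choice (by simp [this]), hp.2.2⟩

theorem blockTr_copy : BlockTr copyBlk fun X J => J = {.blk X} := ⟨itemTr_copyBlk, rfl, rfl⟩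

theorem blockTr_del : BlockTr delBlk fun _ J => J = 0 :=
  ⟨itemTr_delBlk.congr (by simp), rfl, rfl⟩

theorem blockTr_open (m : Mark) : BlockTr (openBlk m) fun X J => J = X.map (.fm m) :=
  ⟨itemTr_openBlk m, rfl, rfl⟩

theorem blockTr_zero : BlockTr .zero fun _ _ => False :=
  ⟨ItemTr.zero.congr (by simp), rfl, rfl⟩

theorem BlockTr.alt {p q : Program} {β γ : Multiset Formula → Multiset AItem → Prop}
    (hp : BlockTr p β) (hq : BlockTr q γ) : BlockTr (.alt p q) fun X J => β X J ∨ γ X J :=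
  ⟨(hp.1.alt hq.1).congr fun i J => by simp [and_or_left, exists_or],
    by simp [driven, hp.2.1, hq.2.1], by simp [mustPop, hp.2.2, hq.2.2]⟩

/-! ### The replies of the universal player -/

/-- The items of a sequent. -/
def enc (S : Sequent) : Multiset AItem :=
  S.form.map (.fm .L) + S.blocks.map .blk + S.succ.map (.fm .R)

/-- The new marks when the universal player chooses the main premiss. -/
def mainMark : Mark → Action
  | .L | .a | .b | .c | .d => some (some .L)
  | .R | .r => some (some .R)
  | _ => none

/-- The new marks when an active formula of a propositional rule has been chosen. -/
def propMark : Mark → Action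
  | .L => some (some .L)
  | .R => some (some .R)
  | .gL | .gR => some none
  | _ => none

/-- The new marks when formulas of the active blocks have been chosen. -/
def sideMark : Mark → Action
  | .b | .c | .d => some none
  | .R => some (some .R)
  | .r => some (some .L)
  | _ => none

/-- The four kinds of replies: the main premiss, one active formula of a propositional rule, a side
premiss with one formula, and a side premiss with two. Which of them exist is controlled by the
marks that the guess has left, because an item without an action blocks the pass. -/
noncomputable def replyP : Program :=
  .alt (allPass mainMark copyBlk) <|
  .alt (.seq (onePass (.alt (moveP .gL .L) (moveP .gR .R))) (allPass propMark copyBlk)) <|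
  .alt (.seq (onePass (moveP .b .R)) (allPass sideMark .zero)) <|
  .seq (onePass (moveP .c .R)) (.seq (onePass (moveP .d .R)) (allPass sideMark .zero))

def Reply (J K : Multiset AItem) : Prop :=
  All (itemRel mainMark fun X J => J = {.blk X}) J K ∨
  (∃ I, One (fun i J => (∃ A, i = .fm .gL A ∧ J = {.fm .L A}) ∨ ∃ A, i = .fm .gR A ∧ J = {.fm .R A})
    J I ∧ All (itemRel propMark fun X J => J = {.blk X}) I K) ∨
  (∃ I, One (fun i J => ∃ A, i = .fm .b A ∧ J = {.fm .R A}) J I ∧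
    All (itemRel sideMark fun _ _ => False) I K) ∨
  ∃ I, One (fun i J => ∃ A, i = .fm .c A ∧ J = {.fm .R A}) J I ∧
    ∃ I', One (fun i J => ∃ A, i = .fm .d A ∧ J = {.fm .R A}) I I' ∧
      All (itemRel sideMark fun _ _ => False) I' K

theorem rewrites_replyP : Rewrites replyP Reply :=
  (rewrites_allPass _ blockTr_copy).alt <|
  ((rewrites_onePass ((itemTr_moveP _ _).alt (itemTr_moveP _ _))).seq
    (rewrites_allPass _ blockTr_copy)).alt <|
  ((rewrites_onePass (itemTr_moveP _ _)).seq (rewrites_allPass _ blockTr_zero)).alt <|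
  (rewrites_onePass (itemTr_moveP _ _)).seq <|
  (rewrites_onePass (itemTr_moveP _ _)).seq (rewrites_allPass _ blockTr_zero)

theorem ptime_replyP : PTime replyP :=
  (ptime_allPass _ blockTr_copy).alt <|
  ((ptime_onePass rfl).seq (ptime_allPass _ blockTr_copy)).alt <|
  ((ptime_onePass rfl).seq (ptime_allPass _ blockTr_zero)).alt <|
  (ptime_onePass rfl).seq <| (ptime_onePass rfl).seq (ptime_allPass _ blockTr_zero)

/-- The replies to `J` are the sequents in `Ss`. -/
def Replies (J : Multiset AItem) (Ss : Set Sequent) : Prop := ∀ K, Reply J K ↔ ∃ T ∈ Ss, K = enc T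

/-- For a rule with one premiss in the same component, the guess already writes that premiss, and
the reply is forced. -/
theorem replies_enc (S : Sequent) : Replies (enc S) {S} := by
  intro K
  simp [Reply, enc, All.add_left, All.map_left, itemRel, mainMark, Action.rel, All.singleton_iff,
    One.add_left, One.map_left]

/-- The universal player keeps one active formula and the others are deleted. Any active formula
blocks the main reply; without one, `S` itself would be a reply. -/
theorem replies_active (Γ' Δ' : Multiset Formula) (S : Sequent) (h : Γ' + Δ' ≠ 0) :
    Replies (Γ'.map (.fm .gL) + Δ'.map (.fm .gR) + enc S)
      {T | (∃ A ∈ Γ', T = ⟨A ::ₘ S.form, S.blocks, S.succ⟩) ∨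
        ∃ A ∈ Δ', T = ⟨S.form, S.blocks, A ::ₘ S.succ⟩} := by
  intro K
  have h' : ¬ (Γ' = 0 ∧ Δ' = 0) := fun h' => h (by simp [h'])
  simp [Reply, enc, All.add_left, All.map_left, itemRel, mainMark, propMark, Action.rel,
    All.singleton_iff, All.false_iff, One.add_left, One.map_left, h']
  constructor
  · rintro ⟨J', ⟨A, Γ', rfl, rfl⟩ | ⟨A, Δ', rfl, rfl⟩, J₁, h1, rfl⟩
    · simp [All.cons_left, All.add_left, All.map_left, itemRel, propMark, Action.rel,
        All.zero_iff] at h1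
      exact ⟨_, .inl ⟨A, by simp, rfl⟩, by simp [h1]⟩
    · simp [All.cons_left, All.add_left, All.map_left, itemRel, propMark, Action.rel,
        All.zero_iff] at h1
      exact ⟨_, .inr ⟨A, by simp, rfl⟩, by simp [h1]⟩
  · rintro ⟨T, ⟨A, hA, rfl⟩ | ⟨A, hA, rfl⟩, rfl⟩
    · obtain ⟨Y, rfl⟩ := Multiset.exists_cons_of_mem hA
      exact ⟨_, .inl ⟨A, Y, rfl, rfl⟩, {AItem.fm .L A}, by simp [All.cons_left, All.add_left,
        All.map_left, itemRel, propMark, Action.rel, All.zero_iff], by simp⟩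
    · obtain ⟨Y, rfl⟩ := Multiset.exists_cons_of_mem hA
      exact ⟨_, .inr ⟨A, Y, rfl, rfl⟩, {AItem.fm .R A}, by simp [All.cons_left, All.add_left,
        All.map_left, itemRel, propMark, Action.rel, All.zero_iff], by simp⟩

/-- All modal rules at once: the mark `a` forbids side premisses, `b` asks for one with each
formula, `c` and `d` for one with each pair, and `r` marks the formula under the box of the
succedent. -/
theorem replies_modal (X Y Z W V : Multiset Formula) :
    Replies (X.map (.fm .a) + Y.map (.fm .b) + Z.map (.fm .c) + W.map (.fm .d) + V.map (.fm .r))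
      {T | T = ⟨X + Y + Z + W, 0, V⟩ ∨ (X = 0 ∧ ∃ A ∈ Y, T = ⟨V, 0, {A}⟩) ∨
        (X = 0 ∧ ∃ A ∈ Z, ∃ B ∈ W, T = ⟨V, 0, {A, B}⟩)} := by
  intro K
  simp [Reply, enc, All.add_left, All.map_left, itemRel, mainMark, sideMark, Action.rel,
    All.singleton_iff, One.add_left, One.map_left, One.cons_left, All.cons_left, All.false_iff,
    All.zero_iff]
  have hmem : ∀ (A : Formula) (X : Multiset Formula), (∃ Y, X = A ::ₘ Y) ↔ A ∈ X := fun A X =>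
    ⟨by rintro ⟨Y, rfl⟩; simp, Multiset.exists_cons_of_mem⟩
  simp only [hmem]
  refine or_congr_right ⟨?_, ?_⟩
  · rintro (⟨A, hA, rfl, rfl⟩ | ⟨A, hA, B, hB, rfl, rfl⟩)
    · exact ⟨_, .inl ⟨rfl, A, hA, rfl⟩, by simp [add_comm _ {AItem.fm .R A}]⟩
    · refine ⟨_, .inr ⟨rfl, A, hA, B, hB, rfl⟩, ?_⟩
      simp only [Multiset.map_zero, add_zero, Multiset.map_cons, Multiset.map_singleton]
      rw [Multiset.cons_swap, add_comm, Multiset.cons_add, Multiset.singleton_add]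
  · rintro ⟨T, ⟨rfl, A, hA, rfl⟩ | ⟨rfl, A, hA, B, hB, rfl⟩, rfl⟩
    · exact .inl ⟨A, hA, rfl, by simp [add_comm _ {AItem.fm .R A}]⟩
    · refine .inr ⟨A, hA, B, hB, rfl, ?_⟩
      simp only [Multiset.map_zero, add_zero, Multiset.map_cons, Multiset.map_singleton]
      rw [Multiset.cons_swap, add_comm, Multiset.cons_add, Multiset.singleton_add]

/-- The mark `w` has no action, so the universal player is stuck and loses. This represents rules
without premisses. -/
theorem replies_won {A : Formula} {J : Multiset AItem} (h : .fm .w A ∈ J) : Replies J ∅ := by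
  obtain ⟨J, rfl⟩ := Multiset.exists_cons_of_mem h
  intro K
  simp [Reply, One.cons_left, All.cons_left, itemRel, mainMark, propMark, sideMark, Action.rel]

open Prog Function

/-! ### The guesses of the existential player -/

/-- The program guesses the applications of the rules `Q`. -/
def Guesses (p : Program) (Q : Sequent → Set Sequent → Prop) : Prop :=
  PTime p ∧ ∃ σ, Rewrites p σ ∧ (∀ S J, σ (enc S) J → ∃ Ss, Q S Ss ∧ Replies J Ss) ∧
    ∀ S Ss, Q S Ss → ∃ J, σ (enc S) J ∧ Replies J Ss

theorem Guesses.alt {p q : Program} {Q R : Sequent → Set Sequent → Prop} (hp : Guesses p Q)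
    (hq : Guesses q R) : Guesses (.alt p q) fun S Ss => Q S Ss ∨ R S Ss := by
  obtain ⟨hp, σ, h1, h2, h3⟩ := hp
  obtain ⟨hq, τ, h4, h5, h6⟩ := hq
  refine ⟨hp.alt hq, _, h1.alt h4, ?_, ?_⟩
  · rintro S J (h | h)
    · obtain ⟨Ss, h7, h8⟩ := h2 S J h
      exact ⟨Ss, .inl h7, h8⟩
    · obtain ⟨Ss, h7, h8⟩ := h5 S J h
      exact ⟨Ss, .inr h7, h8⟩
  · rintro S Ss (h | h)
    · obtain ⟨J, h7, h8⟩ := h3 S Ss h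
      exact ⟨J, .inl h7, h8⟩
    · obtain ⟨J, h7, h8⟩ := h6 S Ss h
      exact ⟨J, .inr h7, h8⟩

theorem Guesses.of_forall_not {Q : Sequent → Set Sequent → Prop} (h : ∀ S Ss, ¬ Q S Ss) :
    Guesses .zero Q :=
  ⟨PTime.driven (k := .S) rfl, _, Rewrites.zero, fun _ _ h => h.elim, fun S Ss h' => (h S Ss h').elim⟩

section enc

variable {Γ Δ : Multiset Formula} {Θ : Multiset (Multiset Formula)} {J K : Multiset AItem}

theorem one_enc_L {ρ : Formula → Multiset AItem → Prop} :
    One (fun i j => ∃ A, i = .fm .L A ∧ ρ A j) (enc ⟨Γ, Θ, Δ⟩) J ↔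
      ∃ A Γ' j, Γ = A ::ₘ Γ' ∧ ρ A j ∧ J = j + enc ⟨Γ', Θ, Δ⟩ := by
  simp [enc, One.add_left, One.map_left, add_assoc, and_assoc]

theorem one_enc_R {ρ : Formula → Multiset AItem → Prop} :
    One (fun i j => ∃ A, i = .fm .R A ∧ ρ A j) (enc ⟨Γ, Θ, Δ⟩) J ↔
      ∃ A Δ' j, Δ = A ::ₘ Δ' ∧ ρ A j ∧ J = j + enc ⟨Γ, Θ, Δ'⟩ := by
  simp [enc, One.add_left, One.map_left, add_left_comm, and_assoc]

theorem one_enc_blk {ρ : Multiset Formula → Multiset AItem → Prop} :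
    One (fun i j => ∃ X, i = .blk X ∧ ρ X j) (enc ⟨Γ, Θ, Δ⟩) J ↔
      ∃ X Θ' j, Θ = X ::ₘ Θ' ∧ ρ X j ∧ J = j + enc ⟨Γ, Θ', Δ⟩ := by
  simp [enc, One.add_left, One.map_left, add_left_comm, add_assoc, and_assoc]

/-- The marks of the active formulas of a modal rule are kept, and other formulas deleted. -/
def keepMark : Mark → Action
  | .L | .R => some none
  | .a => some (some .a)
  | .b => some (some .b)
  | .c => some (some .c)
  | .d => some (some .d)
  | .r => some (some .r)
  | _ => none

/-- A block is deleted or, if `c` holds, opened with one of two marks. -/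
def openRel (c : Bool) (m m' : Mark) (X : Multiset Formula) (J : Multiset AItem) : Prop :=
  J = 0 ∨ if c then J = X.map (.fm m) ∨ J = X.map (.fm m') else False

def openP (c : Bool) (m m' : Mark) : Program :=
  .alt delBlk (if c then .alt (openBlk m) (openBlk m') else .zero)

theorem blockTr_openP (c : Bool) (m m' : Mark) : BlockTr (openP c m m') (openRel c m m') := by
  refine blockTr_del.alt ?_
  cases c
  · exact blockTr_zero
  · exact (blockTr_open m).alt (blockTr_open m')

/-- The choice is made for each block separately, so groups of unbounded size are guessed in one
pass. -/
theorem all_openRel {c : Bool} {m m' : Mark} :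
    All (openRel c m m') Θ J ↔ ∃ U V Θ', Θ = U + V + Θ' ∧ (c = true ∨ U = 0 ∧ V = 0) ∧
      J = U.join.map (.fm m) + V.join.map (.fm m') := by
  induction Θ using Multiset.induction generalizing J with
  | empty =>
    rw [All.zero_left]
    constructor
    · rintro rfl
      exact ⟨0, 0, 0, by simp⟩
    · rintro ⟨U, V, Θ', h, -, rfl⟩
      obtain ⟨⟨rfl, rfl⟩, rfl⟩ : (U = 0 ∧ V = 0) ∧ Θ' = 0 := by simpa [eq_comm] using h
      simp
  | cons X Θ ih =>
    simp only [All.cons_left, ih]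
    constructor
    · rintro ⟨j, J', hj, ⟨U, V, Θ', rfl, hC, rfl⟩, rfl⟩
      rcases hj with rfl | hj
      · exact ⟨U, V, X ::ₘ Θ', by simp, hC, by simp⟩
      · by_cases hC' : c = true
        · rw [if_pos hC'] at hj
          rcases hj with rfl | rfl
          · exact ⟨X ::ₘ U, V, Θ', by simp, .inl hC', by simp [add_assoc]⟩
          · exact ⟨U, X ::ₘ V, Θ', by simp, .inl hC', by simp [add_left_comm]⟩
        · rw [if_neg hC'] at hj
          exact hj.elim
    · rintro ⟨U, V, Θ', h, hC, rfl⟩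
      have hX : X ∈ U + V + Θ' := h ▸ Multiset.mem_cons_self X Θ
      rcases Multiset.mem_add.1 hX with hX | hX
      · rcases Multiset.mem_add.1 hX with hX | hX
        · obtain ⟨U, rfl⟩ := Multiset.exists_cons_of_mem hX
          have hC' : c = true := hC.resolve_right (by simp)
          exact ⟨_, _, .inr (by rw [if_pos hC']; exact .inl rfl), ⟨U, V, Θ',
            by simpa using h, .inl hC', rfl⟩, by simp [add_assoc]⟩
        · obtain ⟨V, rfl⟩ := Multiset.exists_cons_of_mem hX
          have hC' : c = true := hC.resolve_right (by simp)
          exact ⟨_, _, .inr (by rw [if_pos hC']; exact .inr rfl), ⟨U, V, Θ',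
            by simpa using h, .inl hC', rfl⟩, by simp [add_left_comm]⟩
      · obtain ⟨Θ', rfl⟩ := Multiset.exists_cons_of_mem hX
        exact ⟨0, _, .inl rfl, ⟨U, V, Θ', by simpa using h, hC, rfl⟩, by simp⟩

theorem all_keep_enc {β : Multiset Formula → Multiset AItem → Prop} :
    All (itemRel keepMark β) (enc ⟨Γ, Θ, Δ⟩) J ↔ All β Θ J := by
  simp [enc, All.add_left, All.map_left, itemRel, keepMark, Action.rel, All.zero_iff]

end enc

/-- The common pattern of the rules with one principal formula: rewrite it in one pass, and let the
marks in `out` determine the replies. -/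
theorem guesses_L {p : Program} {τ : Type} {F : τ → Formula} {out : τ → Multiset AItem}
    (hp : ItemTr p fun i j => ∃ t, i = .fm .L (F t) ∧ j = out t) (hd : p.driven .S)
    {prem : τ → Sequent → Set Sequent} (hr : ∀ t S, Replies (out t + enc S) (prem t S)) :
    ∃ p, Guesses p fun S Ss => ∃ t Γ Θ Δ, S = ⟨F t ::ₘ Γ, Θ, Δ⟩ ∧ Ss = prem t ⟨Γ, Θ, Δ⟩ := by
  have hp' : ItemTr p fun i j => ∃ A, i = .fm .L A ∧ ∃ t, A = F t ∧ j = out t :=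
    hp.congr fun i j => ⟨by rintro ⟨t, rfl, rfl⟩; exact ⟨_, rfl, t, rfl, rfl⟩,
      by rintro ⟨_, rfl, t, rfl, rfl⟩; exact ⟨t, rfl, rfl⟩⟩
  refine ⟨_, ptime_onePass hd, _, rewrites_onePass hp', ?_, ?_⟩
  · rintro ⟨Γ, Θ, Δ⟩ J h
    obtain ⟨_, Γ, j, rfl, ⟨t, rfl, rfl⟩, rfl⟩ := one_enc_L.1 h
    exact ⟨_, ⟨t, Γ, Θ, Δ, rfl, rfl⟩, hr t _⟩
  · rintro S Ss ⟨t, Γ, Θ, Δ, rfl, rfl⟩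
    exact ⟨_, one_enc_L.2 ⟨_, Γ, _, rfl, ⟨t, rfl, rfl⟩, rfl⟩, hr t _⟩

theorem guesses_R {p : Program} {τ : Type} {F : τ → Formula} {out : τ → Multiset AItem}
    (hp : ItemTr p fun i j => ∃ t, i = .fm .R (F t) ∧ j = out t) (hd : p.driven .S)
    {prem : τ → Sequent → Set Sequent} (hr : ∀ t S, Replies (out t + enc S) (prem t S)) :
    ∃ p, Guesses p fun S Ss => ∃ t Γ Θ Δ, S = ⟨Γ, Θ, F t ::ₘ Δ⟩ ∧ Ss = prem t ⟨Γ, Θ, Δ⟩ := by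
  have hp' : ItemTr p fun i j => ∃ A, i = .fm .R A ∧ ∃ t, A = F t ∧ j = out t :=
    hp.congr fun i j => ⟨by rintro ⟨t, rfl, rfl⟩; exact ⟨_, rfl, t, rfl, rfl⟩,
      by rintro ⟨_, rfl, t, rfl, rfl⟩; exact ⟨t, rfl, rfl⟩⟩
  refine ⟨_, ptime_onePass hd, _, rewrites_onePass hp', ?_, ?_⟩
  · rintro ⟨Γ, Θ, Δ⟩ J h
    obtain ⟨_, Δ, j, rfl, ⟨t, rfl, rfl⟩, rfl⟩ := one_enc_R.1 h
    exact ⟨_, ⟨t, Γ, Θ, Δ, rfl, rfl⟩, hr t _⟩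
  · rintro S Ss ⟨t, Γ, Θ, Δ, rfl, rfl⟩
    exact ⟨_, one_enc_R.2 ⟨_, Δ, _, rfl, ⟨t, rfl, rfl⟩, rfl⟩, hr t _⟩

theorem guesses_t (L : Logic) : ∃ p, Guesses p fun S Ss => ∃ X Γ Θ Δ, L.T = true ∧
    S = ⟨Γ, X ::ₘ Θ, Δ⟩ ∧ Ss = {⟨X + Γ, Θ, Δ⟩} := by
  by_cases hT : L.T = true
  · have hr : ∀ (X Γ Δ : Multiset Formula) Θ,
        Replies (X.map (.fm .L) + enc ⟨Γ, Θ, Δ⟩) {⟨X + Γ, Θ, Δ⟩} := by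
      intro X Γ Δ Θ
      have h := replies_enc ⟨X + Γ, Θ, Δ⟩
      simpa [enc, add_assoc] using h
    refine ⟨_, ptime_onePass rfl, _, rewrites_onePass (itemTr_openBlk .L), ?_, ?_⟩
    · rintro ⟨Γ, Θ, Δ⟩ J h
      obtain ⟨X, Θ, j, rfl, rfl, rfl⟩ := one_enc_blk.1 h
      exact ⟨_, ⟨X, Γ, Θ, Δ, hT, rfl, rfl⟩, hr _ _ _ _⟩
    · rintro S Ss ⟨X, Γ, Θ, Δ, -, rfl, rfl⟩
      exact ⟨_, one_enc_blk.2 ⟨_, Θ, _, rfl, rfl, rfl⟩, hr _ _ _ _⟩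
  · exact ⟨_, .of_forall_not fun S Ss => by simp [hT]⟩

/-! ### Replies to the propositional rules -/

theorem itemTr_bin (m : Mark) {a : Letter} (m₁ m₂ : Mark) {F : Formula → Formula → Formula}
    (hF : ∀ A B, (F A B).word = .inl a :: (A.word ++ B.word)) :
    ItemTr (binP m a m₁ m₂) fun i J => ∃ t : Formula × Formula, i = .fm m (F t.1 t.2) ∧
      J = {.fm m₁ t.1, .fm m₂ t.2} :=
  (itemTr_binP m m₁ m₂ hF).congr fun i J => by simp

theorem word_and (A B : Formula) : (Formula.and A B).word = .inl .and :: (A.word ++ B.word) := by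
  simp [Formula.word, Formula.encode]

theorem word_or (A B : Formula) : (Formula.or A B).word = .inl .or :: (A.word ++ B.word) := by
  simp [Formula.word, Formula.encode]

theorem word_imp (A B : Formula) : (Formula.imp A B).word = .inl .imp :: (A.word ++ B.word) := by
  simp [Formula.word, Formula.encode]

theorem replies_LL (A B : Formula) (S : Sequent) :
    Replies ({.fm .L A, .fm .L B} + enc S) {⟨A ::ₘ B ::ₘ S.form, S.blocks, S.succ⟩} := by
  simpa [enc] using replies_enc ⟨A ::ₘ B ::ₘ S.form, S.blocks, S.succ⟩

theorem replies_LR (A B : Formula) (S : Sequent) :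
    Replies ({.fm .L A, .fm .R B} + enc S) {⟨A ::ₘ S.form, S.blocks, B ::ₘ S.succ⟩} := by
  rw [Multiset.pair_comm]
  simpa [enc] using replies_enc ⟨A ::ₘ S.form, S.blocks, B ::ₘ S.succ⟩

theorem replies_RR (A B : Formula) (S : Sequent) :
    Replies ({.fm .R A, .fm .R B} + enc S) {⟨S.form, S.blocks, A ::ₘ B ::ₘ S.succ⟩} := by
  simpa [enc] using replies_enc ⟨S.form, S.blocks, A ::ₘ B ::ₘ S.succ⟩

theorem replies_gLgL (A B : Formula) (S : Sequent) :
    Replies ({.fm .gL A, .fm .gL B} + enc S)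
      {⟨A ::ₘ S.form, S.blocks, S.succ⟩, ⟨B ::ₘ S.form, S.blocks, S.succ⟩} := by
  have h := replies_active {A, B} 0 S (by simp)
  convert h using 1
  · simp
  · ext; simp

theorem replies_gRgR (A B : Formula) (S : Sequent) :
    Replies ({.fm .gR A, .fm .gR B} + enc S)
      {⟨S.form, S.blocks, A ::ₘ S.succ⟩, ⟨S.form, S.blocks, B ::ₘ S.succ⟩} := by
  have h := replies_active 0 {A, B} S (by simp)
  convert h using 1
  · simp
  · ext; simp

theorem replies_gRgL (A B : Formula) (S : Sequent) :
    Replies ({.fm .gR A, .fm .gL B} + enc S)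
      {⟨S.form, S.blocks, A ::ₘ S.succ⟩, ⟨B ::ₘ S.form, S.blocks, S.succ⟩} := by
  have h := replies_active {B} {A} S (by simp)
  convert h using 1
  · rw [Multiset.pair_comm]; simp
  · ext; simp [or_comm]

open Prog Function

/-! ### Guesses of modal rules -/

section modal

variable {Γ Δ : Multiset Formula} {Θ : Multiset (Multiset Formula)} {J : Multiset AItem}

def openOne (m : Mark) (i : AItem) (J : Multiset AItem) : Prop :=
  ∃ X, i = .blk X ∧ J = X.map (.fm m)

/-- Open at least one block, and with `c` possibly several, and delete everything else. -/
noncomputable def mergeP (c : Bool) (m : Mark) : Program :=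
  .seq (onePass (openBlk m)) (allPass keepMark (openP c m m))

def mergeRel (c : Bool) (m : Mark) (I J : Multiset AItem) : Prop :=
  ∃ K, One (openOne m) I K ∧ All (itemRel keepMark (openRel c m m)) K J

theorem rewrites_mergeP (c : Bool) (m : Mark) : Rewrites (mergeP c m) (mergeRel c m) :=
  (rewrites_onePass (itemTr_openBlk m)).seq (rewrites_allPass _ (blockTr_openP c m m))

theorem ptime_mergeP (c : Bool) (m : Mark) : PTime (mergeP c m) :=
  (ptime_onePass rfl).seq (ptime_allPass _ (blockTr_openP c m m))

theorem one_open {m m' : Mark} {V : Multiset Formula} :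
    One (openOne m) (V.map (.fm m') + enc ⟨Γ, Θ, Δ⟩) J ↔
      ∃ X Θ', Θ = X ::ₘ Θ' ∧ J = X.map (.fm m) + V.map (.fm m') + enc ⟨Γ, Θ', Δ⟩ := by
  have h : ∀ J, One (openOne m) (enc ⟨Γ, Θ, Δ⟩) J ↔
      ∃ X Θ' j, Θ = X ::ₘ Θ' ∧ j = X.map (.fm m) ∧ J = j + enc ⟨Γ, Θ', Δ⟩ := fun J => one_enc_blk
  simp only [One.add_left, One.map_left, h]
  simp [openOne, add_left_comm, add_assoc]

/-- The obligatory first opening makes the group nonempty; the pass over the other blocks enlarges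
it only if `c` holds. -/
theorem mergeRel_enc {c : Bool} {m : Mark} (hm : keepMark m = some (some m))
    {V : Multiset Formula} : mergeRel c m (V.map (.fm .r) + enc ⟨Γ, Θ, Δ⟩) J ↔
      ∃ U Θ', Θ = U + Θ' ∧ (1 ≤ U.card ∧ (c = true ∨ U.card = 1)) ∧
        J = U.join.map (.fm m) + V.map (.fm .r) := by
  have hr : keepMark .r = some (some .r) := rfl
  simp only [mergeRel, one_open]
  constructor
  · rintro ⟨_, ⟨X, Θ, rfl, rfl⟩, h⟩
    simp only [All.add_left, All.map_left, itemRel, hm, hr, Action.rel, All.singleton_iff,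
      all_keep_enc, all_openRel] at h
    obtain ⟨_, _, ⟨_, _, rfl, rfl, rfl⟩, ⟨U, V, Θ, rfl, hC, rfl⟩, rfl⟩ := h
    refine ⟨X ::ₘ (U + V), Θ, by simp, ⟨by simp, hC.imp_right ?_⟩, ?_⟩
    · rintro ⟨rfl, rfl⟩; simp
    · simp only [Multiset.join_cons, Multiset.join_add, Multiset.map_add]; abel
  · rintro ⟨U, Θ', rfl, ⟨hU, hC⟩, rfl⟩
    obtain ⟨X, hX⟩ := Multiset.card_pos_iff_exists_mem.1 hU
    obtain ⟨U, rfl⟩ := Multiset.exists_cons_of_mem hX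
    obtain ⟨Ξ, hΞ⟩ : ∃ Ξ, Ξ = U + Θ' := ⟨_, rfl⟩
    refine ⟨_, ⟨X, Ξ, by simp [hΞ], rfl⟩, ?_⟩
    simp only [All.add_left, All.map_left, itemRel, hm, hr, Action.rel, All.singleton_iff,
      all_keep_enc, all_openRel]
    refine ⟨_, _, ⟨_, _, rfl, rfl, rfl⟩, ⟨U, 0, Θ', by simp [hΞ], hC.imp_right ?_, rfl⟩, ?_⟩
    · intro h
      exact ⟨by simpa using h, rfl⟩
    · simp only [Multiset.join_cons, Multiset.join_zero, Multiset.map_zero, Multiset.map_add]; abel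

theorem replies_refute (X V : Multiset Formula) :
    Replies (X.map (.fm .a) + V.map (.fm .r)) {⟨X, 0, V⟩} := by
  have h := replies_modal X 0 0 0 V
  convert h using 1
  · simp
  · ext; simp

theorem replies_side (Y V : Multiset Formula) :
    Replies (Y.map (.fm .b) + V.map (.fm .r))
      {T | T = ⟨Y, 0, V⟩ ∨ ∃ A ∈ Y, T = ⟨V, 0, {A}⟩} := by
  have h := replies_modal 0 Y 0 0 V
  convert h using 1
  · simp
  · ext; simp

theorem replies_sides (Z W : Multiset Formula) :
    Replies (Z.map (.fm .c) + W.map (.fm .d))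
      {T | T = ⟨Z + W, 0, 0⟩ ∨ ∃ A ∈ Z, ∃ B ∈ W, T = ⟨0, 0, {A, B}⟩} := by
  have h := replies_modal 0 0 Z W 0
  convert h using 1
  · simp
  · ext; simp

theorem guesses_d₁ (L : Logic) : ∃ p, Guesses p fun S Ss => ∃ U Γ Θ Δ, L.D = true ∧ L.M = false ∧
    MergeCard L U.card ∧ S = ⟨Γ, U + Θ, Δ⟩ ∧
      Ss = {T | T = ⟨U.join, 0, 0⟩ ∨ ∃ A ∈ U.join, T = ⟨0, 0, {A}⟩} := by
  by_cases h : L.D = true ∧ L.M = false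
  · have key := fun (S : Sequent) (J : Multiset AItem) => mergeRel_enc (Γ := S.form) (Θ := S.blocks) (Δ := S.succ) (J := J)
      (c := L.C) (m := .b) rfl (V := 0)
    simp only [Multiset.map_zero, zero_add, add_zero] at key
    have hr := fun X => replies_side X 0
    simp only [Multiset.map_zero, add_zero] at hr
    refine ⟨_, ptime_mergeP L.C .b, _, rewrites_mergeP L.C .b, ?_, ?_⟩
    · rintro ⟨Γ, Θ, Δ⟩ J hJ
      obtain ⟨U, Θ', rfl, hU, rfl⟩ := (key ⟨Γ, Θ, Δ⟩ _).1 hJ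
      exact ⟨_, ⟨U, Γ, Θ', Δ, h.1, h.2, hU, rfl, rfl⟩, hr _⟩
    · rintro S Ss ⟨U, Γ, Θ, Δ, -, -, hU, rfl, rfl⟩
      exact ⟨_, (key ⟨Γ, U + Θ, Δ⟩ _).2 ⟨U, Θ, rfl, hU, rfl⟩, hr _⟩
  · exact ⟨_, .of_forall_not fun S Ss => by
      rintro ⟨U, Γ, Θ, Δ, h1, h2, -⟩; exact h ⟨h1, h2⟩⟩

/-- Activate the formula under a box in the succedent. -/
def unboxP : Program :=
  .seq (.pop .S (.inr .R)) <| .seq (.pop .S (.inl .box)) <|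
    .seq (.push .O (.inr .r)) (formulaP true)

theorem itemTr_unboxP :
    ItemTr unboxP fun i J => ∃ C, i = .fm .R C ∧ ∃ B, C = .box B ∧ J = {.fm .r B} := by
  refine .of_tr (((tr_copy.pushSeq _).popSeq _).popSeq _)
    (fun B => ⟨.fm .R (.box B), [.fm .r B], by simp [Item.word, Formula.word, Formula.encode],
      by simp [Item.word], _, rfl, B, rfl, rfl⟩) ?_
  rintro (⟨m, A⟩ | X) J ⟨C, h, B, rfl, rfl⟩
  · cases h
    exact ⟨B, [.fm .r B], by simp [Item.word, Formula.word, Formula.encode],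
      by simp [Item.word], rfl⟩
  · cases h

/-- Guess the blocks in an application of the rule for a box in the succedent. -/
noncomputable def boxRP (L : Logic) (m : Mark) : Program :=
  .seq (onePass unboxP)
    (.alt (mergeP L.C m) (if L.N then allPass keepMark delBlk else .zero))

theorem ptime_boxRP (L : Logic) (m : Mark) : PTime (boxRP L m) := by
  refine (ptime_onePass rfl).seq ((ptime_mergeP _ _).alt ?_)
  cases L.N
  · exact PTime.driven (k := .S) rfl
  · exact ptime_allPass _ blockTr_del

/-- With N there is the further possibility that everything but the activated formula is deleted,
which is the empty group. -/
theorem exists_boxRP (L : Logic) {m : Mark} (hm : keepMark m = some (some m)) :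
    ∃ σ, Rewrites (boxRP L m) σ ∧ ∀ Γ Θ Δ J, σ (enc ⟨Γ, Θ, Δ⟩) J ↔
      ∃ U Θ' B Δ', Θ = U + Θ' ∧ Δ = .box B ::ₘ Δ' ∧
        (MergeCard L U.card ∨ (L.N = true ∧ U = 0)) ∧ J = U.join.map (.fm m) + {.fm .r B} := by
  have hN : Rewrites (if L.N then allPass keepMark delBlk else .zero) fun I J =>
      L.N = true ∧ All (itemRel keepMark fun _ J => J = 0) I J := by
    cases h : L.N
    · simpa using Rewrites.zero
    · simpa using rewrites_allPass _ blockTr_del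
  refine ⟨_, (rewrites_onePass itemTr_unboxP).seq ((rewrites_mergeP L.C m).alt hN), ?_⟩
  intro Γ Θ Δ J
  have hdel : ∀ {Θ Δ B J}, All (itemRel keepMark fun _ J => J = 0)
      ({.fm .r B} + enc ⟨Γ, Θ, Δ⟩) J ↔ J = {.fm .r B} := by
    intro Θ Δ B J
    have hr : keepMark .r = some (some .r) := rfl
    simp [All.cons_left, all_keep_enc, All.zero_iff, itemRel, hr, Action.rel,
      ← Multiset.cons_zero]
  have hmerge : ∀ {Θ Δ B J}, mergeRel L.C m ({.fm .r B} + enc ⟨Γ, Θ, Δ⟩) J ↔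
      ∃ U Θ', Θ = U + Θ' ∧ MergeCard L U.card ∧ J = U.join.map (.fm m) + {.fm .r B} := by
    intro Θ Δ B J
    simpa [MergeCard] using mergeRel_enc (c := L.C) hm (Γ := Γ) (Θ := Θ) (Δ := Δ) (J := J) (V := {B})
  constructor
  · rintro ⟨K, h1, h2⟩
    obtain ⟨_, Δ', _, rfl, ⟨B, rfl, rfl⟩, rfl⟩ := one_enc_R.1 h1
    rcases h2 with h2 | ⟨hN, h2⟩
    · obtain ⟨U, Θ', rfl, hU, rfl⟩ := hmerge.1 h2
      exact ⟨U, Θ', B, Δ', rfl, rfl, .inl hU, rfl⟩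
    · exact ⟨0, Θ, B, Δ', by simp, rfl, .inr ⟨hN, rfl⟩, by simpa using hdel.1 h2⟩
  · rintro ⟨U, Θ', B, Δ', rfl, rfl, hU, rfl⟩
    refine ⟨_, one_enc_R.2 ⟨_, Δ', _, rfl, ⟨B, rfl, rfl⟩, rfl⟩, ?_⟩
    rcases hU with hU | ⟨hN, rfl⟩
    · exact .inl (hmerge.2 ⟨U, Θ', rfl, hU, rfl⟩)
    · exact .inr ⟨hN, hdel.2 (by simp)⟩

theorem guesses_boxR (L : Logic) : ∃ p, Guesses p fun S Ss => ∃ U B Γ Θ Δ, L.M = false ∧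
    (MergeCard L U.card ∨ (L.N = true ∧ U = 0)) ∧ S = ⟨Γ, U + Θ, .box B ::ₘ Δ⟩ ∧
      Ss = {T | T = ⟨U.join, 0, {B}⟩ ∨ ∃ A ∈ U.join, T = ⟨{B}, 0, {A}⟩} := by
  by_cases hM : L.M = false
  · obtain ⟨σ, h1, h2⟩ := exists_boxRP L (m := .b) rfl
    refine ⟨_, ptime_boxRP L .b, σ, h1, ?_, ?_⟩
    · rintro ⟨Γ, Θ, Δ⟩ J hJ
      obtain ⟨U, Θ', B, Δ', rfl, rfl, hU, rfl⟩ := (h2 _ _ _ _).1 hJ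
      exact ⟨_, ⟨U, B, Γ, Θ', Δ', hM, hU, rfl, rfl⟩, by simpa using replies_side U.join {B}⟩
    · rintro S Ss ⟨U, B, Γ, Θ, Δ, -, hU, rfl, rfl⟩
      exact ⟨_, (h2 _ _ _ _).2 ⟨U, Θ, B, Δ, rfl, rfl, hU, rfl⟩,
        by simpa using replies_side U.join {B}⟩
  · exact ⟨_, .of_forall_not fun S Ss => by
      rintro ⟨U, B, Γ, Θ, Δ, h1, -⟩; exact hM h1⟩

theorem guesses_boxRm (L : Logic) : ∃ p, Guesses p fun S Ss => ∃ U B Γ Θ Δ, L.M = true ∧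
    (MergeCard L U.card ∨ (L.N = true ∧ U = 0)) ∧ S = ⟨Γ, U + Θ, .box B ::ₘ Δ⟩ ∧
      Ss = {⟨U.join, 0, {B}⟩} := by
  by_cases hM : L.M = true
  · obtain ⟨σ, h1, h2⟩ := exists_boxRP L (m := .a) rfl
    refine ⟨_, ptime_boxRP L .a, σ, h1, ?_, ?_⟩
    · rintro ⟨Γ, Θ, Δ⟩ J hJ
      obtain ⟨U, Θ', B, Δ', rfl, rfl, hU, rfl⟩ := (h2 _ _ _ _).1 hJ
      exact ⟨_, ⟨U, B, Γ, Θ', Δ', hM, hU, rfl, rfl⟩, by simpa using replies_refute U.join {B}⟩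
    · rintro S Ss ⟨U, B, Γ, Θ, Δ, -, hU, rfl, rfl⟩
      exact ⟨_, (h2 _ _ _ _).2 ⟨U, Θ, B, Δ, rfl, rfl, hU, rfl⟩,
        by simpa using replies_refute U.join {B}⟩
  · exact ⟨_, .of_forall_not fun S Ss => by
      rintro ⟨U, B, Γ, Θ, Δ, h1, -⟩; exact hM h1⟩

theorem guesses_d₂ (L : Logic) : ∃ p, Guesses p fun S Ss => ∃ U V Γ Θ Δ,
    L.D = true ∧ L.M = false ∧ MergeCard L U.card ∧ MergeCard L V.card ∧
      S = ⟨Γ, U + V + Θ, Δ⟩ ∧ Ss = {T | T = ⟨U.join + V.join, 0, 0⟩ ∨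
        ∃ A ∈ U.join, ∃ B ∈ V.join, T = ⟨0, 0, {A, B}⟩} := by
  by_cases h : L.D = true ∧ L.M = false
  swap
  · exact ⟨_, .of_forall_not fun S Ss => by
      rintro ⟨U, V, Γ, Θ, Δ, h1, h2, -⟩; exact h ⟨h1, h2⟩⟩
  have hc : keepMark .c = some (some .c) := rfl
  have hd : keepMark .d = some (some .d) := rfl
  have h0 : ∀ {Γ Θ Δ J}, One (openOne .c) (enc ⟨Γ, Θ, Δ⟩) J ↔
      ∃ X Θ', Θ = X ::ₘ Θ' ∧ J = X.map (.fm .c) + enc ⟨Γ, Θ', Δ⟩ := by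
    intro Γ Θ Δ J
    simpa using one_open (m := .c) (m' := .c) (V := 0) (Γ := Γ) (Θ := Θ) (Δ := Δ) (J := J)
  refine ⟨_, (ptime_onePass (p := openBlk .c) rfl).seq ((ptime_onePass (p := openBlk .d) rfl).seq
    (ptime_allPass keepMark (blockTr_openP L.C .c .d))), _,
    (rewrites_onePass (itemTr_openBlk .c)).seq ((rewrites_onePass (itemTr_openBlk .d)).seq
    (rewrites_allPass keepMark (blockTr_openP L.C .c .d))), ?_, ?_⟩
  · rintro ⟨Γ, Θ, Δ⟩ J ⟨K, h1, K', h2, h3⟩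
    obtain ⟨X, Θ, rfl, rfl⟩ := h0.1 h1
    obtain ⟨Y, Θ, rfl, rfl⟩ := one_open.1 h2
    simp only [All.add_left, All.map_left, itemRel, hc, hd, Action.rel, All.singleton_iff,
      all_keep_enc, all_openRel] at h3
    obtain ⟨_, _, ⟨_, _, rfl, rfl, rfl⟩, ⟨U, V, Θ, rfl, hC, rfl⟩, rfl⟩ := h3
    refine ⟨_, ⟨X ::ₘ U, Y ::ₘ V, Γ, Θ, Δ, h.1, h.2, ⟨by simp, hC.imp_right ?_⟩,
      ⟨by simp, hC.imp_right ?_⟩, ?_, rfl⟩, ?_⟩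
    · rintro ⟨rfl, rfl⟩; simp
    · rintro ⟨rfl, rfl⟩; simp
    · rw [Multiset.cons_add, Multiset.add_cons, Multiset.cons_add, Multiset.cons_add,
        Multiset.cons_swap]
    · convert replies_sides (X ::ₘ U).join (Y ::ₘ V).join using 1
      simp only [Multiset.join_cons, Multiset.map_add]; abel
  · rintro S Ss ⟨U, V, Γ, Θ, Δ, -, -, hU, hV, rfl, rfl⟩
    obtain ⟨X, hX⟩ := Multiset.card_pos_iff_exists_mem.1 hU.1
    obtain ⟨U, rfl⟩ := Multiset.exists_cons_of_mem hX
    obtain ⟨Y, hY⟩ := Multiset.card_pos_iff_exists_mem.1 hV.1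
    obtain ⟨V, rfl⟩ := Multiset.exists_cons_of_mem hY
    obtain ⟨Ξ, hΞ⟩ : ∃ Ξ, Ξ = U + V + Θ := ⟨_, rfl⟩
    refine ⟨_, ⟨_, h0.2 ⟨X, Y ::ₘ Ξ, by simp [hΞ, Multiset.cons_swap], rfl⟩, _,
      one_open.2 ⟨Y, Ξ, rfl, rfl⟩, ?_⟩, replies_sides _ _⟩
    simp only [All.add_left, All.map_left, itemRel, hc, hd, Action.rel, All.singleton_iff,
      all_keep_enc, all_openRel]
    refine ⟨_, _, ⟨_, _, rfl, rfl, rfl⟩, ⟨U, V, Θ, hΞ, ?_, rfl⟩, ?_⟩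
    -- Without C both groups are single blocks, so nothing is opened beyond the two obligatory
    -- blocks.
    · rcases hU.2 with h | h
      · exact .inl h
      · rcases hV.2 with h' | h'
        · exact .inl h'
        · exact .inr ⟨by simpa using h, by simpa using h'⟩
    · simp only [Multiset.join_cons, Multiset.map_add]; abel

end modal

open Prog Function

/-! ### Guesses of refuted blocks -/

section refute

variable {Γ Δ : Multiset Formula} {Θ : Multiset (Multiset Formula)} {J : Multiset AItem}

/-- Refutable numbers of blocks are closed downwards to 1. So the set `L.RD`, however complicated,
matters only through a bound or the lack of one, and a finite program can be chosen for each logic.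
-/
theorem refuteCard_cases (L : Logic) : (∀ k, RefuteCard L k ↔ 1 ≤ k) ∨
    ∃ n, ∀ k, RefuteCard L k ↔ 1 ≤ k ∧ k ≤ n := by
  have hmono : ∀ {j k}, 1 ≤ j → j ≤ k → RefuteCard L k → RefuteCard L j := by
    rintro j k hj hjk ⟨-, h | ⟨rfl, h⟩ | ⟨h1, h2⟩ | ⟨n, hn, h⟩⟩
    · exact ⟨hj, .inl h⟩
    · exact ⟨hj, .inr (.inl ⟨by omega, h⟩)⟩
    · exact ⟨hj, .inr (.inr (.inl ⟨by omega, h2⟩))⟩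
    · exact ⟨hj, .inr (.inr (.inr ⟨n, hn, by omega⟩))⟩
  by_cases hb : ∃ n, ∀ k, RefuteCard L k → k ≤ n
  · obtain ⟨n, hn⟩ := hb
    right
    induction n with
    | zero => exact ⟨0, fun k => ⟨fun h => ⟨h.1, hn k h⟩, fun h => absurd h (by omega)⟩⟩
    | succ n ih =>
      by_cases h : RefuteCard L (n + 1)
      · exact ⟨n + 1, fun k => ⟨fun hk => ⟨hk.1, hn k hk⟩, fun hk => hmono hk.1 hk.2 h⟩⟩
      · refine ih fun k hk => ?_
        rcases (hn k hk).eq_or_lt with rfl | hlt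
        · exact absurd hk h
        · omega
  · left
    push Not at hb
    intro k
    obtain ⟨j, hj, hkj⟩ := hb k
    exact ⟨fun h => h.1, fun h => hmono h hkj.le hj⟩

/-- Open at most `n` blocks. -/
noncomputable def pickP : ℕ → Program
  | 0 => .one
  | n + 1 => .alt .one (.seq (onePass (openBlk .a)) (pickP n))

def pickRel : ℕ → Multiset AItem → Multiset AItem → Prop
  | 0, I, J => J = I
  | n + 1, I, J => J = I ∨ ∃ K, One (openOne .a) I K ∧ pickRel n K J

theorem rewrites_pickP (n : ℕ) : Rewrites (pickP n) (pickRel n) := by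
  induction n with
  | zero => exact Rewrites.one
  | succ n ih => exact Rewrites.one.alt ((rewrites_onePass (itemTr_openBlk .a)).seq ih)

theorem ptime_pickP (n : ℕ) : PTime (pickP n) := by
  induction n with
  | zero => exact PTime.driven (k := .S) rfl
  | succ n ih => exact (PTime.driven (k := .S) rfl).alt ((ptime_onePass rfl).seq ih)

theorem pickRel_enc {n : ℕ} {V : Multiset Formula} :
    pickRel n (V.map (.fm .a) + enc ⟨Γ, Θ, Δ⟩) J ↔ ∃ U Θ', Θ = U + Θ' ∧ U.card ≤ n ∧
      J = (U.join + V).map (.fm .a) + enc ⟨Γ, Θ', Δ⟩ := by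
  induction n generalizing V Θ with
  | zero =>
    simp only [pickRel, Nat.le_zero]
    constructor
    · rintro rfl
      exact ⟨0, Θ, by simp, by simp, by simp⟩
    · rintro ⟨U, Θ', rfl, hU, rfl⟩
      rw [Multiset.card_eq_zero.1 hU]
      simp
  | succ n ih =>
    simp only [pickRel, one_open]
    constructor
    · rintro (rfl | ⟨_, ⟨X, Θ, rfl, rfl⟩, h⟩)
      · exact ⟨0, Θ, by simp, by simp, by simp⟩
      · rw [← Multiset.map_add, ih] at h
        obtain ⟨U, Θ, rfl, hU, rfl⟩ := h
        exact ⟨X ::ₘ U, Θ, by simp, by simpa using hU, by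
          simp only [Multiset.join_cons, Multiset.map_add]; abel⟩
    · rintro ⟨U, Θ', rfl, hU, rfl⟩
      rcases U.empty_or_exists_mem with rfl | ⟨X, hX⟩
      · exact .inl (by simp)
      · obtain ⟨U, rfl⟩ := Multiset.exists_cons_of_mem hX
        refine .inr ⟨_, ⟨X, U + Θ', by simp, rfl⟩, ?_⟩
        rw [← Multiset.map_add, ih]
        exact ⟨U, Θ', rfl, by simpa using hU, by
          simp only [Multiset.join_cons, Multiset.map_add]; abel⟩

/-- Without a bound any nonempty group is opened in one pass. With a bound that is positive, one
block is opened and then, in separate passes, up to a fixed number of further ones. -/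
theorem guesses_refute (L : Logic) : ∃ p, Guesses p fun S Ss => ∃ U Γ Θ Δ,
    RefuteCard L U.card ∧ S = ⟨Γ, U + Θ, Δ⟩ ∧ Ss = {⟨U.join, 0, 0⟩} := by
  have hr : ∀ U : Multiset (Multiset Formula),
      Replies (U.join.map (.fm .a)) {⟨U.join, 0, 0⟩} := fun U => by
    have h := replies_refute U.join 0
    rwa [Multiset.map_zero, add_zero] at h
  suffices h : ∃ p σ, PTime p ∧ Rewrites p σ ∧ ∀ Γ Θ Δ J, σ (enc ⟨Γ, Θ, Δ⟩) J ↔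
      ∃ U Θ', Θ = U + Θ' ∧ RefuteCard L U.card ∧ J = U.join.map (.fm .a) by
    obtain ⟨p, σ, hp, hσ, h⟩ := h
    refine ⟨p, hp, σ, hσ, ?_, ?_⟩
    · rintro ⟨Γ, Θ, Δ⟩ J hJ
      obtain ⟨U, Θ', rfl, hU, rfl⟩ := (h _ _ _ _).1 hJ
      exact ⟨_, ⟨U, Γ, Θ', Δ, hU, rfl, rfl⟩, hr U⟩
    · rintro S Ss ⟨U, Γ, Θ, Δ, hU, rfl, rfl⟩
      exact ⟨_, (h _ _ _ _).2 ⟨U, Θ, rfl, hU, rfl⟩, hr U⟩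
  rcases refuteCard_cases L with h | ⟨n, h⟩
  · refine ⟨_, _, ptime_mergeP true .a, rewrites_mergeP true .a, fun Γ Θ Δ J => ?_⟩
    simpa [h] using mergeRel_enc (c := true) (m := .a) rfl (V := 0) (Γ := Γ) (Θ := Θ) (Δ := Δ)
      (J := J)
  · cases n with
    | zero =>
      refine ⟨_, _, PTime.driven (p := .zero) (k := .S) rfl, Rewrites.zero, fun Γ Θ Δ J => ?_⟩
      simp only [h, false_iff]
      rintro ⟨U, Θ', -, hU, -⟩
      omega
    | succ n =>
      refine ⟨_, _, (ptime_onePass (p := openBlk .a) rfl).seq ((ptime_pickP n).seq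
          (ptime_allPass keepMark blockTr_del)),
        (rewrites_onePass (itemTr_openBlk .a)).seq ((rewrites_pickP n).seq
          (rewrites_allPass keepMark blockTr_del)), fun Γ Θ Δ J => ?_⟩
      have h0 : ∀ J, One (openOne .a) (enc ⟨Γ, Θ, Δ⟩) J ↔
          ∃ X Θ', Θ = X ::ₘ Θ' ∧ J = X.map (.fm .a) + enc ⟨Γ, Θ', Δ⟩ := fun J => by
        simpa using one_open (m := .a) (m' := .a) (V := 0) (Γ := Γ) (Θ := Θ) (Δ := Δ) (J := J)
      have ha : keepMark .a = some (some .a) := rfl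
      have hall : ∀ {X : Multiset Formula} {Θ J}, All (itemRel keepMark fun _ J => J = 0)
          (X.map (.fm .a) + enc ⟨Γ, Θ, Δ⟩) J ↔ J = X.map (.fm .a) := by
        intro X Θ J
        simp [All.add_left, All.map_left, all_keep_enc, All.zero_iff, itemRel, ha, Action.rel,
          All.singleton_iff]
      constructor
      · rintro ⟨K, h1, K', h2, h3⟩
        obtain ⟨X, Θ, rfl, rfl⟩ := (h0 _).1 h1
        obtain ⟨U, Θ, rfl, hU, rfl⟩ := pickRel_enc.1 h2
        refine ⟨X ::ₘ U, Θ, by simp, (h _).2 (by simpa using hU), ?_⟩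
        rw [hall.1 h3, Multiset.join_cons, add_comm]
      · rintro ⟨U, Θ', rfl, hU, rfl⟩
        rw [h] at hU
        obtain ⟨X, hX⟩ := Multiset.card_pos_iff_exists_mem.1 hU.1
        obtain ⟨U, rfl⟩ := Multiset.exists_cons_of_mem hX
        refine ⟨_, (h0 _).2 ⟨X, U + Θ', by simp, rfl⟩, _,
          pickRel_enc.2 ⟨U, Θ', rfl, by simpa using hU.2, rfl⟩, hall.2 ?_⟩
        rw [Multiset.join_cons, add_comm]

end refute

/-! ### Guesses of initial sequents -/

section init

theorem tr_atomBits (m : Mark) : Tr (.seq (.pop .S (.inr m)) (.seq (.pop .S (.inl .var)) (bitsP true)))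
    (fun i : ℕ => (Item.fm m (.atom i)).word) fun i => bitsWord i.bits :=
  (((tr_bitsP true).popSeq _).popSeq _).congr
    (fun i => ⟨i, by simp [Item.word, Formula.word_atom], by simp [outWord]⟩)
    fun i => ⟨i, by simp [Item.word, Formula.word_atom], by simp [outWord]⟩

def stepBits (p : Letter → Program) : Program := .star (.alt (p .one) (p .zero))

def bitsToC : Program := stepBits fun a => .seq (.pop .S (.inl a)) (.push .C (.inl a))

/-- Two indices, one on each stack, are compared digit by digit; they agree if both stacks can be
emptied in this way. -/
def bitsOC : Program := stepBits fun a => .seq (.pop .O (.inl a)) (.pop .C (.inl a))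

theorem rel_bitsToC {x o c : List Sym} {s' : Stk → List Sym} :
    bitsToC.Rel (tape x o c) s' ↔
      ∃ l u, x = bitsWord l ++ u ∧ s' = tape u o ((bitsWord l).reverse ++ c) := by
  constructor
  · intro h
    replace h : Relation.ReflTransGen _ (tape x o c) s' := h
    induction h with
    | refl => exact ⟨[], x, by simp [bitsWord]⟩
    | tail _ h ih =>
      obtain ⟨l, u, rfl, rfl⟩ := ih
      rcases h with ⟨_, ⟨r, hr, rfl⟩, rfl⟩ | ⟨_, ⟨r, hr, rfl⟩, rfl⟩
      · rw [tape_S] at hr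
        subst hr
        exact ⟨l ++ [true], r, by simp [bitsWord, digit]⟩
      · rw [tape_S] at hr
        subst hr
        exact ⟨l ++ [false], r, by simp [bitsWord, digit]⟩
  · rintro ⟨l, u, rfl, rfl⟩
    show Relation.ReflTransGen _ _ _
    induction l generalizing c with
    | nil => exact .refl
    | cons b l ih =>
      refine .head (b := tape (bitsWord l ++ u) o (.inl (digit b) :: c)) ?_
        (by simpa [bitsWord] using ih (c := .inl (digit b) :: c))
      cases b
      · exact .inr ⟨_, ⟨bitsWord l ++ u, rfl, rfl⟩, by simp [Prog.Rel, digit]⟩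
      · exact .inl ⟨_, ⟨bitsWord l ++ u, rfl, rfl⟩, by simp [Prog.Rel, digit]⟩

theorem bitsOC_of_rel {x o c : List Sym} {s' : Stk → List Sym}
    (h : bitsOC.Rel (tape x o c) s') (hO : s' .O = []) (hC : s' .C = []) :
    o = c ∧ s' = tape x [] [] := by
  replace h : Relation.ReflTransGen _ (tape x o c) s' := h
  generalize hs : tape x o c = s at h
  induction h using Relation.ReflTransGen.head_induction_on generalizing o c with
  | refl => subst hs; simp_all
  | head h _ ih =>
    subst hs
    rcases h with ⟨_, ⟨r, hr, rfl⟩, ⟨r', hr', rfl⟩⟩ | ⟨_, ⟨r, hr, rfl⟩, ⟨r', hr', rfl⟩⟩ <;>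
    · simp only [tape_O, update_tape_O, tape_C] at hr hr'
      obtain ⟨rfl, rfl⟩ := ih (o := r) (c := r') (by simp)
      exact ⟨by rw [hr, hr'], rfl⟩

theorem rel_bitsOC (l : List Bool) (x : List Sym) :
    bitsOC.Rel (tape x (bitsWord l) (bitsWord l)) (tape x [] []) := by
  show Relation.ReflTransGen _ _ _
  induction l with
  | nil => exact .refl
  | cons b l ih =>
    refine .head (b := tape x (bitsWord l) (bitsWord l)) ?_ ih
    cases b
    · exact .inr ⟨_, ⟨_, rfl, rfl⟩, by simp [Prog.Rel, digit, bitsWord]⟩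
    · exact .inl ⟨_, ⟨_, rfl, rfl⟩, by simp [Prog.Rel, digit, bitsWord]⟩

/-- Check that the tape consists of two marked occurrences of the same variable, and write that the
existential player has won. -/
def sameP (m m' : Mark) : Program :=
  .seq
    (.seq (.seq (.pop .S (.inr m)) (.seq (.pop .S (.inl .var)) (bitsP true)))
      (.seq (.pop .S (.inr m')) (.seq (.pop .S (.inl .var)) (.seq bitsToC (.empty .S)))))
    (.seq bitsOC (.seq (.empty .O) (.seq (.empty .C) (.seq (.push .S (.inl .bot))
      (.push .S (.inr .w))))))

theorem ptime_sameP (m m' : Mark) : PTime (sameP m m') :=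
  (PTime.driven (k := .S) rfl).seq (PTime.driven (k := .O) rfl)

theorem rel_sameP {m m' : Mark} {is : List Item} {s' : Stk → List Sym} :
    (sameP m m').Rel (tape (words is) [] []) s' ↔
      (∃ p, is = [.fm m (.atom p), .fm m' (.atom p)]) ∧ s' = tape (words [.fm .w .bot]) [] [] := by
  constructor
  · rintro ⟨s₂, ⟨s₁, h1, _, ⟨r, hr, rfl⟩, _, ⟨r', hr', rfl⟩, _, h2, hS, rfl⟩, _, h3, _,
      ⟨hO, rfl⟩, _, ⟨hC, rfl⟩, _, rfl, rfl⟩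
    obtain ⟨p, u, hx, rfl⟩ := (tr_atomBits m _ _ _ _).1 h1
    simp only [tape_S, update_tape_S] at hr hr' h2
    subst hr
    subst hr'
    obtain ⟨l, v, rfl, rfl⟩ := rel_bitsToC.1 h2
    obtain rfl : v = [] := hS
    obtain ⟨h, rfl⟩ := bitsOC_of_rel h3 hO hC
    refine ⟨⟨p, words_injective ?_⟩, by simp [words, Item.word, Formula.word, Formula.encode]⟩
    have hl : bitsWord p.bits = bitsWord l := by simpa using h
    rw [hx, ← hl]
    simp [Item.word, Formula.word_atom]
  · rintro ⟨⟨p, rfl⟩, rfl⟩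
    have h1 := (tr_atomBits m (words [.fm m (.atom p), .fm m' (.atom p)]) [] [] _).2
      ⟨p, (Item.fm m' (.atom p)).word, by simp, rfl⟩
    refine ⟨_, ⟨_, h1, _, ⟨_, rfl, rfl⟩, _, ⟨bitsWord p.bits, ?_, rfl⟩, _,
      ?_, rfl, rfl⟩, _, rel_bitsOC p.bits.reverse [], _, ⟨rfl, rfl⟩, _, ⟨rfl, rfl⟩, _, rfl, ?_⟩
    · simp [Formula.word_atom]
    · simp only [update_tape_S]
      exact rel_bitsToC.2 ⟨p.bits, [], by simp, by simp [bitsWord]⟩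
    · simp [Prog.Rel, words, Item.word, Formula.word, Formula.encode]

theorem Item.abs_eq_fm {i : Item} {m : Mark} {A : Formula} : i.abs = .fm m A ↔ i = .fm m A := by
  cases i <;> simp [Item.abs]

theorem content_eq_pair {is : List Item} {m m' : Mark} {A B : Formula}
    (h : content is = {.fm m A, .fm m' B}) :
    is = [.fm m A, .fm m' B] ∨ is = [.fm m' B, .fm m A] := by
  have hlen : is.length = 2 := by simpa [content] using congrArg Multiset.card h
  obtain ⟨i, j, rfl⟩ := List.length_eq_two.1 hlen
  have h' : i.abs ::ₘ {j.abs} = .fm m A ::ₘ {.fm m' B} := h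
  rcases Multiset.cons_eq_cons.1 h' with ⟨h1, h2⟩ | ⟨-, C, h1, h2⟩
  · left
    rw [Item.abs_eq_fm.1 h1, Item.abs_eq_fm.1 (Multiset.singleton_inj.1 h2)]
  · right
    obtain ⟨h3, rfl⟩ := (Multiset.singleton_eq_cons_iff _).1 h1
    obtain ⟨h4, -⟩ := (Multiset.singleton_eq_cons_iff _).1 h2
    rw [Item.abs_eq_fm.1 h4.symm, Item.abs_eq_fm.1 h3]

/-- The order of the two items on the tape is not known, so both orders are tried. -/
theorem rewrites_same (m m' : Mark) : Rewrites (.alt (sameP m m') (sameP m' m)) fun I J =>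
    ∃ p, I = {.fm m (.atom p), .fm m' (.atom p)} ∧ J = {.fm .w .bot} := by
  constructor
  · rintro is s' (h | h)
    · obtain ⟨⟨p, rfl⟩, rfl⟩ := rel_sameP.1 h
      exact ⟨_, rfl, p, rfl, rfl⟩
    · obtain ⟨⟨p, rfl⟩, rfl⟩ := rel_sameP.1 h
      exact ⟨_, rfl, p, Multiset.pair_comm _ _, rfl⟩
  · rintro is J ⟨p, h, rfl⟩
    refine ⟨[.fm .w .bot], rfl, ?_⟩
    rcases content_eq_pair h with rfl | rfl
    · exact .inl (rel_sameP.2 ⟨⟨p, rfl⟩, rfl⟩)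
    · exact .inr (rel_sameP.2 ⟨⟨p, rfl⟩, rfl⟩)

/-- A variable is guessed on each side and all else is deleted. Only then are the two compared, as
nothing else is left on the tape. -/
theorem guesses_init : ∃ p, Guesses p fun S Ss => ∃ p Γ Θ Δ,
    S = ⟨.atom p ::ₘ Γ, Θ, .atom p ::ₘ Δ⟩ ∧ Ss = ∅ := by
  have hp : ∀ m m', ItemTr (atomP m m') fun i j =>
      ∃ A, i = .fm m A ∧ ∃ p, A = .atom p ∧ j = {.fm m' (.atom p)} := fun m m' =>
    (itemTr_atomP m m').congr fun i j => ⟨by rintro ⟨p, rfl, rfl⟩; exact ⟨_, rfl, p, rfl, rfl⟩,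
      by rintro ⟨_, rfl, p, rfl, rfl⟩; exact ⟨p, rfl, rfl⟩⟩
  have hc : keepMark .c = some (some .c) := rfl
  have hd : keepMark .d = some (some .d) := rfl
  have hall : ∀ {Γ Θ Δ J A B}, All (itemRel keepMark fun _ J => J = 0)
      ({.fm .c A} + ({.fm .d B} + enc ⟨Γ, Θ, Δ⟩)) J ↔ J = {.fm .c A, .fm .d B} := by
    intro Γ Θ Δ J A B
    rw [Multiset.pair_comm (AItem.fm .c A)]
    simp [All.cons_left, all_keep_enc, All.zero_iff, itemRel, hc, hd, Action.rel]
  have hone : ∀ {Γ Θ Δ J B}, One (fun i j => ∃ A, i = .fm .L A ∧ ∃ p, A = .atom p ∧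
      j = {.fm .c (.atom p)}) ({.fm .d B} + enc ⟨Γ, Θ, Δ⟩) J ↔
        ∃ p Γ', Γ = .atom p ::ₘ Γ' ∧ J = {.fm .c (.atom p)} + ({.fm .d B} + enc ⟨Γ', Θ, Δ⟩) := by
    intro Γ Θ Δ J B
    simp only [One.add_left, One.singleton_left, one_enc_L]
    constructor
    · rintro (⟨J', ⟨A, h, -⟩, -⟩ | ⟨J', ⟨A, Γ', j, rfl, ⟨p, rfl, rfl⟩, rfl⟩, rfl⟩)
      · cases h
      · exact ⟨p, Γ', rfl, by abel⟩
    · rintro ⟨p, Γ', rfl, rfl⟩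
      exact .inr ⟨_, ⟨_, Γ', _, rfl, ⟨p, rfl, rfl⟩, rfl⟩, by abel⟩
  refine ⟨_, (ptime_onePass (p := atomP .R .d) rfl).seq <| (ptime_onePass (p := atomP .L .c) rfl).seq <|
    (ptime_allPass keepMark blockTr_del).seq ((ptime_sameP .c .d).alt (ptime_sameP .d .c)), _,
    (rewrites_onePass (hp .R .d)).seq <| (rewrites_onePass (hp .L .c)).seq <|
    (rewrites_allPass keepMark blockTr_del).seq (rewrites_same .c .d), ?_, ?_⟩
  · rintro ⟨Γ, Θ, Δ⟩ J ⟨K₁, h1, K₂, h2, K₃, h3, p, rfl, rfl⟩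
    obtain ⟨_, Δ, _, rfl, ⟨q, rfl, rfl⟩, rfl⟩ := one_enc_R.1 h1
    obtain ⟨r, Γ, rfl, rfl⟩ := hone.1 h2
    have h := hall.1 h3
    have h1 : AItem.fm .c (.atom p) ∈ ({.fm .c (.atom r), .fm .d (.atom q)} : Multiset AItem) :=
      h ▸ by simp
    have h2 : AItem.fm .d (.atom p) ∈ ({.fm .c (.atom r), .fm .d (.atom q)} : Multiset AItem) :=
      h ▸ by simp
    obtain rfl : p = r := by simpa using h1
    obtain rfl : p = q := by simpa using h2
    exact ⟨∅, ⟨p, Γ, Θ, Δ, rfl, rfl⟩, replies_won (A := .bot) (by simp)⟩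
  · rintro S Ss ⟨p, Γ, Θ, Δ, rfl, rfl⟩
    exact ⟨_, ⟨_, one_enc_R.2 ⟨_, Δ, _, rfl, ⟨p, rfl, rfl⟩, rfl⟩, _, hone.2 ⟨p, Γ, rfl, rfl⟩, _,
      hall.2 rfl, p, rfl, rfl⟩, replies_won (A := .bot) (by simp)⟩

end init

/-! ### All rules -/

theorem guesses_botL : ∃ p, Guesses p fun S Ss => ∃ (_ : Unit) (Γ : Multiset Formula)
    (Θ : Multiset (Multiset Formula)) (Δ : Multiset Formula), S = ⟨.bot ::ₘ Γ, Θ, Δ⟩ ∧ Ss = ∅ :=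
  guesses_L (p := leafP .L .bot .w) (F := fun _ : Unit => .bot)
    (out := fun _ => {.fm .w .bot}) (prem := fun _ _ => ∅)
    ((itemTr_leafP .L .w (F := .bot) (by simp [Formula.word, Formula.encode])).congr fun i j => by simp) rfl
    fun _ S => replies_won (A := .bot) (by simp)

theorem guesses_topR : ∃ p, Guesses p fun S Ss => ∃ (_ : Unit) (Γ : Multiset Formula)
    (Θ : Multiset (Multiset Formula)) (Δ : Multiset Formula), S = ⟨Γ, Θ, .top ::ₘ Δ⟩ ∧ Ss = ∅ :=
  guesses_R (p := leafP .R .top .w) (F := fun _ : Unit => .top)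
    (out := fun _ => {.fm .w .top}) (prem := fun _ _ => ∅)
    ((itemTr_leafP .R .w (F := .top) (by simp [Formula.word, Formula.encode])).congr fun i j => by simp) rfl
    fun _ S => replies_won (A := .top) (by simp)

theorem replies_box (A : Formula) (S : Sequent) :
    Replies ({.blk {A}} + enc S) {⟨S.form, {A} ::ₘ S.blocks, S.succ⟩} := by
  simpa [enc] using replies_enc ⟨S.form, {A} ::ₘ S.blocks, S.succ⟩

theorem exists_guesses_nRule (L : Logic) : ∃ p, Guesses p (NRule L) := by
  obtain ⟨p₁, h₁⟩ := guesses_init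
  obtain ⟨p₂, h₂⟩ := guesses_botL
  obtain ⟨p₃, h₃⟩ := guesses_topR
  obtain ⟨p₄, h₄⟩ := guesses_L (itemTr_bin .L .gR .gL word_imp) rfl fun t S => replies_gRgL t.1 t.2 S
  obtain ⟨p₅, h₅⟩ := guesses_R (itemTr_bin .R .L .R word_imp) rfl fun t S => replies_LR t.1 t.2 S
  obtain ⟨p₆, h₆⟩ := guesses_L (itemTr_bin .L .L .L word_and) rfl fun t S => replies_LL t.1 t.2 S
  obtain ⟨p₇, h₇⟩ := guesses_R (itemTr_bin .R .gR .gR word_and) rfl fun t S => replies_gRgR t.1 t.2 S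
  obtain ⟨p₈, h₈⟩ := guesses_L (itemTr_bin .L .gL .gL word_or) rfl fun t S => replies_gLgL t.1 t.2 S
  obtain ⟨p₉, h₉⟩ := guesses_R (itemTr_bin .R .R .R word_or) rfl fun t S => replies_RR t.1 t.2 S
  obtain ⟨q₁, k₁⟩ := guesses_L itemTr_boxP rfl replies_box
  obtain ⟨q₂, k₂⟩ := guesses_t L
  obtain ⟨q₃, k₃⟩ := guesses_boxR L
  obtain ⟨q₄, k₄⟩ := guesses_boxRm L
  obtain ⟨q₅, k₅⟩ := guesses_refute L
  obtain ⟨q₆, k₆⟩ := guesses_d₁ L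
  obtain ⟨q₇, k₇⟩ := guesses_d₂ L
  have h := h₁.alt <| h₂.alt <| h₃.alt <| h₄.alt <| h₅.alt <| h₆.alt <| h₇.alt <| h₈.alt <|
    h₉.alt <| k₁.alt <| k₂.alt <| k₃.alt <| k₄.alt <| k₅.alt <| k₆.alt k₇
  refine ⟨.alt p₁ <| .alt p₂ <| .alt p₃ <| .alt p₄ <| .alt p₅ <| .alt p₆ <| .alt p₇ <| .alt p₈ <|
      .alt p₉ <| .alt q₁ <| .alt q₂ <| .alt q₃ <| .alt q₄ <| .alt q₅ <| .alt q₆ q₇, ?_⟩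
  convert h using 3 with S Ss
  constructor
  · intro h
    cases h with
    | init p Γ Θ Δ => exact .inl ⟨p, Γ, Θ, Δ, rfl, rfl⟩
    | botL Γ Θ Δ => exact .inr <| .inl ⟨(), Γ, Θ, Δ, rfl, rfl⟩
    | topR Γ Θ Δ => exact .inr <| .inr <| .inl ⟨(), Γ, Θ, Δ, rfl, rfl⟩
    | impL A B Γ Θ Δ => exact .inr <| .inr <| .inr <| .inl ⟨(A, B), Γ, Θ, Δ, rfl, rfl⟩
    | impR A B Γ Θ Δ => exact .inr <| .inr <| .inr <| .inr <| .inl ⟨(A, B), Γ, Θ, Δ, rfl, rfl⟩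
    | andL A B Γ Θ Δ =>
      exact .inr <| .inr <| .inr <| .inr <| .inr <| .inl ⟨(A, B), Γ, Θ, Δ, rfl, rfl⟩
    | andR A B Γ Θ Δ =>
      exact .inr <| .inr <| .inr <| .inr <| .inr <| .inr <| .inl ⟨(A, B), Γ, Θ, Δ, rfl, rfl⟩
    | orL A B Γ Θ Δ =>
      exact .inr <| .inr <| .inr <| .inr <| .inr <| .inr <| .inr <| .inl ⟨(A, B), Γ, Θ, Δ, rfl, rfl⟩
    | orR A B Γ Θ Δ =>
      exact .inr <| .inr <| .inr <| .inr <| .inr <| .inr <| .inr <| .inr <| .inl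
        ⟨(A, B), Γ, Θ, Δ, rfl, rfl⟩
    | boxL A Γ Θ Δ =>
      exact .inr <| .inr <| .inr <| .inr <| .inr <| .inr <| .inr <| .inr <| .inr <| .inl
        ⟨A, Γ, Θ, Δ, rfl, rfl⟩
    | t h X Γ Θ Δ =>
      exact .inr <| .inr <| .inr <| .inr <| .inr <| .inr <| .inr <| .inr <| .inr <| .inr <| .inl
        ⟨X, Γ, Θ, Δ, h, rfl, rfl⟩
    | boxR hM U B Γ Θ Δ hU =>
      exact .inr <| .inr <| .inr <| .inr <| .inr <| .inr <| .inr <| .inr <| .inr <| .inr <| .inr <|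
        .inl ⟨U, B, Γ, Θ, Δ, hM, hU, rfl, rfl⟩
    | boxRm hM U B Γ Θ Δ hU =>
      exact .inr <| .inr <| .inr <| .inr <| .inr <| .inr <| .inr <| .inr <| .inr <| .inr <| .inr <|
        .inr <| .inl ⟨U, B, Γ, Θ, Δ, hM, hU, rfl, rfl⟩
    | refute U Γ Θ Δ hU =>
      exact .inr <| .inr <| .inr <| .inr <| .inr <| .inr <| .inr <| .inr <| .inr <| .inr <| .inr <|
        .inr <| .inr <| .inl ⟨U, Γ, Θ, Δ, hU, rfl, rfl⟩
    | d₁ h hM U Γ Θ Δ hU =>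
      exact .inr <| .inr <| .inr <| .inr <| .inr <| .inr <| .inr <| .inr <| .inr <| .inr <| .inr <|
        .inr <| .inr <| .inr <| .inl ⟨U, Γ, Θ, Δ, h, hM, hU, rfl, rfl⟩
    | d₂ h hM U V Γ Θ Δ hU hV =>
      exact .inr <| .inr <| .inr <| .inr <| .inr <| .inr <| .inr <| .inr <| .inr <| .inr <| .inr <|
        .inr <| .inr <| .inr <| .inr ⟨U, V, Γ, Θ, Δ, h, hM, hU, hV, rfl, rfl⟩
  · rintro (⟨p, Γ, Θ, Δ, rfl, rfl⟩ | ⟨_, Γ, Θ, Δ, rfl, rfl⟩ | ⟨_, Γ, Θ, Δ, rfl, rfl⟩ |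
      ⟨⟨A, B⟩, Γ, Θ, Δ, rfl, rfl⟩ | ⟨⟨A, B⟩, Γ, Θ, Δ, rfl, rfl⟩ | ⟨⟨A, B⟩, Γ, Θ, Δ, rfl, rfl⟩ |
      ⟨⟨A, B⟩, Γ, Θ, Δ, rfl, rfl⟩ | ⟨⟨A, B⟩, Γ, Θ, Δ, rfl, rfl⟩ | ⟨⟨A, B⟩, Γ, Θ, Δ, rfl, rfl⟩ |
      ⟨A, Γ, Θ, Δ, rfl, rfl⟩ | ⟨X, Γ, Θ, Δ, h, rfl, rfl⟩ | ⟨U, B, Γ, Θ, Δ, hM, hU, rfl, rfl⟩ |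
      ⟨U, B, Γ, Θ, Δ, hM, hU, rfl, rfl⟩ | ⟨U, Γ, Θ, Δ, hU, rfl, rfl⟩ |
      ⟨U, Γ, Θ, Δ, h, hM, hU, rfl, rfl⟩ | ⟨U, V, Γ, Θ, Δ, h, hM, hU, hV, rfl, rfl⟩)
    · exact .init p Γ Θ Δ
    · exact .botL Γ Θ Δ
    · exact .topR Γ Θ Δ
    · exact .impL A B Γ Θ Δ
    · exact .impR A B Γ Θ Δ
    · exact .andL A B Γ Θ Δ
    · exact .andR A B Γ Θ Δ
    · exact .orL A B Γ Θ Δ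
    · exact .orR A B Γ Θ Δ
    · exact .boxL A Γ Θ Δ
    · exact .t h X Γ Θ Δ
    · exact .boxR hM U B Γ Θ Δ hU
    · exact .boxRm hM U B Γ Θ Δ hU
    · exact .refute U Γ Θ Δ hU
    · exact .d₁ h hM U Γ Θ Δ hU
    · exact .d₂ h hM U V Γ Θ Δ hU hV

open Prog Function

/-! ### The initial position -/

def SequentList.word (S : SequentList) : List Sym := S.encode.map .inl

def SequentList.items (S : SequentList) : List Item :=
  S.form.map (.fm .L) ++ S.blocks.map .blk ++ S.succ.map (.fm .R)

theorem SequentList.toSequent_eq (S : SequentList) :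
    S.toSequent = ⟨S.form, (S.blocks.map Multiset.ofList : List (Multiset Formula)), S.succ⟩ := by
  simp [toSequent, ← List.map_eq_flatMap, Function.comp_def]

theorem SequentList.content_items (S : SequentList) : content S.items = enc S.toSequent := by
  rw [toSequent_eq]
  have h : content (S.blocks.map .blk) = ((S.blocks.map Multiset.ofList).map .blk : List AItem) := by
    rw [content, List.map_map, List.map_map]
    rfl
  simp only [items, content_append, content_map_fm, enc, h, Multiset.map_coe]

theorem SequentList.word_eq (S : SequentList) :
    S.word = S.form.flatMap Formula.word ++
      (S.blocks.flatMap (fun X => (Item.blk X).word) ++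
        (.inl .arrow :: (S.succ.flatMap Formula.word ++ [.inl .bar]))) := by
  have h : Formula.word = fun A => A.encode.map .inl := rfl
  simp [word, encode, h, Item.word, List.map_flatMap]

/-- Skip a sequent of the input. -/
def skipSeq : Program :=
  .seq (.star (formulaP false)) <|
    .seq (.star (.seq (.pop .S (.inl .blockOpen))
      (.seq (.star (formulaP false)) (.pop .S (.inl .blockClose))))) <|
    .seq (.pop .S (.inl .arrow)) <| .seq (.star (formulaP false)) (.pop .S (.inl .bar))

/-- Copy a sequent of the input, with marks. -/
def copySeq : Program :=
  .seq (.star (.seq (.push .O (.inr .L)) (formulaP true))) <|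
    .seq (.star copyBlk) <|
    .seq (.pop .S (.inl .arrow)) <|
      .seq (.star (.seq (.push .O (.inr .R)) (formulaP true))) (.pop .S (.inl .bar))

theorem tr_skipSeq : Tr skipSeq SequentList.word fun _ => [] := by
  have h : Tr (.seq (.pop .S (.inl .blockOpen))
      (.seq (.star (formulaP false)) (.pop .S (.inl .blockClose))))
      (fun X : List Formula => (Item.blk X).word) fun _ => [] :=
    ((tr_skip.star.seq (Tr.pop _)).popSeq _).congr
      (fun t => ⟨t.1, by simp [Item.word], by simp⟩) fun X => ⟨(X, ()), by simp [Item.word], by simp⟩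
  refine (tr_skip.star.seq (h.star.seq ((tr_skip.star.seq (Tr.pop _)).popSeq _))).congr
    (fun t => ⟨⟨t.1, t.2.1, t.2.2.1⟩, by rw [SequentList.word_eq], by simp⟩)
    fun S => ⟨(S.form, S.blocks, S.succ, ()), by rw [SequentList.word_eq], by simp⟩

theorem tr_copySeq : Tr copySeq SequentList.word fun S => words S.items := by
  have h : Tr copyBlk (fun X : List Formula => (Item.blk X).word) fun X => (Item.blk X).word :=
    (((tr_copy.star.seq tr_closeP).pushSeq _).popSeq _).congr
      (fun t => ⟨t.1, by simp [Item.word], by simp [Item.word]⟩)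
      fun X => ⟨(X, ()), by simp [Item.word], by simp [Item.word]⟩
  have hw : ∀ Xs : List (List Formula), words (Xs.map .blk) = Xs.flatMap fun X => (Item.blk X).word :=
    fun Xs => by simp [words, List.flatMap_map]
  refine ((tr_copy.pushSeq (.inr .L)).star.seq
    (h.star.seq (((tr_copy.pushSeq (.inr .R)).star.seq (Tr.pop _)).popSeq _))).congr
    (fun t => ⟨⟨t.1, t.2.1, t.2.2.1⟩, by rw [SequentList.word_eq], ?_⟩)
    fun S => ⟨(S.form, S.blocks, S.succ, ()), by rw [SequentList.word_eq], ?_⟩ <;>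
  simp [SequentList.items, words_map_fm, hw]

/-- Choose a sequent of the input. -/
noncomputable def startP : Program := pass (.seq (.star skipSeq) (.seq copySeq (.star skipSeq)))

theorem ptime_startP : PTime startP := ptime_pass rfl

/-- The whole input is read, so its syntax is checked while one component is chosen; a word that
denotes no hypersequent leaves the existential player stuck. -/
theorem rel_startP {x : List Sym} {s' : Stk → List Sym} : startP.Rel (tape x [] []) s' ↔
    ∃ G₁ S G₂, x = (G₁ ++ S :: G₂).flatMap SequentList.word ∧ s' = tape (words S.items) [] [] := by
  have h := tr_skipSeq.star.seq (tr_copySeq.seq tr_skipSeq.star)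
  have h0 : ∀ l : List SequentList, l.flatMap (fun _ => ([] : List Sym)) = [] := fun l =>
    List.flatMap_eq_nil_iff.2 (by simp)
  simp only [h0, List.nil_append, List.append_nil] at h
  constructor
  · rintro ⟨s₁, h1, _, ⟨hS, rfl⟩, h2⟩
    obtain ⟨⟨G₁, S, G₂⟩, u, rfl, rfl⟩ := (h _ _ _ _).1 h1
    obtain rfl : u = [] := hS
    exact ⟨G₁, S, G₂, by simp, by simpa using rel_rewindP.1 h2⟩
  · rintro ⟨G₁, S, G₂, rfl, rfl⟩
    exact ⟨_, (h _ _ _ _).2 ⟨(G₁, S, G₂), [], by simp, rfl⟩, _, ⟨rfl, rfl⟩, rel_rewindP.2 (by simp)⟩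

/-! ### Weights -/

/-- The weight of a formula on the tape. -/
def Formula.tapeWt : Formula → ℕ
  | atom i => i.bits.length + 1
  | bot => 1
  | top => 1
  | and A B => A.tapeWt + B.tapeWt + 2
  | or A B => A.tapeWt + B.tapeWt + 2
  | imp A B => A.tapeWt + B.tapeWt + 2
  | box A => A.tapeWt + 3

theorem Formula.length_word_le (A : Formula) : A.word.length ≤ A.tapeWt := by
  simp only [word, List.length_map]
  induction A <;> simp [encode, tapeWt] <;> omega

theorem Formula.tapeWt_lt (A : Formula) : A.tapeWt + 1 ≤ 4 * A.word.length := by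
  simp only [word, List.length_map]
  induction A <;> simp [encode, tapeWt] <;> omega

def formsTapeWt (X : Multiset Formula) : ℕ := (X.map fun A => A.tapeWt + 1).sum

def blocksTapeWt (Θ : Multiset (Multiset Formula)) : ℕ := (Θ.map fun X => formsTapeWt X + 2).sum

def Sequent.tapeWt (S : Sequent) : ℕ :=
  formsTapeWt S.form + blocksTapeWt S.blocks + formsTapeWt S.succ

def AItem.tapeWt : AItem → ℕ
  | fm _ A => A.tapeWt + 1
  | blk X => formsTapeWt X + 2

@[simp] theorem formsTapeWt_zero : formsTapeWt 0 = 0 := by simp [formsTapeWt]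
@[simp] theorem formsTapeWt_cons (A : Formula) (X : Multiset Formula) :
    formsTapeWt (A ::ₘ X) = A.tapeWt + 1 + formsTapeWt X := by simp [formsTapeWt]
@[simp] theorem formsTapeWt_singleton (A : Formula) : formsTapeWt {A} = A.tapeWt + 1 := by
  simp [formsTapeWt]
@[simp] theorem formsTapeWt_add (X Y : Multiset Formula) :
    formsTapeWt (X + Y) = formsTapeWt X + formsTapeWt Y := by simp [formsTapeWt]
@[simp] theorem blocksTapeWt_zero : blocksTapeWt 0 = 0 := by simp [blocksTapeWt]
@[simp] theorem blocksTapeWt_cons (X : Multiset Formula) (Θ : Multiset (Multiset Formula)) :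
    blocksTapeWt (X ::ₘ Θ) = formsTapeWt X + 2 + blocksTapeWt Θ := by simp [blocksTapeWt]

theorem blocksTapeWt_eq (U : Multiset (Multiset Formula)) :
    blocksTapeWt U = formsTapeWt U.join + 2 * U.card := by
  induction U using Multiset.induction with
  | empty => simp
  | cons X U ih => simp [ih]; omega

theorem tapeWt_lt_of_mem {A : Formula} {X : Multiset Formula} (h : A ∈ X) :
    A.tapeWt + 1 ≤ formsTapeWt X := by
  obtain ⟨X, rfl⟩ := Multiset.exists_cons_of_mem h
  simp

theorem Sequent.tapeWt_enc (S : Sequent) : ((enc S).map AItem.tapeWt).sum = S.tapeWt := by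
  simp [enc, tapeWt, formsTapeWt, blocksTapeWt, AItem.tapeWt, Function.comp_def]

/-- A binary connective weighs 2, but the two new marks that replace it cost only 1 more than the
old one. A box weighs 3 and a block only 2, so L□ gains. Rules that refute blocks remove no box, and
there the nonempty group pays. -/
theorem NRule.tapeWt_lt {L : Logic} {S T : Sequent} {Ss : Set Sequent} (h : NRule L S Ss)
    (hT : T ∈ Ss) : T.tapeWt < S.tapeWt := by
  cases h with
  | init | botL | topR => exact hT.elim
  | impL A B Γ Θ Δ =>
    rcases hT with rfl | rfl <;> simp [Sequent.tapeWt, Formula.tapeWt] <;> omega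
  | andR A B Γ Θ Δ =>
    rcases hT with rfl | rfl <;> simp [Sequent.tapeWt, Formula.tapeWt] <;> omega
  | orL A B Γ Θ Δ =>
    rcases hT with rfl | rfl <;> simp [Sequent.tapeWt, Formula.tapeWt] <;> omega
  | impR | andL | orR | boxL | t | boxRm =>
    rw [Set.mem_singleton_iff] at hT
    subst hT
    simp [Sequent.tapeWt, Formula.tapeWt, blocksTapeWt_eq]
    omega
  | refute U Γ Θ Δ hU =>
    rw [Set.mem_singleton_iff] at hT
    subst hT
    have := hU.1
    simp [Sequent.tapeWt, blocksTapeWt_eq]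
    omega
  | boxR hM U B Γ Θ Δ hU =>
    rcases hT with rfl | ⟨A, hA, rfl⟩
    · simp [Sequent.tapeWt, Formula.tapeWt, blocksTapeWt_eq]
      omega
    · have := tapeWt_lt_of_mem hA
      simp [Sequent.tapeWt, Formula.tapeWt, blocksTapeWt_eq]
      omega
  | d₁ h hM U Γ Θ Δ hU =>
    have := hU.1
    rcases hT with rfl | ⟨A, hA, rfl⟩
    · simp [Sequent.tapeWt, blocksTapeWt_eq]
      omega
    · have := tapeWt_lt_of_mem hA
      simp [Sequent.tapeWt, blocksTapeWt_eq]
      omega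
  | d₂ h hM U V Γ Θ Δ hU hV =>
    have := hU.1
    rcases hT with rfl | ⟨A, hA, B, hB, rfl⟩
    · simp [Sequent.tapeWt, blocksTapeWt_eq]
      omega
    · have := tapeWt_lt_of_mem hA
      have := tapeWt_lt_of_mem hB
      simp [Sequent.tapeWt, blocksTapeWt_eq]
      omega

theorem length_flatMap_word_le (X : List Formula) :
    (X.flatMap Formula.word).length ≤ formsTapeWt X := by
  induction X with
  | nil => simp
  | cons A X ih =>
    have := A.length_word_le
    simp only [List.flatMap_cons, List.length_append, ← Multiset.cons_coe, formsTapeWt_cons]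
    omega

theorem formsTapeWt_le (X : List Formula) :
    formsTapeWt X ≤ 4 * (X.flatMap Formula.word).length := by
  induction X with
  | nil => simp
  | cons A X ih =>
    have := A.tapeWt_lt
    simp only [List.flatMap_cons, List.length_append, ← Multiset.cons_coe, formsTapeWt_cons]
    omega

/-- The weight bounds the tape as well as the number of rounds: a mark costs 1 and the two brackets
of a block cost 2. -/
theorem length_words_le (is : List Item) :
    (words is).length ≤ ((content is).map AItem.tapeWt).sum := by
  induction is with
  | nil => simp
  | cons i is ih =>
    rw [words_cons, content_cons, Multiset.map_cons, Multiset.sum_cons, List.length_append]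
    refine Nat.add_le_add ?_ ih
    cases i with
    | fm m A =>
      have := A.length_word_le
      simp only [Item.word, Item.abs, AItem.tapeWt, List.length_cons]
      omega
    | blk X =>
      have := length_flatMap_word_le X
      simp only [Item.word, Item.abs, AItem.tapeWt, List.length_cons, List.length_append,
        List.length_nil]
      omega

theorem SequentList.tapeWt_le (S : SequentList) : S.toSequent.tapeWt ≤ 4 * S.word.length := by
  have h1 := formsTapeWt_le S.form
  have h2 := formsTapeWt_le S.succ
  have h3 : ∀ Xs : List (List Formula),
      blocksTapeWt (Xs.map Multiset.ofList : List (Multiset Formula)) ≤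
        4 * (Xs.flatMap fun X => (Item.blk X).word).length := by
    intro Xs
    induction Xs with
    | nil => simp
    | cons X Xs ih =>
      have := formsTapeWt_le X
      simp only [List.map_cons, ← Multiset.cons_coe, blocksTapeWt_cons, List.flatMap_cons,
        List.length_append, Item.word, List.length_cons, List.length_nil] at ih ⊢
      omega
  have h3 := h3 S.blocks
  rw [word_eq, toSequent_eq]
  simp only [Sequent.tapeWt, List.length_append, List.length_cons]
  omega

/-! ### The game -/

theorem enc_injective : Injective enc := by
  rintro ⟨Γ, Θ, Δ⟩ ⟨Γ', Θ', Δ'⟩ h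
  have h1 := congrArg (fun J : Multiset AItem => (J.map fun i => match i with
    | .fm .L A => ({A} : Multiset Formula) | _ => 0).sum) h
  have h2 := congrArg (fun J : Multiset AItem => (J.map fun i => match i with
    | .blk X => ({X} : Multiset (Multiset Formula)) | _ => 0).sum) h
  have h3 := congrArg (fun J : Multiset AItem => (J.map fun i => match i with
    | .fm .R A => ({A} : Multiset Formula) | _ => 0).sum) h
  simp [enc] at h1 h2 h3
  rw [h1, h2, h3]

theorem prov_iff {L : Logic} {S : Sequent} :
    Prov L S ↔ ∃ Ss, NRule L S Ss ∧ ∀ T ∈ Ss, Prov L T :=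
  ⟨fun ⟨h, hS⟩ => ⟨_, h, hS⟩, fun ⟨_, h, hS⟩ => .rule h hS⟩

/-- The tape describes a provable sequent. -/
def TapeProv (L : Logic) (s : Stk → List Sym) : Prop :=
  ∃ is S, s = tape (words is) [] [] ∧ content is = enc S ∧ Prov L S

/-- The tape determines the sequent, in whatever order its items are written. -/
theorem tapeProv_iff {L : Logic} {is : List Item} {S : Sequent} (h : content is = enc S) :
    TapeProv L (tape (words is) [] []) ↔ Prov L S := by
  constructor
  · rintro ⟨js, T, hs, hT, hP⟩
    obtain rfl := words_injective (tape_inj.1 hs).1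
    obtain rfl := enc_injective (h.symm.trans hT)
    exact hP
  · exact fun hP => ⟨is, S, rfl, h, hP⟩

noncomputable def searchPrograms (p : Program) : Phase → Program
  | .init => startP
  | .guess => p
  | .reply => replyP

/-- The rank of a position is the weight of the sequent on the tape, and its value is provability of
that sequent. The existential player first chooses a component, which by `derivable_iff_exists_prov`
decides the hypersequent. -/
theorem exists_wins (L : Logic) : ∃ (p : Program) (q : Polynomial ℕ), ∀ w : List Letter,
    Wins (searchPrograms p) (q.eval w.length) (.init, [searchPrograms p .init])
      (update (fun _ => []) .S (w.map .inl)) (w ∈ derivabilityProblem L) := by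
  obtain ⟨p, ⟨TE, hTE⟩, σ, hσ, h1, h2⟩ := exists_guesses_nRule L
  obtain ⟨TA, hTA⟩ := ptime_replyP
  obtain ⟨TI, hTI⟩ := ptime_startP
  obtain ⟨N, hN⟩ : ∃ N : Polynomial ℕ, ∀ n, N.eval n = 4 * n := ⟨4 * Polynomial.X, by simp⟩
  -- At most N + 1 rounds, each with a guess on stacks of size N, a reply on what the guess leaves
  -- and two changes of turn; before them the choice of a component and one change of turn.
  refine ⟨p, (N + 1) * (TE.comp N + TA.comp (TE.comp N) + 2) + 1 + TI, fun w => ?_⟩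
  set G := searchPrograms p with hG
  have hlen : ∀ x : List Sym, ∀ k, (tape x [] [] k).length ≤ x.length := by
    rintro x (_ | _ | _) <;> simp
  let inv : ℕ → (Stk → List Sym) → Prop := fun m s =>
    ∃ is S, s = tape (words is) [] [] ∧ content is = enc S ∧ m = S.tapeWt
  -- The same bound holds at the start of every round, so the growth within the rounds does not
  -- accumulate.
  have hlen' : ∀ m ≤ N.eval w.length, ∀ s, inv m s → ∀ k, (s k).length ≤ N.eval w.length := by
    rintro m hm _ ⟨is, S, rfl, his, rfl⟩ k
    have := length_words_le is
    rw [his, Sequent.tapeWt_enc] at this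
    exact (hlen _ k).trans (this.trans hm)
  have hgame := Wins.game (G := G) (N := N.eval w.length) (inv := inv) (W := TapeProv L)
    (tE := TE.eval (N.eval w.length)) (tA := TA.eval (TE.eval (N.eval w.length)))
    (fun m hm s hs => (hTE _ s (hlen' m hm s hs)).1 G)
    (fun m hm s s' hs hs' => (hTA _ s' ((hTE _ s (hlen' m hm s hs)).2 s' hs')).1 G)
    (by
      rintro m _ s' s'' ⟨is, S, rfl, his, rfl⟩ hs' hs''
      obtain ⟨js, rfl, hj⟩ := hσ.1 _ _ hs'
      obtain ⟨ks, rfl, hk⟩ := rewrites_replyP.1 _ _ hs''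
      rw [his] at hj
      obtain ⟨Ss, hR, hSs⟩ := h1 _ _ hj
      obtain ⟨T, hT, hkT⟩ := (hSs _).1 hk
      exact ⟨_, hR.tapeWt_lt hT, ks, T, rfl, hkT, rfl⟩)
    (by
      rintro m _ ⟨is, S, rfl, his, rfl⟩
      rw [tapeProv_iff his, prov_iff]
      constructor
      · rintro ⟨Ss, hR, hP⟩
        obtain ⟨J, hJ, hSs⟩ := h2 _ _ hR
        rw [← his] at hJ
        obtain ⟨js, rfl, hj⟩ := hσ.2 _ _ hJ
        refine ⟨_, hj, fun s'' hs'' => ?_⟩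
        obtain ⟨ks, rfl, hk⟩ := rewrites_replyP.1 _ _ hs''
        obtain ⟨T, hT, hkT⟩ := (hSs _).1 hk
        exact (tapeProv_iff hkT).2 (hP T hT)
      · rintro ⟨s', hs', h⟩
        obtain ⟨js, rfl, hj⟩ := hσ.1 _ _ hs'
        rw [his] at hj
        obtain ⟨Ss, hR, hSs⟩ := h1 _ _ hj
        refine ⟨Ss, hR, fun T hT => ?_⟩
        obtain ⟨ks, hk, hk'⟩ := rewrites_replyP.2 _ _ ((hSs _).2 ⟨T, hT, rfl⟩)
        exact (tapeProv_iff hk).1 (h _ hk'))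
  have hstart : update (fun _ => []) .S (w.map .inl) = tape (w.map .inl) [] [] := by
    funext k; cases k <;> simp
  rw [hstart]
  have hword : ∀ l : List SequentList,
      l.flatMap SequentList.word = (l.flatMap SequentList.encode).map .inl := fun l => by
    rw [List.map_flatMap]; rfl
  have hinit := (hTI w.length (tape (w.map .inl) [] []) fun k => by
    simpa using hlen (w.map .inl) k).1 G .init []
      ((N.eval w.length + 1) * (TE.eval (N.eval w.length) +
        TA.eval (TE.eval (N.eval w.length)) + 2) + 1) (TapeProv L)
  refine ((hinit fun s' hs' => ?_).mono ?_).congr ?_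
  · obtain ⟨G₁, S, G₂, hw, rfl⟩ := rel_startP.1 hs'
    have hS : S.toSequent.tapeWt ≤ N.eval w.length := by
      have h := congrArg List.length hw
      simp only [List.flatMap_append, List.flatMap_cons, List.length_append, List.length_map] at h
      have := S.tapeWt_le
      rw [hN]
      omega
    exact Wins.goto rfl ((hgame _ hS _ ⟨_, _, rfl, S.content_items, rfl⟩).mono
      (Nat.mul_le_mul_right _ (Nat.succ_le_succ hS)))
  · simp [Polynomial.eval_comp]
  · simp only [Outcome, Phase.isUniv, Bool.false_eq_true, if_false, rel_startP]
    constructor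
    · rintro ⟨_, ⟨G₁, S, G₂, hw, rfl⟩, hP⟩
      rw [tapeProv_iff S.content_items] at hP
      rw [hword] at hw
      refine ⟨_, List.map_injective_iff.2 Sum.inl_injective hw,
        derivable_iff_exists_prov.2 ⟨_, ?_, hP⟩⟩
      simp
    · rintro ⟨l, rfl, hD⟩
      obtain ⟨S, hS, hP⟩ := derivable_iff_exists_prov.1 hD
      obtain ⟨S, hS', rfl⟩ := List.mem_map.1 (Multiset.mem_coe.1 hS)
      obtain ⟨G₁, G₂, rfl⟩ := List.append_of_mem hS'
      exact ⟨_, ⟨G₁, S, G₂, by rw [hword], rfl⟩, (tapeProv_iff S.content_items).2 hP⟩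

theorem search_complexity (L : Logic) :
    InAlternatingPTime (derivabilityProblem L) ∧ InPSPACE (derivabilityProblem L) := by
  obtain ⟨p, q, h⟩ := exists_wins L
  exact decides_of_wins (searchPrograms p) .S ⟨Sum.inl, Sum.inl_injective⟩ q h

end NNML

theorem mainTheorem6 (L : NNML.Logic) :
    -- the search is correct, also when it is cut off after polynomially many steps, and up to the
    -- cut-off it only meets hypersequents of polynomial size
    (∃ p q : Polynomial ℕ, ∀ G : NNML.Hypersequent,
      (NNML.Derivable L G ↔ ∃ n, NNML.SearchSucceeds L n (NNML.searchStart L G)) ∧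
      (NNML.Derivable L G ↔
        NNML.SearchSucceeds L (p.eval (NNML.hypersequentSize G)) (NNML.searchStart L G)) ∧
      ∀ n H, n ≤ p.eval (NNML.hypersequentSize G) →
        NNML.SearchRun L n (NNML.searchStart L G) H →
          NNML.hypersequentSize H ≤ q.eval (NNML.hypersequentSize G)) ∧
    -- every run is polynomial without any cut-off, unless N is combined with one of P, D, RD
    ((L.N = true → L.P = false ∧ L.D = false ∧ L.RD = ∅) →
      ∃ p : Polynomial ℕ, ∀ (G : NNML.Hypersequent) (n : ℕ) (H : NNML.Hypersequent),
        NNML.SearchRun L n (NNML.searchStart L G) H →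
          n ≤ p.eval (NNML.hypersequentSize G) ∧
          NNML.hypersequentSize H ≤ p.eval (NNML.hypersequentSize G)) ∧
    NNML.InAlternatingPTime (NNML.derivabilityProblem L) ∧
    NNML.InPSPACE (NNML.derivabilityProblem L) := ⟨NNML.search_correct L, NNML.searchRun_bounded L, NNML.search_complexity L⟩
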